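/- Let $k$ be a field and let $Q$ be a finite quiver which is simply laced, i.e. it has at most one arrow from any vertex to another one and no loops; write $s(a)$, $t(a)$ for the source and target of an arrow $a$. Let $\Delta=(A,M)$ be a $Q$-set with zero compositions, that is: a $k$-algebra $A_x$ for each vertex $x\in Q_0$ and, for each arrow $a\in Q_1$, an $A_{t(a)}$-$A_{s(a)}$-bimodule $M_a$ (on which $k$ acts centrally). Put $A=\prod_{x\in Q_0}A_x$ and $M=\bigoplus_{a\in Q_1}M_a$, which is an $A$-bimodule by extending the actions by zero, and let $\Lambda=\Lambda_\Delta=A\oplus M$ with product $(r+m)(r'+m')=rr'+(rm'+mr')$. For a $k$-algebra $R$ let $\mathsf{HH}^n(R)=\mathrm{Ext}^n_{R\otimes R^{\mathrm{op}}}(R,R)$, and let $d$ be the coboundary of the Hochschild complex $\mathrm{Hom}_k(R^{\otimes \bullet},R)$. For a path $\omega=a_m\cdots a_1$ of $Q$ (a vertex $x$ if $m=0$), a trajectory of duration $n$ over $\omega$ is a sequence $$\tau=t(a_m)^{p_{m+1}},a_m,s(a_m)^{p_m},\dots,s(a_2)^{p_2},a_1,s(a_1)^{p_1},\qquad p_i\ge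 0,\quad m+\sum_i p_i=n$$ (where $x^p$ is $x$ repeated $p$ times; $\tau=x^n$ if $\omega=x$). Let $T_n(\omega)$ be the set of these, and let $\tau_\Delta$ be the tensor product over $k$ obtained from $\tau$ by replacing each vertex $x$ by $A_x$ and each arrow $a$ by $M_a$ ($\tau_\Delta=k$ if $n=0$). Let $\Delta_\omega=e_{t(\omega)}\Lambda e_{s(\omega)}$, where $e_x\in\Lambda$ is the unit of $A_x$. Then $\mathsf H^\bullet_\omega(\Delta)$ is the cohomology of the complex $$\mathsf K^n_\omega=\bigoplus_{\tau\in T_n(\omega)}\mathrm{Hom}_k(\tau_\Delta,\Delta_\omega),$$ where the coboundary of $f$ consists of the components, at the trajectories in $T_{n+1}(\omega)$, of the Hochschild coboundary $df$ of $f$ extended by zero to a Hochschild cochain of $\Lambda$. A path is a cycle if its source and target are equal (vertices are cycles of length $0$). Then these $\mathsf K^\bullet_\omega$ are complexes, and there are $k$-linear maps forming a long exact sequence $$\cdots\to\bigoplus_{\delta}\mathsf H^n_\delta(\Delta)\to \mathsf{HH}^n(\Lambda)\to \mathsf{HH}^n(A)\oplus\bigoplus_{\gamma}\mathsf H^n_\gamma(\Delta)\to\bigoplus_{\delta}\mathsf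 H^{n+1}_\delta(\Delta)\to\cdots\qquad(n\ge 0),$$ where in degree $n$ the index $\delta$ runs over the non cycles of length at most $n$ and $\gamma$ over the cycles of positive length at most $n$. For $n=0$ the sum over $\delta$ is zero, for $n=0,1$ the sum over $\gamma$ is zero, and for $n=1$ one has $\bigoplus_{\delta}\mathsf H^1_\delta(\Delta)\cong\mathrm{End}_{A-A}(M)$ (a cocycle $f:M_a\to M_a$ going to its extension by zero to $M$), so that the sequence starts $$0\to \mathsf{HH}^0(\Lambda)\to \mathsf{HH}^0(A)\to\mathrm{End}_{A-A}(M)\to \mathsf{HH}^1(\Lambda)\to \mathsf{HH}^1(A)\to\bigoplus_{\delta}\mathsf H^2_\delta(\Delta)\to \mathsf{HH}^2(\Lambda)\to\cdots.$$ Moreover, for suitable isomorphisms in all degrees of $\mathsf{HH}^n(\Lambda)$ and $\mathsf{HH}^n(A)$ with the cohomology of the Hochschild complexes of $\Lambda$ and $A$, the first map is induced by extension of cochains by zero, the second one by restriction of cochains of $\Lambda$ to $A$ and to the trajectories over the cycles $\gamma$ (with values projected to $A$, respectively to $\Delta_\gamma$), and the third one is the connecting homomorphism: if a Hochschild $n$-cochain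 $F$ of $\Lambda$ restricts to cocycles on $A$ and over all these $\gamma$, then the classes of these restrictions are sent to the classes of the components of $dF$ over the non cycles $\delta$ of length at most $n+1$. -/

import Mathlib

open scoped TensorProduct DirectSum

/-! ### Cohomology of a sequence of linear maps -/

section Cohomology

variable {k : Type*} [Field k] {X : ℕ → Type*} [∀ n, AddCommGroup (X n)] [∀ n, Module k (X n)]

/-- The coboundaries in degree `n` of a cochain complex `0 → X 0 → X 1 → ⋯`. -/
def coboundaries (d : ∀ n, X n →ₗ[k] X (n + 1)) : ∀ n, Submodule k (X n)
  | 0 => ⊥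
  | n + 1 => LinearMap.range (d n)

/-- The cohomology in degree `n` of a cochain complex `0 → X 0 → X 1 → ⋯`: cocycles modulo
coboundaries. -/
abbrev CochainCohomology (d : ∀ n, X n →ₗ[k] X (n + 1)) (n : ℕ) : Type _ :=
  LinearMap.ker (d n) ⧸ (coboundaries d n).submoduleOf (LinearMap.ker (d n))

/-- The cohomology class of a cocycle. -/
def cohomologyClass (d : ∀ n, X n →ₗ[k] X (n + 1)) {n : ℕ} (f : X n) (hf : d n f = 0) :
    CochainCohomology d n :=
  Submodule.Quotient.mk ⟨f, hf⟩

end Cohomology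

/-! ### Hochschild cohomology and Hochschild cochains -/

section Hochschild

variable (k : Type*) [Field k]

/-- The algebra `R` as a bimodule over itself, i.e. as a module over `R ⊗ Rᵒᵖ`. -/
noncomputable def regularBimodule (R : Type*) [Ring R] [Algebra k R] :
    ModuleCat (R ⊗[k] Rᵐᵒᵖ) :=
  letI : Module (R ⊗[k] Rᵐᵒᵖ) R := TensorProduct.Algebra.module
  ModuleCat.of (R ⊗[k] Rᵐᵒᵖ) R

/-- Hochschild cohomology `HHⁿ(R) = Extⁿ(R, R)`, where `Ext` is taken over `R ⊗ Rᵒᵖ`. -/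
noncomputable abbrev HH (R : Type*) [Ring R] [Algebra k R] (n : ℕ) : Type _ :=
  CategoryTheory.Abelian.Ext (regularBimodule k R) (regularBimodule k R) n

/-- The space `Hom_k(R ⊗ ⋯ ⊗ R, R)` of Hochschild `n`-cochains, written as multilinear maps. -/
abbrev HochschildCochain (R : Type*) [Ring R] [Algebra k R] (n : ℕ) : Type _ :=
  MultilinearMap k (fun _ : Fin n => R) R

variable {k} {R : Type*} [Ring R] [Algebra k R]

theorem contractNth_mul_update {n : ℕ} (j : Fin n) (x : Fin (n + 1) → R) (i : Fin (n + 1)) :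
    ∃ (l : Fin n) (φ : R →ₗ[k] R), ∀ a : R,
      Fin.contractNth j.castSucc (· * ·) (Function.update x i a) =
        Function.update (Fin.contractNth j.castSucc (· * ·) x) l (φ a) := by
  rcases lt_trichotomy i.val j.val with h | h | h
  · refine ⟨⟨i.val, by omega⟩, LinearMap.id, fun a => funext fun t => ?_⟩
    simp only [Fin.contractNth, Function.update_apply, Fin.ext_iff, Fin.val_castSucc, Fin.val_succ,
      LinearMap.id_apply]
    split_ifs <;> first | rfl | omega
  · refine ⟨j, LinearMap.mulRight k (x j.succ), fun a => funext fun t => ?_⟩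
    simp only [Fin.contractNth, Function.update_apply, Fin.ext_iff, Fin.val_castSucc, Fin.val_succ,
      LinearMap.mulRight_apply]
    split_ifs with h1 h2 h3 h4 h5 <;> first | rfl | omega | skip
    all_goals
      obtain rfl : t = j := Fin.ext (by omega)
      rfl
  · rcases (show i.val = j.val + 1 ∨ j.val + 1 < i.val by omega) with h' | h'
    · refine ⟨j, LinearMap.mulLeft k (x j.castSucc), fun a => funext fun t => ?_⟩
      simp only [Fin.contractNth, Function.update_apply, Fin.ext_iff, Fin.val_castSucc,
        Fin.val_succ, LinearMap.mulLeft_apply]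
      split_ifs with h1 h2 h3 h4 h5 <;> first | rfl | omega | skip
      all_goals
        obtain rfl : t = j := Fin.ext (by omega)
        rfl
    · refine ⟨⟨i.val - 1, by omega⟩, LinearMap.id, fun a => funext fun t => ?_⟩
      simp only [Fin.contractNth, Function.update_apply, Fin.ext_iff, Fin.val_castSucc,
        Fin.val_succ, LinearMap.id_apply]
      split_ifs <;> first | rfl | omega

/-- The summand `f(x₁, …, xⱼ xⱼ₊₁, …, xₙ₊₁)` of the Hochschild coboundary (here `j` counts
from `0`). -/
def contractCochain {n : ℕ} (j : Fin n) :
    HochschildCochain k R n →ₗ[k] HochschildCochain k R (n + 1) where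
  toFun f :=
    { toFun := fun x => f (Fin.contractNth j.castSucc (· * ·) x)
      map_update_add' := by
        intro inst x i a b
        obtain rfl : inst = instDecidableEqFin (n + 1) := Subsingleton.elim _ _
        obtain ⟨l, φ, h⟩ := contractNth_mul_update (k := k) j x i
        simp only [h, map_add, MultilinearMap.map_update_add]
      map_update_smul' := by
        intro inst x i c a
        obtain rfl : inst = instDecidableEqFin (n + 1) := Subsingleton.elim _ _
        obtain ⟨l, φ, h⟩ := contractNth_mul_update (k := k) j x i
        simp only [h, map_smul, MultilinearMap.map_update_smul] }
  map_add' _ _ := rfl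
  map_smul' _ _ := rfl

/-- The summand `x₁ f(x₂, …, xₙ₊₁)` of the Hochschild coboundary. -/
def leftCochain (n : ℕ) : HochschildCochain k R n →ₗ[k] HochschildCochain k R (n + 1) where
  toFun f := LinearMap.uncurryLeft
    { toFun := fun x => (LinearMap.mulLeft k x).compMultilinearMap f
      map_add' := by intros; ext; simp [add_mul]
      map_smul' := by intros; ext; simp }
  map_add' _ _ := by ext; simp
  map_smul' _ _ := by ext; simp

/-- The summand `f(x₁, …, xₙ) xₙ₊₁` of the Hochschild coboundary. -/
def rightCochain (n : ℕ) : HochschildCochain k R n →ₗ[k] HochschildCochain k R (n + 1) where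
  toFun f := MultilinearMap.uncurryRight ((LinearMap.mul k R).compMultilinearMap f)
  map_add' _ _ := by ext; simp
  map_smul' _ _ := by ext; simp

/-- The Hochschild coboundary
`(d f)(x₁, …, xₙ₊₁) = x₁ f(x₂, …, xₙ₊₁) + ∑ᵢ (-1)ⁱ f(x₁, …, xᵢ xᵢ₊₁, …, xₙ₊₁)
  + (-1)ⁿ⁺¹ f(x₁, …, xₙ) xₙ₊₁`. -/
def hochschildD (k : Type*) [Field k] (R : Type*) [Ring R] [Algebra k R] (n : ℕ) :
    HochschildCochain k R n →ₗ[k] HochschildCochain k R (n + 1) :=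
  leftCochain n + ∑ j : Fin n, (-1 : k) ^ (j.val + 1) • contractCochain j
    + (-1 : k) ^ (n + 1) • rightCochain n

/-- The cohomology of the Hochschild complex of `R`. -/
abbrev HochschildComplexCohomology (k : Type*) [Field k] (R : Type*) [Ring R] [Algebra k R]
    (n : ℕ) : Type _ :=
  CochainCohomology (X := fun n => HochschildCochain k R n) (hochschildD k R) n

/-- The class of a Hochschild cocycle. -/
def hochschildClass {n : ℕ} (F : HochschildCochain k R n) (hF : hochschildD k R n F = 0) :
    HochschildComplexCohomology k R n :=
  cohomologyClass (X := fun n => HochschildCochain k R n) (hochschildD k R) F hF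

end Hochschild

/-! ### Simply laced quivers, paths and `Q`-sets with zero compositions -/

universe u v w

/-- A quiver is simply laced if it has neither double arrows nor loops. -/
structure IsSimplyLaced (V : Type v) [Quiver.{w + 1} V] : Prop where
  thin : ∀ x y : V, Subsingleton (x ⟶ y)
  loopless : ∀ x : V, IsEmpty (x ⟶ x)

/-- The paths of length at most `n` that are not cycles. -/
structure NonCycle (V : Type v) [Quiver.{w + 1} V] (n : ℕ) where
  source : V
  target : V
  path : Quiver.Path source target
  ne : source ≠ target
  length_le : path.length ≤ n

/-- The cycles of positive length at most `n`. -/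
structure PosCycle (V : Type v) [Quiver.{w + 1} V] (n : ℕ) where
  base : V
  path : Quiver.Path base base
  pos : 0 < path.length
  length_le : path.length ≤ n

/-- A `Q`-set on the quiver `V` all of whose composition maps `α` are zero: an algebra `A x` for
each vertex `x`, and an `A (t a)`-`A (s a)`-bimodule `M a` (with `k` acting centrally) for each
arrow `a`. -/
structure QSet (k : Type*) [Field k] (V : Type v) [Quiver.{w + 1} V] where
  A : V → Type u
  [ring : ∀ x, Ring (A x)]
  [algebra : ∀ x, Algebra k (A x)]
  M : Quiver.Total V → Type u
  [addCommGroup : ∀ a, AddCommGroup (M a)]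
  [module : ∀ a, Module k (M a)]
  [leftModule : ∀ a, Module (A a.right) (M a)]
  [rightModule : ∀ a, Module (A a.left)ᵐᵒᵖ (M a)]
  [smulComm : ∀ a, SMulCommClass (A a.right) (A a.left)ᵐᵒᵖ (M a)]
  [leftTower : ∀ a, IsScalarTower k (A a.right) (M a)]
  [rightTower : ∀ a, IsScalarTower k (A a.left)ᵐᵒᵖ (M a)]

namespace QSet

attribute [instance] ring algebra addCommGroup module leftModule rightModule smulComm
  leftTower rightTower

variable {k : Type*} [Field k] {V : Type v} [Quiver.{w + 1} V] (Δ : QSet.{u} k V)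

/-- The product algebra `A = ∏ₓ Aₓ`. -/
abbrev Diag : Type _ := ∀ x, Δ.A x

/-- The direct sum `M` of the bimodules `M a`, over the arrows `a` of a finite quiver. -/
def Bimod : Type _ := ∀ a, Δ.M a

instance : AddCommGroup Δ.Bimod := inferInstanceAs (AddCommGroup (∀ a, Δ.M a))

instance : Module k Δ.Bimod := inferInstanceAs (Module k (∀ a, Δ.M a))

/-- `A` acts on the left on `M a` through its component `A (t a)`. -/
instance : Module Δ.Diag Δ.Bimod where
  smul r m := fun a => r a.right • m a
  one_smul m := funext fun a => one_smul _ (m a)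
  mul_smul r s m := funext fun a => mul_smul (r a.right) (s a.right) (m a)
  smul_zero r := funext fun a => smul_zero (r a.right)
  smul_add r m m' := funext fun a => smul_add (r a.right) (m a) (m' a)
  add_smul r s m := funext fun a => add_smul (r a.right) (s a.right) (m a)
  zero_smul m := funext fun a => zero_smul _ (m a)

/-- `A` acts on the right on `M a` through its component `A (s a)`. -/
instance : Module (Δ.Diag)ᵐᵒᵖ Δ.Bimod where
  smul r m := fun a => MulOpposite.op (r.unop a.left) • m a
  one_smul m := funext fun a => one_smul _ (m a)
  mul_smul r s m := funext fun a =>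
    mul_smul (MulOpposite.op (r.unop a.left)) (MulOpposite.op (s.unop a.left)) (m a)
  smul_zero r := funext fun a => smul_zero (MulOpposite.op (r.unop a.left))
  smul_add r m m' := funext fun a => smul_add (MulOpposite.op (r.unop a.left)) (m a) (m' a)
  add_smul r s m := funext fun a =>
    add_smul (MulOpposite.op (r.unop a.left)) (MulOpposite.op (s.unop a.left)) (m a)
  zero_smul m := funext fun a => zero_smul _ (m a)

instance : SMulCommClass Δ.Diag (Δ.Diag)ᵐᵒᵖ Δ.Bimod where
  smul_comm r s m := funext fun a => smul_comm (r a.right) (MulOpposite.op (s.unop a.left)) (m a)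

instance : IsScalarTower k Δ.Diag Δ.Bimod where
  smul_assoc c r m := funext fun a => smul_assoc c (r a.right) (m a)

instance : IsScalarTower k (Δ.Diag)ᵐᵒᵖ Δ.Bimod where
  smul_assoc c r m := funext fun a => smul_assoc c (MulOpposite.op (r.unop a.left)) (m a)

/-- The endomorphisms of `M` as an `A`-bimodule. -/
def bimodEnd : Submodule k (Δ.Bimod →ₗ[k] Δ.Bimod) where
  carrier := {f | (∀ (r : Δ.Diag) (m : Δ.Bimod), f (r • m) = r • f m) ∧
    ∀ (r : (Δ.Diag)ᵐᵒᵖ) (m : Δ.Bimod), f (r • m) = r • f m}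
  add_mem' := by
    rintro f g ⟨hf, hf'⟩ ⟨hg, hg'⟩
    exact ⟨fun r m => by simp [hf, hg], fun r m => by simp [hf', hg']⟩
  zero_mem' := ⟨fun r m => by simp, fun r m => by simp⟩
  smul_mem' := by
    rintro c f ⟨hf, hf'⟩
    refine ⟨fun r m => ?_, fun r m => ?_⟩
    · rw [LinearMap.smul_apply, LinearMap.smul_apply, hf]
      exact funext fun a => (smul_comm (r a.right) c (f m a)).symm
    · rw [LinearMap.smul_apply, LinearMap.smul_apply, hf']
      exact funext fun a => (smul_comm (MulOpposite.op (r.unop a.left)) c (f m a)).symm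

/-- The algebra `Λ_Δ = A ⊕ M` of the `Q`-set; as the compositions are zero, its product is
`(r + m)(r' + m') = r r' + (r m' + m r')`. -/
abbrev Lam : Type _ := TrivSqZeroExt Δ.Diag Δ.Bimod

/-! ### Trajectories -/

/-- The bimodule attached to an entry of a trajectory: `A x` for a vertex `x`, and `M a` for an
arrow `a`. -/
def Entry : V ⊕ Quiver.Total V → Type u
  | .inl x => Δ.A x
  | .inr a => Δ.M a

instance : ∀ e, AddCommGroup (Δ.Entry e)
  | .inl x => inferInstanceAs (AddCommGroup (Δ.A x))
  | .inr a => inferInstanceAs (AddCommGroup (Δ.M a))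

instance : ∀ e, Module k (Δ.Entry e)
  | .inl x => inferInstanceAs (Module k (Δ.A x))
  | .inr a => inferInstanceAs (Module k (Δ.M a))

open Classical in
/-- The inclusion of `A x`, respectively `M a`, as a direct summand of `Λ_Δ`. -/
noncomputable def entryIncl : ∀ e, Δ.Entry e →ₗ[k] Δ.Lam
  | .inl x => (TrivSqZeroExt.inlAlgHom k Δ.Diag Δ.Bimod).toLinearMap ∘ₗ LinearMap.single k Δ.A x
  | .inr a => ((TrivSqZeroExt.inrHom Δ.Diag Δ.Bimod).restrictScalars k) ∘ₗ
      (LinearMap.single k Δ.M a : Δ.M a →ₗ[k] Δ.Bimod)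

/-- The projection of `Λ_Δ` onto its direct summand `A x`, respectively `M a`. -/
def entryProj : ∀ e, Δ.Lam →ₗ[k] Δ.Entry e
  | .inl x => (LinearMap.proj x : Δ.Diag →ₗ[k] Δ.A x) ∘ₗ
      (TrivSqZeroExt.fstHom k Δ.Diag Δ.Bimod).toLinearMap
  | .inr a => (LinearMap.proj a : (∀ a, Δ.M a) →ₗ[k] Δ.M a) ∘ₗ
      ((TrivSqZeroExt.sndHom Δ.Diag Δ.Bimod).restrictScalars k)

open Classical in
/-- The idempotent of `Λ_Δ` given by the vertex `x`. -/
noncomputable def idem (x : V) : Δ.Lam := TrivSqZeroExt.inl (Pi.single x 1)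

/-- The linear map `z ↦ y z x` of `Λ_Δ`, for the idempotents of the vertices `x` and `y`. -/
noncomputable def cornerMap (x y : V) : Δ.Lam →ₗ[k] Δ.Lam :=
  LinearMap.mulLeft k (Δ.idem y) ∘ₗ LinearMap.mulRight k (Δ.idem x)

/-- The subspace `Δ_ω = t(ω) Λ_Δ s(ω)` of `Λ_Δ`, for paths `ω` from `x` to `y`. -/
noncomputable abbrev Corner (x y : V) : Submodule k Δ.Lam := LinearMap.range (Δ.cornerMap x y)

end QSet

section Trajectories

variable {V : Type v} [Quiver.{w + 1} V]

/-- `IsTrajectoryOver ω l` says that the list `l` of vertices and arrows is a trajectory over the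
path `ω = aₘ⋯a₁`, that is
`l = t(aₘ)^{pₘ₊₁}, aₘ, s(aₘ)^{pₘ}, …, s(a₂)^{p₂}, a₁, s(a₁)^{p₁}` for some waiting times
`p₁, …, pₘ₊₁ ≥ 0` (and `l = x^p` if `ω` is a vertex `x`). Reading from the right, each entry either
repeats the current end point or is the next arrow. -/
inductive IsTrajectoryOver : ∀ {x y : V}, Quiver.Path x y → List (V ⊕ Quiver.Total V) → Prop
  | nil (x : V) : IsTrajectoryOver (Quiver.Path.nil : Quiver.Path x x) []
  | wait {x y : V} (ω : Quiver.Path x y) (l : List (V ⊕ Quiver.Total V)) :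
      IsTrajectoryOver ω l → IsTrajectoryOver ω (.inl y :: l)
  | move {x y z : V} (ω : Quiver.Path x y) (a : y ⟶ z) (l : List (V ⊕ Quiver.Total V)) :
      IsTrajectoryOver ω l → IsTrajectoryOver (ω.cons a) (.inr ⟨y, z, a⟩ :: l)

/-- The set `Tₙ(ω)` of trajectories of duration `n` over the path `ω`, as sequences of `n`
entries. -/
def Trajectory {x y : V} (ω : Quiver.Path x y) (n : ℕ) : Type _ :=
  {τ : Fin n → V ⊕ Quiver.Total V // IsTrajectoryOver ω (List.ofFn τ)}

noncomputable instance [Finite V] [Finite (Quiver.Total V)] {x y : V} (ω : Quiver.Path x y)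
    (n : ℕ) : Fintype (Trajectory ω n) :=
  haveI : Finite (Trajectory ω n) := Subtype.finite
  Fintype.ofFinite _

end Trajectories

/-! ### Cohomology along a path -/

namespace QSet

variable {k : Type*} [Field k] {V : Type v} [Quiver.{w + 1} V] (Δ : QSet.{u} k V)
  {x y : V} (ω : Quiver.Path x y)

/-- The space `⊕_{τ ∈ Tₙ(ω)} Hom_k(τ_Δ, Δ_ω)` of `n`-cochains along `ω`. As `τ_Δ` is the tensor
product over `k` of the spaces attached to the entries of `τ`, linear maps on `τ_Δ` are written as
multilinear maps. -/
def PathCochain (n : ℕ) : Type _ :=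
  ∀ τ : Trajectory ω n, MultilinearMap k (fun i => Δ.Entry (τ.1 i)) (Δ.Corner x y)

noncomputable instance (n : ℕ) : AddCommGroup (Δ.PathCochain ω n) :=
  inferInstanceAs (AddCommGroup (∀ τ : Trajectory ω n,
    MultilinearMap k (fun i => Δ.Entry (τ.1 i)) (Δ.Corner x y)))

noncomputable instance (n : ℕ) : Module k (Δ.PathCochain ω n) :=
  inferInstanceAs (Module k (∀ τ : Trajectory ω n,
    MultilinearMap k (fun i => Δ.Entry (τ.1 i)) (Δ.Corner x y)))

/-- The component over the trajectories of `ω` of a Hochschild cochain of `Λ_Δ`. -/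
noncomputable def pathRes (n : ℕ) :
    HochschildCochain k Δ.Lam n →ₗ[k] Δ.PathCochain ω n where
  toFun F τ := (Δ.cornerMap x y).rangeRestrict.compMultilinearMap
    (F.compLinearMap fun i => Δ.entryIncl (τ.1 i))
  map_add' _ _ := funext fun _ => MultilinearMap.ext fun _ =>
    map_add (Δ.cornerMap x y).rangeRestrict _ _
  map_smul' _ _ := funext fun _ => MultilinearMap.ext fun _ =>
    map_smul (Δ.cornerMap x y).rangeRestrict _ _

variable [Finite V] [Finite (Quiver.Total V)]

/-- A cochain along `ω`, viewed as a Hochschild cochain of `Λ_Δ` (extension by zero). -/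
noncomputable def pathExt (n : ℕ) :
    Δ.PathCochain ω n →ₗ[k] HochschildCochain k Δ.Lam n where
  toFun f := ∑ τ, (Δ.Corner x y).subtype.compMultilinearMap
    ((f τ).compLinearMap fun i => Δ.entryProj (τ.1 i))
  map_add' _ _ := by
    rw [← Finset.sum_add_distrib]
    exact Finset.sum_congr rfl fun _ _ => rfl
  map_smul' _ _ := by
    rw [RingHom.id_apply, Finset.smul_sum]
    exact Finset.sum_congr rfl fun _ _ => rfl

/-- The coboundary along `ω`: apply the Hochschild coboundary of `Λ_Δ` and keep the components at
the trajectories over `ω`. Those components of `d f_τ` can be non-zero only at the trajectories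
obtained by increasing one waiting time of `τ`. -/
noncomputable def pathD (n : ℕ) : Δ.PathCochain ω n →ₗ[k] Δ.PathCochain ω (n + 1) :=
  Δ.pathRes ω (n + 1) ∘ₗ hochschildD k Δ.Lam n ∘ₗ Δ.pathExt ω n

/-- The cohomology `Hⁿ_ω(Δ)` of `Δ` along the path `ω`. -/
abbrev PathCohomology (n : ℕ) : Type _ :=
  CochainCohomology (Δ.pathD ω) n

variable {ω} in
/-- The class in `Hⁿ_ω(Δ)` of a cocycle along `ω`. -/
noncomputable def pathClass {n : ℕ} (f : Δ.PathCochain ω n) (hf : Δ.pathD ω n f = 0) :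
    Δ.PathCohomology ω n :=
  cohomologyClass (Δ.pathD ω) f hf

/-- `⊕_δ Hⁿ_δ(Δ)`, over the non cycles `δ` of length at most `n`. -/
abbrev NonCycleCohomology (n : ℕ) : Type _ :=
  ⨁ δ : NonCycle V n, Δ.PathCohomology δ.path n

/-- `⊕_γ Hⁿ_γ(Δ)`, over the cycles `γ` of positive length at most `n`. -/
abbrev PosCycleCohomology (n : ℕ) : Type _ :=
  ⨁ γ : PosCycle V n, Δ.PathCohomology γ.path n

open Classical in
/-- The class of a cocycle along the non cycle `δ`, in the direct sum over the non cycles. -/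
noncomputable def nonCycleClass {n : ℕ} (δ : NonCycle V n) (f : Δ.PathCochain δ.path n)
    (hf : Δ.pathD δ.path n f = 0) : Δ.NonCycleCohomology n :=
  DirectSum.of (fun δ : NonCycle V n => Δ.PathCohomology δ.path n) δ
    (Δ.pathClass f hf)

/-- The restriction of a Hochschild cochain of `Λ_Δ = A ⊕ M` to a Hochschild cochain of `A`. -/
def diagRes (n : ℕ) : HochschildCochain k Δ.Lam n →ₗ[k] HochschildCochain k Δ.Diag n where
  toFun F := (TrivSqZeroExt.fstHom k Δ.Diag Δ.Bimod).toLinearMap.compMultilinearMap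
    (F.compLinearMap fun _ => (TrivSqZeroExt.inlAlgHom k Δ.Diag Δ.Bimod).toLinearMap)
  map_add' _ _ := by ext; simp
  map_smul' _ _ := by ext; simp

end QSet

/-!
The long exact sequence is the one of a subcomplex of the Hochschild complex of `Λ = A ⊕ M`. The
subcomplex `QSet.offCycles` consists of the cochains whose restrictions to `A` and to all cycles
vanish. It remains to compute its cohomology, the one of the quotient, and the one of the whole
complex; the general sequence is `exists_longExactSequence`, which takes these three identifications
as surjections from cocycles with prescribed kernels.

The cohomology of the Hochschild complex is `HH`, because the bar resolution, which is contracted by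
`(a ⊗ b) ⊗ t ↦ (1 ⊗ b) ⊗ (a ⊗ t)`, is a resolution by free bimodules (`nonempty_hh_linearEquiv`).

The coboundary respects paths as far as possible. If a family of homogeneous arguments has its
degrees along a trajectory over `ω`, then multiplying two neighbours shortens a waiting time or
gives zero, since `M M = 0`. In the two outer terms of `d F`, multiplying a value of `F` by an
element of some `M a` on one side gives zero unless the remaining arguments run along a cycle, again
by `M M = 0`; and as there are no loops, `ω` itself is then not a cycle
(`QSet.pathRes_hochschildD_eq_zero`). Hence the restriction to a cycle is a chain map, and so is the
restriction of the subcomplex to a non cycle. It follows that the `K_ω` are complexes, and that the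
quotient by the subcomplex, whose elements are determined by their restrictions to `A` and to the
cycles of positive length, has cohomology `HHⁿ(A) ⊕ ⨁_γ Hⁿ_γ(Δ)` (`QSet.cycleMap_eq_zero_iff`).

The restrictions to `A` and to all paths do not determine a cochain: they only see the components at
composable arguments, with the value in the corner cut out by the end points. The Peirce projection
`π F (x) = ∑_v e_{v₀} F(e_{v₀} x₁ e_{v₁}, …) e_{vₙ}` keeps exactly these components. In a simply
laced quiver `e_y Λ e_x` is zero, one `A x` or one `M a`, so that a composable family of nonzero
homogeneous arguments runs along a unique trajectory, and `π F` is determined by the restrictions of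
`F` (`QSet.peirceProj_eq_zero`). The projection is a chain map homotopic to the identity, by
comparing the two contracting homotopies `barShift` and `barContraction` of the bar resolution
(`exists_peirceProj_sub_eq`). On the subcomplex this gives that a cocycle whose restrictions to the
non cycles vanish is a coboundary inside the subcomplex; the primitive supplied by the homotopy has
to be corrected on `A` (`QSet.exists_mem_offCycles_hochschildD_eq`). So the subcomplex has
cohomology `⨁_δ Hⁿ_δ(Δ)` (`QSet.nonCycleMap_eq_zero_iff`), the classes being represented by
extensions by zero, which are chain maps along non cycles (`QSet.hochschildD_pathExt`).

In degree one, the cocycles of the subcomplex are up to coboundaries the `A`-bimodule endomorphisms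
of `M`, and such an endomorphism is not a coboundary in the subcomplex unless it is zero, since the
`0`-cochains of the subcomplex lie in `M` and `M M = 0` (`QSet.endClass_bijective`).
-/

/-! ### Ext groups from projective resolutions -/

section ExtResolution

open CategoryTheory CategoryTheory.Limits CategoryTheory.Abelian

variable {k : Type*} [Field k]

/-- A surjection from the cocycles whose kernel consists of the coboundaries identifies its target
with the cohomology. -/
theorem nonempty_linearEquiv_cochainCohomology {X : ℕ → Type*} [∀ n, AddCommGroup (X n)]
    [∀ n, Module k (X n)] (d : ∀ n, X n →ₗ[k] X (n + 1)) (n : ℕ) {E : Type*} [AddCommGroup E]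
    [Module k E] (g : LinearMap.ker (d n) →ₗ[k] E) (hg : Function.Surjective g)
    (hk : ∀ x, g x = 0 ↔ (x : X n) ∈ coboundaries d n) :
    Nonempty (E ≃ₗ[k] CochainCohomology d n) := by
  have h : LinearMap.ker g = (coboundaries d n).submoduleOf (LinearMap.ker (d n)) := by
    ext x
    rw [LinearMap.mem_ker, hk]
    rfl
  exact ⟨(g.quotKerEquivOfSurjective hg).symm ≪≫ₗ Submodule.quotEquivOfEq _ _ h⟩

/-- Isomorphic cochain complexes have isomorphic cohomology. -/
theorem nonempty_cochainCohomology_linearEquiv {X X' : ℕ → Type*} [∀ n, AddCommGroup (X n)]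
    [∀ n, Module k (X n)] [∀ n, AddCommGroup (X' n)] [∀ n, Module k (X' n)]
    (d : ∀ n, X n →ₗ[k] X (n + 1)) (d' : ∀ n, X' n →ₗ[k] X' (n + 1)) (e₀ : ∀ n, X n ≃ X' n)
    (hadd : ∀ n x y, e₀ n (x + y) = e₀ n x + e₀ n y)
    (hsmul : ∀ n (c : k) x, e₀ n (c • x) = c • e₀ n x)
    (h₀ : ∀ n x, e₀ (n + 1) (d n x) = d' n (e₀ n x)) (n : ℕ) :
    Nonempty (CochainCohomology d n ≃ₗ[k] CochainCohomology d' n) := by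
  let e : ∀ n, X n ≃ₗ[k] X' n := fun n =>
    { e₀ n with
      map_add' := hadd n
      map_smul' := hsmul n }
  have h : ∀ n x, e (n + 1) (d n x) = d' n (e n x) := h₀
  have h' : ∀ n x, d n ((e n).symm x) = (e (n + 1)).symm (d' n x) := fun n x => by
    rw [LinearEquiv.eq_symm_apply, h, LinearEquiv.apply_symm_apply]
  let r : LinearMap.ker (d' n) →ₗ[k] LinearMap.ker (d n) :=
    ((e n).symm.toLinearMap.comp (LinearMap.ker (d' n)).subtype).codRestrict _ fun x => by
      have hx : d' n x = 0 := x.2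
      simp [h', hx]
  refine nonempty_linearEquiv_cochainCohomology d' n
    (((coboundaries d n).submoduleOf (LinearMap.ker (d n))).mkQ ∘ₗ r) ?_ fun x => ?_
  · refine (Submodule.mkQ_surjective _).comp fun y => ⟨⟨e n y, ?_⟩, ?_⟩
    · have hy : d n y = 0 := y.2
      simp [← h, hy]
    · exact Subtype.ext ((e n).symm_apply_apply _)
  · rw [LinearMap.comp_apply, Submodule.mkQ_apply, Submodule.Quotient.mk_eq_zero]
    change (e n).symm (x : X' n) ∈ coboundaries d n ↔ _
    cases n with
    | zero => simp [coboundaries]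
    | succ n =>
      simp only [coboundaries, LinearMap.mem_range]
      constructor
      · rintro ⟨y, hy⟩
        exact ⟨e n y, by rw [← h, hy, LinearEquiv.apply_symm_apply]⟩
      · rintro ⟨y, hy⟩
        exact ⟨(e n).symm y, by rw [h', hy]⟩

variable {C : Type*} [Category* C] [Abelian C] [Linear k C] [HasExt.{w} C]

/-- `Ext` is computed by any projective resolution, `k`-linearly. The induction on the degree
shifts dimensions along the kernel of the augmentation. -/
theorem nonempty_ext_linearEquiv_cochainCohomology (Y : C) (n : ℕ) :
    ∀ (X : C) (P : ℕ → C) [∀ n, Projective (P n)] (d : ∀ n, P (n + 1) ⟶ P n) (ε : P 0 ⟶ X)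
      [Epi ε] (h₀ : d 0 ≫ ε = 0) (_ : (ShortComplex.mk (d 0) ε h₀).Exact)
      (h : ∀ n, d (n + 1) ≫ d n = 0) (_ : ∀ n, (ShortComplex.mk (d (n + 1)) (d n) (h n)).Exact),
      Nonempty (Ext X Y n ≃ₗ[k] CochainCohomology (X := fun n => P n ⟶ Y)
        (fun n => Linear.leftComp k Y (d n)) n) := by
  -- `Hom(X, Y)` consists of the morphisms `P 0 ⟶ Y` that vanish on the image of `P 1`.
  have key : ∀ (X : C) (P : ℕ → C) [∀ n, Projective (P n)] (d : ∀ n, P (n + 1) ⟶ P n)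
      (ε : P 0 ⟶ X) [Epi ε] (h₀ : d 0 ≫ ε = 0) (_ : (ShortComplex.mk (d 0) ε h₀).Exact)
      (h : ∀ n, d (n + 1) ≫ d n = 0) (_ : ∀ n, (ShortComplex.mk (d (n + 1)) (d n) (h n)).Exact),
      ∃ φ : (X ⟶ Y) ≃ₗ[k] LinearMap.ker (Linear.leftComp k Y (d 0)),
        ∀ f, (φ f : P 0 ⟶ Y) = ε ≫ f := by
    intro X P _ d ε _ h₀ e₀ h e
    refine ⟨LinearEquiv.ofBijective (LinearMap.codRestrict _ (Linear.leftComp k Y ε) fun f => ?_)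
      ⟨fun f g hfg => ?_, fun f => ?_⟩, fun f => rfl⟩
    · simp [reassoc_of% h₀]
    · simpa [cancel_epi] using congrArg Subtype.val hfg
    · have hf : d 0 ≫ f.1 = 0 := f.2
      exact ⟨e₀.desc f.1 hf, Subtype.ext (e₀.g_desc f.1 hf)⟩
  induction n with
  | zero =>
    intro X P _ d ε _ h₀ e₀ h e
    obtain ⟨φ, -⟩ := key X P d ε h₀ e₀ h e
    refine nonempty_linearEquiv_cochainCohomology (X := fun n => P n ⟶ Y) _ 0
      ((Ext.linearEquiv₀.trans φ).symm.toLinearMap) (LinearEquiv.surjective _) fun x => ?_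
    simp [coboundaries]
  | succ n ih =>
    intro X P _ d ε _ h₀ e₀ h e
    let S := ShortComplex.mk (kernel.ι ε) ε (kernel.condition ε)
    have hS : S.ShortExact := { exact := ShortComplex.exact_kernel ε }
    let ε' : P 1 ⟶ kernel ε := kernel.lift ε (d 0) h₀
    have hε' : ε' ≫ kernel.ι ε = d 0 := kernel.lift_ι _ _ _
    have : Epi ε' := e₀.epi_kernelLift
    have h₀' : d 1 ≫ ε' = 0 := by
      rw [← cancel_mono (kernel.ι ε), Category.assoc, hε', h 0, zero_comp]
    have e₀' : (ShortComplex.mk (d 1) ε' h₀').Exact := by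
      let φ : ShortComplex.mk (d 1) ε' h₀' ⟶ ShortComplex.mk (d 1) (d 0) (h 0) :=
        { τ₁ := 𝟙 _, τ₂ := 𝟙 _, τ₃ := kernel.ι ε }
      have : Epi φ.τ₁ := inferInstanceAs (Epi (𝟙 _))
      have : IsIso φ.τ₂ := inferInstanceAs (IsIso (𝟙 _))
      have : Mono φ.τ₃ := inferInstanceAs (Mono (kernel.ι ε))
      exact (ShortComplex.exact_iff_of_epi_of_isIso_of_mono φ).2 (e 0)
    -- The dimension shift: as `P 0` is projective, it is surjective, and in positive degrees also
    -- injective.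
    let D : Ext (kernel ε) Y n →ₗ[k] Ext X Y (n + 1) :=
      Ext.precompOfLinear (hS.extClass) k Y (add_comm 1 n)
    have hD : Function.Surjective D := fun x =>
      Ext.contravariant_sequence_exact₃ hS Y x
        (Ext.eq_zero_of_projective (C := C) (P := P 0) _) (add_comm 1 n)
    cases n with
    | zero =>
      -- The kernel of the dimension shift consists of the morphisms that extend to `P 0`.
      obtain ⟨φ, hφ⟩ := key (kernel ε) (fun n => P (n + 1)) (fun n => d (n + 1)) ε' h₀' e₀'
        (fun n => h (n + 1)) (fun n => e (n + 1))
      let D' : (kernel ε ⟶ Y) →ₗ[k] Ext X Y 1 := D ∘ₗ Ext.linearEquiv₀.symm.toLinearMap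
      have hD' : Function.Surjective D' := hD.comp (LinearEquiv.surjective _)
      refine nonempty_linearEquiv_cochainCohomology (X := fun n => P n ⟶ Y) _ 1
        (D' ∘ₗ φ.symm.toLinearMap) (hD'.comp (LinearEquiv.surjective _)) fun x => ?_
      obtain ⟨f, rfl⟩ := φ.surjective x
      have : D' f = hS.extClass.comp (Ext.mk₀ f) (add_zero 1) := rfl
      simp only [LinearMap.comp_apply, LinearEquiv.coe_coe, LinearEquiv.symm_apply_apply, this,
        hφ]
      constructor
      · intro hf
        obtain ⟨y, hy⟩ := Ext.contravariant_sequence_exact₁ hS Y _ _ hf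
        obtain ⟨g, rfl⟩ := (Ext.linearEquiv₀ (R := k)).symm.surjective y
        refine ⟨g, ?_⟩
        have hg : kernel.ι ε ≫ g = f := by
          apply (Ext.linearEquiv₀ (R := k)).symm.injective
          exact (Ext.mk₀_comp_mk₀ _ _).symm.trans hy
        change d 0 ≫ g = ε' ≫ f
        rw [← hg, ← hε', Category.assoc]
      · rintro ⟨g, hg⟩
        have hg : d 0 ≫ g = ε' ≫ f := hg
        rw [← hε', Category.assoc, cancel_epi] at hg
        rw [← hg, ← Ext.mk₀_comp_mk₀, ← Ext.comp_assoc_of_third_deg_zero]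
        exact (congrArg (fun z => Ext.comp z (Ext.mk₀ g) (add_zero 1)) hS.extClass_comp).trans
          (by rw [Ext.zero_comp])
    | succ n =>
      obtain ⟨φ⟩ := ih (kernel ε) (fun n => P (n + 1)) (fun n => d (n + 1)) ε' h₀' e₀'
        (fun n => h (n + 1)) (fun n => e (n + 1))
      have hD' : Function.Injective D := by
        refine (injective_iff_map_eq_zero D).2 fun x hx => ?_
        obtain ⟨y, rfl⟩ := Ext.contravariant_sequence_exact₁ hS Y x (add_comm 1 (n + 1)) hx
        rw [Ext.eq_zero_of_projective (C := C) (P := P 0) y, Ext.comp_zero]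
      exact ⟨(LinearEquiv.ofBijective D ⟨hD', hD⟩).symm.trans φ⟩

open ModuleCat in
/-- Over a `k`-algebra `S`, the groups `Ext(X, Y)` in a given universe are computed by resolutions
of `X` by projective modules that are small for this universe. -/
theorem nonempty_ext_linearEquiv_of_projective_resolution {S : Type u} [Ring S] [Algebra k S]
    (X Y : ModuleCat.{u} S) [Module k Y] [IsScalarTower k S Y]
    (P : ℕ → Type v) [∀ n, AddCommGroup (P n)] [∀ n, Module S (P n)]
    [∀ n, Module.Projective S (P n)] [∀ n, Small.{u} (P n)] (d : ∀ n, P (n + 1) →ₗ[S] P n)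
    (ε : P 0 →ₗ[S] X) (hε : Function.Surjective ε) (h₀ : Function.Exact (d 0) ε)
    (h : ∀ n, Function.Exact (d (n + 1)) (d n)) (n : ℕ) :
    Nonempty (Ext X Y n ≃ₗ[k] CochainCohomology (X := fun n => P n →ₗ[S] Y)
      (fun n => LinearMap.lcomp k Y (d n)) n) := by
  -- Shrinking the modules moves the resolution to the universe of `X`.
  let e : ∀ n, Shrink.{u} (P n) ≃ₗ[S] P n := fun n => Shrink.linearEquiv S (P n)
  let Q : ℕ → ModuleCat.{u} S := fun n => ModuleCat.of S (Shrink.{u} (P n))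
  let dQ : ∀ n, Q (n + 1) ⟶ Q n := fun n =>
    ModuleCat.ofHom ((e n).symm.toLinearMap ∘ₗ d n ∘ₗ (e (n + 1)).toLinearMap)
  let εQ : Q 0 ⟶ X := ModuleCat.ofHom (ε ∘ₗ (e 0).toLinearMap)
  have : ∀ n, Projective (Q n) := fun n =>
    (IsProjective.iff_projective _).1 (inferInstanceAs (Module.Projective S (Shrink.{u} (P n))))
  have : Epi εQ := (ModuleCat.epi_iff_surjective _).2 (hε.comp (e 0).surjective)
  have z₀ : dQ 0 ≫ εQ = 0 := by
    ext x
    simpa [dQ, εQ] using h₀.apply_apply_eq_zero _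
  have z : ∀ n, dQ (n + 1) ≫ dQ n = 0 := fun n => by
    refine ModuleCat.hom_ext (LinearMap.ext fun x => ?_)
    change (e n).symm (d n (e (n + 1) ((e (n + 1)).symm (d (n + 1) (e (n + 2) x))))) = 0
    rw [LinearEquiv.apply_symm_apply, (h n).apply_apply_eq_zero, map_zero]
  obtain ⟨φ⟩ := nonempty_ext_linearEquiv_cochainCohomology (k := k) Y n X Q dQ εQ z₀
    (by
      refine (ShortComplex.ShortExact.moduleCat_exact_iff_function_exact _).2 fun x => ?_
      refine (h₀ (e 0 x)).trans ⟨?_, ?_⟩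
      · rintro ⟨y, hy⟩
        exact ⟨(e 1).symm y, (e 0).injective (by simpa [dQ] using hy)⟩
      · rintro ⟨y, rfl⟩
        exact ⟨e 1 y, by simp [dQ]⟩) z
    (fun n => by
      refine (ShortComplex.ShortExact.moduleCat_exact_iff_function_exact _).2 fun x => ?_
      change (e n).symm (d n (e (n + 1) x)) = 0 ↔ _
      rw [map_eq_zero_iff _ (e n).symm.injective]
      refine (h n (e (n + 1) x)).trans ⟨?_, ?_⟩
      · rintro ⟨y, hy⟩
        exact ⟨(e (n + 2)).symm y, (e (n + 1)).injective (by simpa [dQ] using hy)⟩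
      · rintro ⟨y, rfl⟩
        exact ⟨e (n + 2) y, by simp [dQ]⟩)
  obtain ⟨ψ⟩ := @nonempty_cochainCohomology_linearEquiv k _ (fun n => Q n ⟶ Y)
    (fun n => P n →ₗ[S] Y) (fun n => Preadditive.homGroup (Q n) Y)
    (fun n => Linear.homModule (Q n) Y) _ _ (fun n => Linear.leftComp k Y (dQ n))
    (fun n => LinearMap.lcomp k Y (d n))
    (fun n =>
      { toFun := fun f => f.hom ∘ₗ (e n).symm.toLinearMap
        invFun := fun f => ModuleCat.ofHom (f ∘ₗ (e n).toLinearMap)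
        left_inv := fun f => by ext; simp
        right_inv := fun f => by ext; simp })
    (fun n f g => rfl)
    (fun n c f => LinearMap.ext fun x => algebraMap_smul S c (f.hom ((e n).symm x)))
    (fun n f => LinearMap.ext fun x => by
      change f.hom ((e n).symm (d n (e (n + 1) ((e (n + 1)).symm x)))) = _
      rw [LinearEquiv.apply_symm_apply]
      rfl) n
  exact ⟨φ.trans ψ⟩

end ExtResolution

/-! ### The bar resolution -/

section Bar

variable (k : Type*) [Field k] (R : Type*) [Ring R] [Algebra k R]

/-- The `n`-th term `(R ⊗ Rᵒᵖ) ⊗ R^{⊗ n}` of the bar resolution of `R`. -/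
def BarModule (n : ℕ) : Type _ := (R ⊗[k] Rᵐᵒᵖ) ⊗[k] (⨂[k] (_ : Fin n), R)

noncomputable instance (n : ℕ) : AddCommGroup (BarModule k R n) :=
  inferInstanceAs (AddCommGroup ((R ⊗[k] Rᵐᵒᵖ) ⊗[k] (⨂[k] (_ : Fin n), R)))

noncomputable instance (n : ℕ) : Module (R ⊗[k] Rᵐᵒᵖ) (BarModule k R n) :=
  inferInstanceAs (Module (R ⊗[k] Rᵐᵒᵖ) ((R ⊗[k] Rᵐᵒᵖ) ⊗[k] (⨂[k] (_ : Fin n), R)))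

noncomputable instance (n : ℕ) : Module k (BarModule k R n) :=
  inferInstanceAs (Module k ((R ⊗[k] Rᵐᵒᵖ) ⊗[k] (⨂[k] (_ : Fin n), R)))

instance (n : ℕ) : IsScalarTower k (R ⊗[k] Rᵐᵒᵖ) (BarModule k R n) :=
  inferInstanceAs (IsScalarTower k (R ⊗[k] Rᵐᵒᵖ) ((R ⊗[k] Rᵐᵒᵖ) ⊗[k] (⨂[k] (_ : Fin n), R)))

instance (n : ℕ) : Module.Free (R ⊗[k] Rᵐᵒᵖ) (BarModule k R n) :=
  inferInstanceAs (Module.Free (R ⊗[k] Rᵐᵒᵖ) ((R ⊗[k] Rᵐᵒᵖ) ⊗[k] (⨂[k] (_ : Fin n), R)))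

noncomputable instance : Module k (regularBimodule k R) := inferInstanceAs (Module k R)

variable {k R}

/-- The element `s ⊗ t` of the bar module. -/
noncomputable def barMk {n : ℕ} (s : R ⊗[k] Rᵐᵒᵖ) (t : ⨂[k] (_ : Fin n), R) : BarModule k R n :=
  TensorProduct.tmul k s t

section barMk

variable {n : ℕ} (s s' : R ⊗[k] Rᵐᵒᵖ) (t t' : ⨂[k] (_ : Fin n), R)

theorem barMk_add : barMk s (t + t') = barMk s t + barMk s t' := TensorProduct.tmul_add s t t'

theorem add_barMk : barMk (s + s') t = barMk s t + barMk s' t := TensorProduct.add_tmul s s' t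

theorem sub_barMk : barMk (s - s') t = barMk s t - barMk s' t := TensorProduct.sub_tmul s s' t

theorem barMk_smul (c : k) : barMk s (c • t) = c • barMk s t := TensorProduct.tmul_smul c s t

theorem smul_barMk (c : k) : barMk (c • s) t = c • barMk s t :=
  (TensorProduct.smul_tmul' c s t).symm

theorem mul_barMk : barMk (s * s') t = s • barMk s' t := (TensorProduct.smul_tmul' s s' t).symm

theorem sum_barMk {ι : Type*} (f : Finset ι) (g : ι → R ⊗[k] Rᵐᵒᵖ) :
    barMk (∑ i ∈ f, g i) t = ∑ i ∈ f, barMk (g i) t := TensorProduct.sum_tmul f g t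

theorem barMk_eq_smul : barMk s t = s • barMk 1 t := by rw [← mul_barMk, mul_one]

/-- The map `barMk` as a bilinear map. -/
noncomputable def barMkₗ : (R ⊗[k] Rᵐᵒᵖ) →ₗ[k] (⨂[k] (_ : Fin n), R) →ₗ[k] BarModule k R n :=
  LinearMap.mk₂ k barMk add_barMk (fun c s t => smul_barMk s t c) barMk_add
    (fun c s t => barMk_smul s t c)

@[simp]
theorem barMkₗ_apply : barMkₗ s t = barMk s t := rfl

end barMk

theorem bar_induction {n : ℕ} {P : BarModule k R n → Prop}
    (add : ∀ p q, P p → P q → P (p + q))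
    (mk : ∀ (a : R) (b : Rᵐᵒᵖ) (t : ⨂[k] (_ : Fin n), R), P (barMk (a ⊗ₜ[k] b) t)) (p) : P p := by
  have h0 : P 0 := by
    have := mk 0 0 0
    rwa [show barMk ((0 : R) ⊗ₜ[k] (0 : Rᵐᵒᵖ)) (0 : ⨂[k] (_ : Fin n), R) = 0 from
      TensorProduct.tmul_zero _ _] at this
  refine TensorProduct.induction_on p h0 (fun s t => ?_) add
  refine TensorProduct.induction_on s ?_ (fun a b => mk a b t) fun s s' h h' => ?_
  · rw [TensorProduct.zero_tmul]
    exact h0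
  · rw [TensorProduct.add_tmul]
    exact add _ _ h h'

theorem regularBimodule_tmul_smul (a : R) (b : Rᵐᵒᵖ) (r : R) :
    (a ⊗ₜ[k] b) • (show regularBimodule k R from r) = a * (r * b.unop) :=
  letI : Module (R ⊗[k] Rᵐᵒᵖ) R := TensorProduct.Algebra.module
  TensorProduct.Algebra.smul_def a b r

instance : IsScalarTower k (R ⊗[k] Rᵐᵒᵖ) (regularBimodule k R) where
  smul_assoc c s r := by
    induction s with
    | zero =>
      have h : (0 : R ⊗[k] Rᵐᵒᵖ) • r = 0 := zero_smul (R ⊗[k] Rᵐᵒᵖ) r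
      rw [smul_zero]
      exact h.trans ((congrArg (c • ·) h).trans (smul_zero c)).symm
    | add s t hs ht => rw [smul_add, add_smul, add_smul, smul_add, hs, ht]
    | tmul a b =>
      rw [TensorProduct.smul_tmul']
      exact (regularBimodule_tmul_smul (c • a) b r).trans
        ((smul_mul_assoc c a _).trans
          (congrArg (c • · : R → R) (regularBimodule_tmul_smul a b r)).symm)

theorem bar_hom_ext {n : ℕ} {N : Type*} [AddCommGroup N] [Module (R ⊗[k] Rᵐᵒᵖ) N]
    {f g : BarModule k R n →ₗ[R ⊗[k] Rᵐᵒᵖ] N}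
    (h : ∀ t, f (barMk 1 t) = g (barMk 1 t)) : f = g := by
  refine LinearMap.ext fun p => ?_
  induction p using bar_induction with
  | add p q hp hq => rw [map_add, map_add, hp, hq]
  | mk a b t => rw [barMk_eq_smul, map_smul, map_smul, h]

section Lifts

variable {n : ℕ} {N : Type*} [AddCommGroup N] [Module k N]

/-- The linear map on `R^{⊗ (n + 1)} = R ⊗ R^{⊗ n}` given by a bilinear map. -/
noncomputable def consLift (g : R →ₗ[k] (⨂[k] (_ : Fin n), R) →ₗ[k] N) :
    (⨂[k] (_ : Fin (n + 1)), R) →ₗ[k] N :=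
  PiTensorProduct.lift (LinearMap.uncurryLeft (M := fun _ => R)
    ((PiTensorProduct.lift (R := k) (s := fun _ : Fin n => R) (E := N)).symm.toLinearMap ∘ₗ g))

theorem consLift_tprod (g : R →ₗ[k] (⨂[k] (_ : Fin n), R) →ₗ[k] N) (x : Fin (n + 1) → R) :
    consLift g (PiTensorProduct.tprod k x) = g (x 0) (PiTensorProduct.tprod k (Fin.tail x)) := by
  simp [consLift]

/-- The map `a, t ↦ a ⊗ t` from `R × R^{⊗ n}` to `R^{⊗ (n + 1)}`. -/
noncomputable def consTensor :
    R →ₗ[k] (⨂[k] (_ : Fin n), R) →ₗ[k] (⨂[k] (_ : Fin (n + 1)), R) :=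
  PiTensorProduct.lift.toLinearMap ∘ₗ
    MultilinearMap.curryLeft (M := fun _ => R) (PiTensorProduct.tprod k)

theorem consTensor_tprod (a : R) (x : Fin n → R) :
    consTensor a (PiTensorProduct.tprod k x) =
      PiTensorProduct.tprod k (Fin.cons (α := fun _ => R) a x) := by
  simp [consTensor]

@[simp]
theorem consLift_consTensor (g : R →ₗ[k] (⨂[k] (_ : Fin n), R) →ₗ[k] N) (a : R)
    (t : ⨂[k] (_ : Fin n), R) : consLift g (consTensor a t) = g a t := by
  have : consLift g ∘ₗ consTensor a = g a := by
    ext x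
    simp [consTensor_tprod, consLift_tprod]
  exact LinearMap.congr_fun this t

/-- Linear maps on `R^{⊗ (n + 1)}` are determined by their values on the tensors `a ⊗ t`. -/
theorem linearMap_ext_consTensor {f g : (⨂[k] (_ : Fin (n + 1)), R) →ₗ[k] N}
    (h : ∀ a t, f (consTensor a t) = g (consTensor a t)) : f = g := by
  ext x
  have := h (x 0) (PiTensorProduct.tprod k (Fin.tail x))
  simpa [consTensor_tprod] using this

variable [Module (R ⊗[k] Rᵐᵒᵖ) N] [IsScalarTower k (R ⊗[k] Rᵐᵒᵖ) N]

/-- The bimodule map on the bar module induced by a linear map on `R^{⊗ n}`. -/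
noncomputable def barLift (f : (⨂[k] (_ : Fin n), R) →ₗ[k] N) :
    BarModule k R n →ₗ[R ⊗[k] Rᵐᵒᵖ] N :=
  TensorProduct.AlgebraTensorModule.lift (LinearMap.toSpanSingleton (R ⊗[k] Rᵐᵒᵖ) _ f)

theorem barLift_barMk (f : (⨂[k] (_ : Fin n), R) →ₗ[k] N) (s : R ⊗[k] Rᵐᵒᵖ)
    (t : ⨂[k] (_ : Fin n), R) : barLift f (barMk s t) = s • f t := rfl

theorem barLift_one (f : (⨂[k] (_ : Fin n), R) →ₗ[k] N)
    (t : ⨂[k] (_ : Fin n), R) : barLift f (barMk 1 t) = f t := by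
  rw [barLift_barMk, one_smul]

/-- The linear map `t ↦ f (1 ⊗ t)` on `R^{⊗ n}`, for a linear map `f` on the bar module. -/
noncomputable def barRestrict (f : BarModule k R n →ₗ[k] N) : (⨂[k] (_ : Fin n), R) →ₗ[k] N where
  toFun t := f (barMk 1 t)
  map_add' t t' := by rw [barMk_add, map_add]
  map_smul' c t := by rw [barMk_smul, map_smul, RingHom.id_apply]

theorem bar_hom_ext_consTensor {f g : BarModule k R (n + 1) →ₗ[R ⊗[k] Rᵐᵒᵖ] N}
    (h : ∀ a t, f (barMk 1 (consTensor a t)) = g (barMk 1 (consTensor a t))) : f = g := by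
  refine bar_hom_ext fun t => ?_
  have := linearMap_ext_consTensor
    (f := barRestrict (f.restrictScalars k)) (g := barRestrict (g.restrictScalars k)) h
  exact LinearMap.congr_fun this t

end Lifts

variable {V : Type*} [Fintype V] (e : V → R)

/-- The map `(a ⊗ b) ⊗ t ↦ ∑_y (e_y ⊗ b) ⊗ (e_y a ⊗ t)` of right `R`-modules; if `∑_y e_y² = 1`,
this is a contracting homotopy of the bar resolution. -/
noncomputable def barContraction (n : ℕ) : BarModule k R n →ₗ[k] BarModule k R (n + 1) :=
  TensorProduct.lift (TensorProduct.lift (∑ y, LinearMap.mk₂ k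
    (fun a b => barMkₗ (e y ⊗ₜ b) ∘ₗ consTensor (e y * a))
    (fun a a' b => LinearMap.ext fun t => by simp [mul_add, barMk_add])
    (fun c a b => LinearMap.ext fun t => by simp)
    (fun a b b' => LinearMap.ext fun t => by simp [TensorProduct.tmul_add])
    (fun c a b => LinearMap.ext fun t => by simp)))

theorem barContraction_barMk {n : ℕ} (a : R) (b : Rᵐᵒᵖ) (t : ⨂[k] (_ : Fin n), R) :
    barContraction e n (barMk (a ⊗ₜ b) t) =
      ∑ y, barMk (e y ⊗ₜ[k] b) (consTensor (e y * a) t) := by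
  have : barContraction e n (barMk (a ⊗ₜ b) t) =
      TensorProduct.lift (∑ y, LinearMap.mk₂ k
        (fun a b => barMkₗ (e y ⊗ₜ b) ∘ₗ consTensor (e y * a)) _ _ _ _) (a ⊗ₜ b) t := rfl
  rw [this]
  simp [LinearMap.sum_apply]

/-- The usual contracting homotopy `(a ⊗ b) ⊗ t ↦ (1 ⊗ b) ⊗ (a ⊗ t)` of the bar resolution. -/
noncomputable abbrev barShift (n : ℕ) : BarModule k R n →ₗ[k] BarModule k R (n + 1) :=
  barContraction (fun _ : Unit => 1) n

theorem barShift_barMk {n : ℕ} (a : R) (b : Rᵐᵒᵖ) (t : ⨂[k] (_ : Fin n), R) :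
    barShift n (barMk (a ⊗ₜ b) t) = barMk ((1 : R) ⊗ₜ[k] b) (consTensor a t) := by
  simp [barContraction_barMk]

theorem barContraction_right_smul {n : ℕ} (b : Rᵐᵒᵖ) (p : BarModule k R n) :
    barContraction e n (((1 : R) ⊗ₜ[k] b) • p) =
      ((1 : R) ⊗ₜ[k] b) • barContraction e n p := by
  induction p using bar_induction with
  | add p q hp hq => rw [smul_add, map_add, map_add, smul_add, hp, hq]
  | mk a c t =>
    simp only [← mul_barMk, barContraction_barMk, Finset.smul_sum,
      Algebra.TensorProduct.tmul_mul_tmul, one_mul]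

theorem barContraction_eq_sum {n : ℕ} (p : BarModule k R n) :
    barContraction e n p =
      ∑ y, (e y ⊗ₜ[k] (1 : Rᵐᵒᵖ)) • barShift n ((e y ⊗ₜ[k] (1 : Rᵐᵒᵖ)) • p) := by
  induction p using bar_induction with
  | add p q hp hq => simp only [smul_add, map_add, hp, hq, Finset.sum_add_distrib]
  | mk a c t =>
    simp only [← mul_barMk, barContraction_barMk, Algebra.TensorProduct.tmul_mul_tmul,
      one_mul, mul_one, Finset.univ_unique, Finset.sum_singleton]

/-- The augmentation `a ⊗ b ↦ a b` of the bar resolution. -/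
noncomputable def barAug : BarModule k R 0 →ₗ[R ⊗[k] Rᵐᵒᵖ] regularBimodule k R :=
  barLift (PiTensorProduct.lift (MultilinearMap.constOfIsEmpty k (fun _ : Fin 0 => R)
    (show regularBimodule k R from (1 : R))))

/-- The differential of the bar resolution, defined by the requirement that `barShift` is a
contracting homotopy. -/
noncomputable def barD : ∀ n, BarModule k R (n + 1) →ₗ[R ⊗[k] Rᵐᵒᵖ] BarModule k R n
  | 0 => barLift (consLift (LinearMap.mk₂ k
      (fun a t => barMk (a ⊗ₜ[k] (1 : Rᵐᵒᵖ) - (1 : R) ⊗ₜ[k] MulOpposite.op a) t)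
      (fun a a' t => by
        simp only [TensorProduct.add_tmul, sub_barMk, MulOpposite.op_add,
          TensorProduct.tmul_add, add_barMk]; abel)
      (fun c a t => by
        rw [MulOpposite.op_smul, TensorProduct.tmul_smul, ← TensorProduct.smul_tmul', sub_barMk,
          sub_barMk, smul_barMk, smul_barMk, smul_sub])
      (fun a t t' => by rw [barMk_add])
      (fun c a t => by rw [barMk_smul])))
  | n + 1 => barLift (consLift (LinearMap.mk₂ k
      (fun a t => barMk (a ⊗ₜ[k] (1 : Rᵐᵒᵖ)) t -
        barShift n ((a ⊗ₜ[k] (1 : Rᵐᵒᵖ)) • barD n (barMk 1 t)))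
      (fun a a' t => by
        simp only [TensorProduct.add_tmul, add_barMk, add_smul, map_add]; abel)
      (fun c a t => by
        rw [← TensorProduct.smul_tmul', smul_barMk, smul_assoc, map_smul, smul_sub])
      (fun a t t' => by
        simp only [barMk_add, smul_add, map_add]; abel)
      (fun c a t => by
        have h : barD n (barMk 1 (c • t)) = c • barD n (barMk 1 t) := by
          rw [barMk_smul]
          exact map_smul ((barD n).restrictScalars k) c _
        rw [h, barMk_smul, smul_sub, smul_comm _ c, map_smul])))

theorem barD_zero_consTensor (a : R) (t : ⨂[k] (_ : Fin 0), R) :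
    barD 0 (barMk 1 (consTensor a t)) =
      barMk (a ⊗ₜ[k] (1 : Rᵐᵒᵖ) - (1 : R) ⊗ₜ[k] MulOpposite.op a) t := by
  rw [barD, barLift_one, consLift_consTensor, LinearMap.mk₂_apply]

theorem barD_succ_consTensor {n : ℕ} (a : R) (t : ⨂[k] (_ : Fin (n + 1)), R) :
    barD (n + 1) (barMk 1 (consTensor a t)) = barMk (a ⊗ₜ[k] (1 : Rᵐᵒᵖ)) t -
        barShift n ((a ⊗ₜ[k] (1 : Rᵐᵒᵖ)) • barD n (barMk 1 t)) := by
  rw [barD, barLift_one, consLift_consTensor, LinearMap.mk₂_apply]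

/-- The map `r ↦ ∑_y e_y ⊗ e_y r`, contracting the bar resolution in its lowest degree. -/
noncomputable def augContraction : regularBimodule k R →ₗ[k] BarModule k R 0 where
  toFun r := ∑ y, barMk (e y ⊗ₜ[k] MulOpposite.op (e y * (show R from r)))
    (PiTensorProduct.tprod k (Fin.elim0 : Fin 0 → R))
  map_add' r r' := by
    rw [← Finset.sum_add_distrib]
    refine Finset.sum_congr rfl fun y _ => ?_
    rw [← add_barMk, ← TensorProduct.tmul_add, ← MulOpposite.op_add]
    exact congrArg (fun z : R => barMk (e y ⊗ₜ[k] MulOpposite.op z)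
      (PiTensorProduct.tprod k (Fin.elim0 : Fin 0 → R))) (mul_add (e y) r r')
  map_smul' c r := by
    rw [RingHom.id_apply, Finset.smul_sum]
    refine Finset.sum_congr rfl fun y _ => ?_
    rw [← smul_barMk, ← TensorProduct.tmul_smul, ← MulOpposite.op_smul]
    exact congrArg (fun z : R => barMk (e y ⊗ₜ[k] MulOpposite.op z)
      (PiTensorProduct.tprod k (Fin.elim0 : Fin 0 → R))) (mul_smul_comm c (e y) r)

theorem exists_smul_tprod_zero (t : ⨂[k] (_ : Fin 0), R) :
    ∃ c : k, t = c • PiTensorProduct.tprod k (Fin.elim0 : Fin 0 → R) := by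
  induction t using PiTensorProduct.induction_on with
  | smul_tprod c f => exact ⟨c, by rw [Subsingleton.elim f Fin.elim0]⟩
  | add x y hx hy =>
    obtain ⟨c, rfl⟩ := hx
    obtain ⟨d, rfl⟩ := hy
    exact ⟨c + d, (add_smul c d _).symm⟩

theorem bar_zero_induction {P : BarModule k R 0 → Prop}
    (add : ∀ p q, P p → P q → P (p + q))
    (mk : ∀ (a : R) (b : Rᵐᵒᵖ), P (barMk (a ⊗ₜ[k] b) (PiTensorProduct.tprod k Fin.elim0))) (p) :
    P p := by
  induction p using bar_induction with
  | add p q hp hq => exact add p q hp hq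
  | mk a b t =>
    obtain ⟨c, rfl⟩ := exists_smul_tprod_zero t
    rw [barMk_smul, ← smul_barMk, TensorProduct.smul_tmul']
    exact mk _ _

theorem barAug_barMk_tprod (a : R) (b : Rᵐᵒᵖ) (x : Fin 0 → R) :
    barAug (barMk (a ⊗ₜ[k] b) (PiTensorProduct.tprod k x)) =
      (show regularBimodule k R from a * b.unop) := by
  rw [barAug, barLift_barMk, PiTensorProduct.lift.tprod]
  exact (regularBimodule_tmul_smul a b 1).trans (congrArg (a * ·) (one_mul b.unop))

theorem barAug_augContraction (he : ∑ y, e y * e y = 1) (r : regularBimodule k R) :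
    barAug (augContraction e r) = r := by
  have h : ∀ r' : R, ∑ y, e y * (e y * r') = r' := fun r' => by
    simp only [← mul_assoc, ← Finset.sum_mul, he, one_mul]
  simp only [augContraction, LinearMap.coe_mk, AddHom.coe_mk, map_sum, barAug_barMk_tprod,
    MulOpposite.unop_op]
  exact h r

theorem barD_barContraction_zero (he : ∑ y, e y * e y = 1) (p : BarModule k R 0) :
    barD 0 (barContraction e 0 p) + augContraction e (barAug p) = p := by
  induction p using bar_zero_induction with
  | add x y hx hy =>
    simp only [map_add]
    rw [add_add_add_comm, hx, hy]
  | mk a b =>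
    rw [barAug_barMk_tprod, barContraction_barMk, map_sum]
    have h1 : ∀ y, barD 0 (barMk (e y ⊗ₜ[k] b) (consTensor (e y * a)
        (PiTensorProduct.tprod k Fin.elim0))) =
        barMk ((e y * e y * a) ⊗ₜ[k] b) (PiTensorProduct.tprod k Fin.elim0) -
          barMk (e y ⊗ₜ[k] MulOpposite.op (e y * (a * b.unop)))
            (PiTensorProduct.tprod k Fin.elim0) := fun y => by
      rw [barMk_eq_smul, map_smul, barD_zero_consTensor, ← mul_barMk, mul_sub, sub_barMk,
        Algebra.TensorProduct.tmul_mul_tmul, Algebra.TensorProduct.tmul_mul_tmul, mul_one, mul_one,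
        ← mul_assoc, ← mul_assoc, MulOpposite.op_mul _ b.unop, MulOpposite.op_unop]
    simp only [h1, Finset.sum_sub_distrib, ← sum_barMk, ← TensorProduct.sum_tmul,
      ← Finset.sum_mul, he, one_mul, augContraction, LinearMap.coe_mk, AddHom.coe_mk]
    rw [sub_add_cancel]

theorem barD_barContraction_succ (he : ∑ y, e y * e y = 1) {n : ℕ} (p : BarModule k R (n + 1)) :
    barD (n + 1) (barContraction e (n + 1) p) + barContraction e n (barD n p) = p := by
  induction p using bar_induction with
  | add p q hp hq =>
    simp only [map_add]
    rw [add_add_add_comm, hp, hq]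
  | mk a b t =>
    have hb : ∀ c : R, (c ⊗ₜ[k] b) = (c ⊗ₜ[k] (1 : Rᵐᵒᵖ)) * ((1 : R) ⊗ₜ[k] b) := fun c => by
      rw [Algebra.TensorProduct.tmul_mul_tmul, mul_one, one_mul]
    have hD : barD n (barMk (a ⊗ₜ[k] b) t) = (a ⊗ₜ[k] b) • barD n (barMk 1 t) := by
      rw [barMk_eq_smul, map_smul]
    have h1 : ∀ y, barD (n + 1) (barMk (e y ⊗ₜ[k] b) (consTensor (e y * a) t)) =
        barMk ((e y * e y * a) ⊗ₜ[k] b) t - (e y ⊗ₜ[k] (1 : Rᵐᵒᵖ)) •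
          barShift n ((e y ⊗ₜ[k] (1 : Rᵐᵒᵖ)) • barD n (barMk (a ⊗ₜ[k] b) t)) := fun y => by
      rw [barMk_eq_smul, map_smul, barD_succ_consTensor, smul_sub, ← mul_barMk,
        Algebra.TensorProduct.tmul_mul_tmul, mul_one, ← mul_assoc, hb (e y),
        mul_smul, ← barContraction_right_smul, ← mul_smul, hD, ← mul_smul]
      simp only [Algebra.TensorProduct.tmul_mul_tmul, one_mul, mul_one]
    rw [barContraction_barMk, map_sum, barContraction_eq_sum]
    simp only [h1, Finset.sum_sub_distrib, ← sum_barMk, ← TensorProduct.sum_tmul,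
      ← Finset.sum_mul, he, one_mul, sub_add_cancel]

end Bar

theorem contractNth_cons_succ {R : Type*} [Mul R] {n : ℕ} (j : Fin n) (a : R)
    (y : Fin (n + 1) → R) :
    Fin.contractNth j.succ.castSucc (· * ·) (Fin.cons (α := fun _ => R) a y) =
      Fin.cons (α := fun _ => R) a (Fin.contractNth j.castSucc (· * ·) y) := by
  funext t
  refine Fin.cases ?_ (fun t => ?_) t
  · simp [Fin.contractNth]
  · simp [Fin.contractNth]

theorem contractNth_cons_zero {R : Type*} [Mul R] {n : ℕ} (a : R) (y : Fin (n + 1) → R) :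
    Fin.contractNth (0 : Fin (n + 1)).castSucc (· * ·) (Fin.cons (α := fun _ => R) a y) =
      Fin.cons (α := fun _ => R) (a * y 0) (Fin.tail y) := by
  funext t
  refine Fin.cases ?_ (fun t => ?_) t
  · simp [Fin.contractNth]
  · simp [Fin.contractNth, Fin.tail]

section BarExact

variable {k : Type*} [Field k] {R : Type*} [Ring R] [Algebra k R]

theorem sum_unit_mul : ∑ _y : Unit, (1 : R) * 1 = 1 := by simp

theorem barAug_comp_barD : barAug ∘ₗ barD (k := k) (R := R) 0 = 0 := by
  refine bar_hom_ext_consTensor fun a t => ?_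
  obtain ⟨c, rfl⟩ := exists_smul_tprod_zero t
  rw [LinearMap.comp_apply, barD_zero_consTensor, barMk_smul, sub_barMk,
    LinearMap.map_smul_of_tower, map_sub, barAug_barMk_tprod, barAug_barMk_tprod,
    LinearMap.zero_apply]
  have : (a * MulOpposite.unop 1 : R) = 1 * (MulOpposite.op a).unop := by simp
  rw [this]
  exact (congrArg (c • ·) (sub_self _)).trans (smul_zero c)

/-- The composite vanishes on the image of the contracting homotopy, which generates the bar
module. -/
theorem barD_comp_barD (n : ℕ) : barD n ∘ₗ barD (k := k) (R := R) (n + 1) = 0 := by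
  have key : ∀ n, (∀ p, barD n (barShift n (barD n p)) = barD (k := k) (R := R) n p) →
      barD n ∘ₗ barD (k := k) (R := R) (n + 1) = 0 := fun n hn => by
    refine bar_hom_ext_consTensor fun a t => ?_
    have h1 : barMk (1 : R ⊗[k] Rᵐᵒᵖ) (consTensor a t) = barShift _ (barMk (a ⊗ₜ 1) t) :=
      (barShift_barMk a 1 t).symm
    have h2 := barD_barContraction_succ (k := k) (fun _ : Unit => 1) sum_unit_mul
      (barMk (a ⊗ₜ[k] (1 : Rᵐᵒᵖ)) t)
    rw [LinearMap.comp_apply, LinearMap.zero_apply, h1, eq_sub_of_add_eq h2, map_sub, hn, sub_self]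
  induction n with
  | zero =>
    refine key 0 fun p => ?_
    have := barD_barContraction_zero (k := k) (fun _ : Unit => 1) sum_unit_mul (barD 0 p)
    rw [← LinearMap.comp_apply barAug, barAug_comp_barD, LinearMap.zero_apply, map_zero,
      add_zero] at this
    exact this
  | succ n ih =>
    refine key (n + 1) fun p => ?_
    have := barD_barContraction_succ (k := k) (fun _ : Unit => 1) sum_unit_mul (barD (n + 1) p)
    rw [← LinearMap.comp_apply (barD n), ih, LinearMap.zero_apply, map_zero, add_zero] at this
    exact this

theorem barAug_surjective : Function.Surjective (barAug (k := k) (R := R)) := fun r =>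
  ⟨_, barAug_augContraction (k := k) (fun _ : Unit => 1) sum_unit_mul r⟩

theorem barD_zero_exact : Function.Exact (barD (k := k) (R := R) 0) barAug := by
  refine fun p => ⟨fun hp => ?_, ?_⟩
  · have := barD_barContraction_zero (k := k) (fun _ : Unit => 1) sum_unit_mul p
    rw [hp, map_zero, add_zero] at this
    exact ⟨_, this⟩
  · rintro ⟨q, rfl⟩
    exact LinearMap.congr_fun barAug_comp_barD q

theorem barD_succ_exact (n : ℕ) :
    Function.Exact (barD (k := k) (R := R) (n + 1)) (barD n) := by
  refine fun p => ⟨fun hp => ?_, ?_⟩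
  · have := barD_barContraction_succ (k := k) (fun _ : Unit => 1) sum_unit_mul p
    rw [hp, map_zero, add_zero] at this
    exact ⟨_, this⟩
  · rintro ⟨q, rfl⟩
    exact LinearMap.congr_fun (barD_comp_barD n) q

/-- The differential of the bar resolution on generators. -/
theorem barD_tprod (n : ℕ) (x : Fin (n + 1) → R) :
    barD n (barMk 1 (PiTensorProduct.tprod k x)) =
      barMk (x 0 ⊗ₜ[k] (1 : Rᵐᵒᵖ)) (PiTensorProduct.tprod k (Fin.tail x)) +
      ∑ j : Fin n, (-1 : k) ^ (j.val + 1) •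
        barMk 1 (PiTensorProduct.tprod k (Fin.contractNth j.castSucc (· * ·) x)) +
      (-1 : k) ^ (n + 1) • barMk ((1 : R) ⊗ₜ[k] MulOpposite.op (x (Fin.last n)))
        (PiTensorProduct.tprod k (Fin.init x)) := by
  induction n with
  | zero =>
    obtain ⟨a, y, rfl⟩ : ∃ a y, x = Fin.cons (α := fun _ => R) a y :=
      ⟨x 0, Fin.tail x, (Fin.cons_self_tail x).symm⟩
    rw [← consTensor_tprod, barD_zero_consTensor, sub_barMk, Subsingleton.elim (Fin.init _) y]
    simp [sub_eq_add_neg]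
  | succ n ih =>
    obtain ⟨a, y, rfl⟩ : ∃ a y, x = Fin.cons (α := fun _ => R) a y :=
      ⟨x 0, Fin.tail x, (Fin.cons_self_tail x).symm⟩
    have hinit : Fin.init (Fin.cons (α := fun _ => R) a y) =
        Fin.cons (α := fun _ => R) a (Fin.init y) := by
      funext t
      refine Fin.cases rfl (fun t => rfl) t
    have hlast : Fin.cons (α := fun _ => R) a y (Fin.last (n + 1)) = y (Fin.last n) := rfl
    rw [← consTensor_tprod, barD_succ_consTensor, ih, Fin.sum_univ_succ, hinit, hlast,
      Fin.cons_zero, Fin.tail_cons, contractNth_cons_zero]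
    simp only [smul_add, map_add, Finset.smul_sum, map_sum, contractNth_cons_succ,
      smul_comm _ (_ : k), map_smul, ← mul_barMk, Algebra.TensorProduct.tmul_mul_tmul, mul_one,
      one_mul, barShift_barMk, consTensor_tprod, Fin.val_zero, Fin.val_succ, zero_add, pow_one,
      pow_succ _ (_ + 1), mul_neg, neg_smul, Finset.sum_neg_distrib, one_smul,
      ← Algebra.TensorProduct.one_def]
    abel

theorem hochschildD_apply {n : ℕ} (F : HochschildCochain k R n) (x : Fin (n + 1) → R) :
    hochschildD k R n F x = x 0 * F (Fin.tail x) +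
      ∑ j : Fin n, (-1 : k) ^ (j.val + 1) • F (Fin.contractNth j.castSucc (· * ·) x) +
      (-1 : k) ^ (n + 1) • (F (Fin.init x) * x (Fin.last n)) := by
  simp [hochschildD, leftCochain, rightCochain, contractCochain]

/-- Hochschild cochains are the bimodule maps on the bar resolution. -/
noncomputable def barHomEquiv (n : ℕ) : HochschildCochain k R n ≃
    (BarModule k R n →ₗ[R ⊗[k] Rᵐᵒᵖ] regularBimodule k R) where
  toFun F := barLift (PiTensorProduct.lift
    (show MultilinearMap k (fun _ : Fin n => R) (regularBimodule k R) from F))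
  invFun g := show MultilinearMap k (fun _ : Fin n => R) (regularBimodule k R) from
    (barRestrict (g.restrictScalars k)).compMultilinearMap (PiTensorProduct.tprod k)
  left_inv F := by
    refine MultilinearMap.ext fun x => ?_
    exact (barLift_one (N := regularBimodule k R) (PiTensorProduct.lift
      (show MultilinearMap k (fun _ : Fin n => R) (regularBimodule k R) from F)) _).trans
      (PiTensorProduct.lift.tprod x)
  right_inv g := by
    refine bar_hom_ext fun t => ?_
    rw [barLift_one]
    induction t using PiTensorProduct.induction_on with
    | smul_tprod c x =>
      rw [map_smul, PiTensorProduct.lift.tprod, barMk_smul, LinearMap.map_smul_of_tower]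
      rfl
    | add t t' h h' => rw [map_add, h, h', barMk_add, map_add]

theorem barHomEquiv_one_tprod {n : ℕ} (F : HochschildCochain k R n) (x : Fin n → R) :
    barHomEquiv n F (barMk 1 (PiTensorProduct.tprod k x)) = (show regularBimodule k R from F x) :=
  (barLift_one _ _).trans (PiTensorProduct.lift.tprod x)

theorem barHomEquiv_tmul_tprod {n : ℕ} (F : HochschildCochain k R n) (a : R) (b : Rᵐᵒᵖ)
    (x : Fin n → R) :
    barHomEquiv n F (barMk (a ⊗ₜ b) (PiTensorProduct.tprod k x)) =
      (show regularBimodule k R from a * (F x * b.unop)) := by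
  rw [barMk_eq_smul, map_smul, barHomEquiv_one_tprod]
  exact regularBimodule_tmul_smul a b (F x)

/-- Bimodule maps on the bar module are determined by the associated Hochschild cochain. -/
theorem barHom_ext {n : ℕ} {f g : BarModule k R n →ₗ[R ⊗[k] Rᵐᵒᵖ] regularBimodule k R}
    (h : ∀ x, f (barMk 1 (PiTensorProduct.tprod k x)) = g (barMk 1 (PiTensorProduct.tprod k x))) :
    f = g :=
  (barHomEquiv n).symm.injective (MultilinearMap.ext h)

/-- The Hochschild coboundary is dual to the differential of the bar resolution. -/
theorem barHomEquiv_hochschildD {n : ℕ} (F : HochschildCochain k R n) :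
    barHomEquiv (n + 1) (hochschildD k R n F) = barHomEquiv n F ∘ₗ barD n := by
  refine barHom_ext fun x => ?_
  have hsmul : ∀ (c : k) (p : BarModule k R n), barHomEquiv n F (c • p) = c • barHomEquiv n F p :=
    fun c p => LinearMap.map_smul_of_tower _ c p
  rw [barHomEquiv_one_tprod, hochschildD_apply, LinearMap.comp_apply, barD_tprod]
  simp only [map_add, map_sum, hsmul, barHomEquiv_tmul_tprod, barHomEquiv_one_tprod,
    MulOpposite.unop_op, MulOpposite.unop_one, mul_one, one_mul]
  rfl

theorem hochschildD_comp_hochschildD (n : ℕ) (F : HochschildCochain k R n) :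
    hochschildD k R (n + 1) (hochschildD k R n F) = 0 := by
  apply (barHomEquiv (n + 2)).injective
  rw [barHomEquiv_hochschildD, barHomEquiv_hochschildD, LinearMap.comp_assoc, barD_comp_barD,
    LinearMap.comp_zero]
  refine barHom_ext fun x => ?_
  rw [barHomEquiv_one_tprod]
  rfl

end BarExact

section HochschildExt

variable (k : Type*) [Field k] (R : Type u) [Ring R] [Algebra k R]

/-- Every element of the bar module is a finite sum of elements `s ⊗ x₁ ⊗ ⋯ ⊗ xₙ`, so its size is
bounded by that of `R` even if `k` lives in a larger universe. -/
instance small_barModule (n : ℕ) : Small.{u} (BarModule k R n) := by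
  let f : ((Fin n → R) →₀ (R ⊗[k] Rᵐᵒᵖ)) →ₗ[R ⊗[k] Rᵐᵒᵖ] BarModule k R n :=
    Finsupp.linearCombination _ fun x => barMk 1 (PiTensorProduct.tprod k x)
  refine small_of_surjective (f := f) fun p => ?_
  induction p using bar_induction with
  | add p q hp hq =>
    obtain ⟨x, rfl⟩ := hp
    obtain ⟨y, rfl⟩ := hq
    exact ⟨x + y, map_add f x y⟩
  | mk a b t =>
    induction t using PiTensorProduct.induction_on with
    | smul_tprod c x =>
      refine ⟨Finsupp.single x (c • a ⊗ₜ b), ?_⟩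
      rw [barMk_smul, ← smul_barMk, barMk_eq_smul]
      exact Finsupp.linearCombination_single _ _ _
    | add t t' h h' =>
      obtain ⟨x, hx⟩ := h
      obtain ⟨y, hy⟩ := h'
      exact ⟨x + y, by rw [map_add, hx, hy, barMk_add]⟩

/-- Hochschild cohomology is the cohomology of the Hochschild complex, as the latter is the complex
of bimodule maps from the bar resolution to `R`. -/
theorem nonempty_hh_linearEquiv (n : ℕ) :
    Nonempty (HH k R n ≃ₗ[k] HochschildComplexCohomology k R n) := by
  obtain ⟨φ⟩ := nonempty_ext_linearEquiv_of_projective_resolution (k := k)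
    (regularBimodule k R) (regularBimodule k R) (BarModule k R) barD barAug barAug_surjective
    barD_zero_exact barD_succ_exact n
  obtain ⟨ψ⟩ := nonempty_cochainCohomology_linearEquiv (X := fun n => HochschildCochain k R n)
    (hochschildD k R)
    (fun n => LinearMap.lcomp k (regularBimodule k R) (barD (k := k) (R := R) n)) barHomEquiv
    (fun n F G => barHom_ext fun x => by
      rw [LinearMap.add_apply, barHomEquiv_one_tprod, barHomEquiv_one_tprod,
        barHomEquiv_one_tprod]
      rfl)
    (fun n c F => barHom_ext fun x => by
      rw [LinearMap.smul_apply, barHomEquiv_one_tprod, barHomEquiv_one_tprod]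
      rfl)
    (fun n F => barHomEquiv_hochschildD F) n
  exact ⟨φ.trans ψ.symm⟩

end HochschildExt

/-! ### The Peirce projection of Hochschild cochains -/

section Normalization

variable {k : Type*} [Field k] {R : Type*} [Ring R] [Algebra k R] {V : Type*} [Fintype V]
  (e : V → R)

/-- The endomorphism of the bar resolution that replaces `1 ⊗ (x₁ ⊗ ⋯ ⊗ xₙ)` by the sum of
`(e_{v₀} ⊗ e_{vₙ}) ⊗ (e_{v₀} x₁ e_{v₁} ⊗ ⋯ ⊗ e_{vₙ₋₁} xₙ e_{vₙ})` over all sequences `v`. It is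
defined by the recursion that makes `barContraction` and `barShift` correspond. -/
noncomputable def barProj : ∀ n, BarModule k R n →ₗ[R ⊗[k] Rᵐᵒᵖ] BarModule k R n
  | 0 => barLift (barMkₗ (∑ y, e y ⊗ₜ[k] MulOpposite.op (e y)))
  | n + 1 => barLift (consLift (LinearMap.mk₂ k
      (fun a t => barContraction e n ((a ⊗ₜ[k] (1 : Rᵐᵒᵖ)) • barProj n (barMk 1 t)))
      (fun a a' t => by rw [TensorProduct.add_tmul, add_smul, map_add])
      (fun c a t => by rw [← TensorProduct.smul_tmul', smul_assoc, map_smul])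
      (fun a t t' => by rw [barMk_add, map_add, smul_add, map_add])
      (fun c a t => by
        have h : barProj n (barMk 1 (c • t)) = c • barProj n (barMk 1 t) := by
          rw [barMk_smul]
          exact map_smul ((barProj n).restrictScalars k) c _
        rw [h, smul_comm, map_smul])))

theorem barProj_zero (s : R ⊗[k] Rᵐᵒᵖ) (t : ⨂[k] (_ : Fin 0), R) :
    barProj e 0 (barMk s t) = ∑ y, barMk (s * e y ⊗ₜ[k] MulOpposite.op (e y)) t := by
  rw [barProj, barLift_barMk, barMkₗ_apply, ← mul_barMk, Finset.mul_sum, sum_barMk]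

theorem barProj_succ_consTensor {n : ℕ} (a : R) (t : ⨂[k] (_ : Fin n), R) :
    barProj e (n + 1) (barMk 1 (consTensor a t)) =
      barContraction e n ((a ⊗ₜ[k] (1 : Rᵐᵒᵖ)) • barProj e n (barMk 1 t)) := by
  rw [barProj, barLift_one, consLift_consTensor, LinearMap.mk₂_apply]

theorem barProj_barShift {n : ℕ} (p : BarModule k R n) :
    barProj e (n + 1) (barShift n p) = barContraction e n (barProj e n p) := by
  induction p using bar_induction with
  | add p q hp hq => simp only [map_add, hp, hq]
  | mk a b t =>
    have h : barProj e n (barMk (a ⊗ₜ[k] b) t) = (a ⊗ₜ[k] b) • barProj e n (barMk 1 t) := by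
      rw [barMk_eq_smul, map_smul]
    rw [barShift_barMk, barMk_eq_smul, map_smul, barProj_succ_consTensor,
      ← barContraction_right_smul, ← mul_smul, Algebra.TensorProduct.tmul_mul_tmul, one_mul,
      mul_one, h]

theorem barProj_tprod (n : ℕ) (x : Fin n → R) :
    barProj e n (barMk (1 : R ⊗[k] Rᵐᵒᵖ) (PiTensorProduct.tprod k x)) =
      ∑ v : Fin (n + 1) → V, barMk (e (v 0) ⊗ₜ[k] MulOpposite.op (e (v (Fin.last n))))
        (PiTensorProduct.tprod k fun i => e (v i.castSucc) * (x i * e (v i.succ))) := by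
  induction n with
  | zero =>
    rw [barProj_zero]
    refine Fintype.sum_equiv (Equiv.funUnique (Fin 1) V).symm _ _ fun y => ?_
    rw [one_mul]
    exact congrArg (fun x => barMk _ (PiTensorProduct.tprod k x)) (Subsingleton.elim _ _)
  | succ n ih =>
    obtain ⟨a, y, rfl⟩ : ∃ a y, x = Fin.cons (α := fun _ => R) a y :=
      ⟨x 0, Fin.tail x, (Fin.cons_self_tail x).symm⟩
    rw [← consTensor_tprod, barProj_succ_consTensor, ih, Finset.smul_sum, map_sum]
    simp only [← mul_barMk, Algebra.TensorProduct.tmul_mul_tmul, one_mul, barContraction_barMk,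
      consTensor_tprod]
    rw [Finset.sum_comm, ← Fintype.sum_prod_type']
    refine Fintype.sum_equiv (Fin.consEquiv fun _ => V) _ _ fun z => ?_
    congr 2
    funext i
    refine Fin.cases rfl (fun i => ?_) i
    simp [Fin.consEquiv]

theorem barAug_barProj (he : ∑ y, e y * e y = 1) (p : BarModule k R 0) :
    barAug (barProj e 0 p) = barAug p := by
  induction p using bar_zero_induction with
  | add p q hp hq => simp only [map_add, hp, hq]
  | mk a b =>
    have h : ∀ a b : R, ∑ y, a * e y * (e y * b) = a * b := fun a b => by
      simp only [mul_assoc, ← Finset.mul_sum]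
      simp only [← mul_assoc, ← Finset.sum_mul, he, one_mul]
    simp only [barProj_zero, map_sum, Algebra.TensorProduct.tmul_mul_tmul, barAug_barMk_tprod,
      MulOpposite.unop_mul, MulOpposite.unop_op]
    exact h a b.unop

/-- The map `barProj` is a chain map, since it corresponds to two contracting homotopies of the same
resolution. -/
theorem barD_barProj (he : ∑ y, e y * e y = 1) (n : ℕ) :
    barD n ∘ₗ barProj (k := k) e (n + 1) = barProj e n ∘ₗ barD (k := k) n := by
  induction n with
  | zero =>
    refine bar_hom_ext_consTensor fun a t => ?_
    have h1 := barD_barContraction_zero (k := k) e he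
      ((a ⊗ₜ[k] (1 : Rᵐᵒᵖ)) • barProj e 0 (barMk 1 t))
    rw [LinearMap.comp_apply, LinearMap.comp_apply, barProj_succ_consTensor,
      eq_sub_of_add_eq h1, barD_zero_consTensor, sub_barMk, map_sub, map_smul, barAug_barProj e he,
      barProj_zero, barProj_zero, barProj_zero, Finset.smul_sum, ← map_smul, ← mul_barMk, mul_one]
    simp only [← mul_barMk, one_mul, Algebra.TensorProduct.tmul_mul_tmul]
    congr 1
    obtain ⟨c, rfl⟩ := exists_smul_tprod_zero t
    rw [barMk_smul, LinearMap.map_smul_of_tower, barAug_barMk_tprod, map_smul]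
    simp only [barMk_smul, ← Finset.smul_sum]
    refine congrArg (c • ·) (Finset.sum_congr rfl fun y _ => ?_)
    rw [MulOpposite.unop_one, mul_one, MulOpposite.op_mul]
  | succ n ih =>
    refine bar_hom_ext_consTensor fun a t => ?_
    have h1 := barD_barContraction_succ (k := k) e he
      ((a ⊗ₜ[k] (1 : Rᵐᵒᵖ)) • barProj e (n + 1) (barMk 1 t))
    rw [LinearMap.comp_apply, LinearMap.comp_apply, barProj_succ_consTensor,
      eq_sub_of_add_eq h1, barD_succ_consTensor, map_sub, barProj_barShift, (barD n).map_smul,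
      (barProj (k := k) e n).map_smul, barMk_eq_smul (a ⊗ₜ[k] (1 : Rᵐᵒᵖ)),
      (barProj (k := k) e (n + 1)).map_smul, ← LinearMap.comp_apply (barD n), ih,
      LinearMap.comp_apply]

/-- A homotopy between `barProj` and the identity of the bar resolution, if `∑_y e_y² = 1`. -/
noncomputable def barHomotopy : ∀ n, BarModule k R n →ₗ[R ⊗[k] Rᵐᵒᵖ] BarModule k R (n + 1)
  | 0 => barLift (barRestrict (barShift 0 ∘ₗ
      (barProj (k := k) e 0 - LinearMap.id).restrictScalars k))
  | n + 1 => barLift (barRestrict (barShift (n + 1) ∘ₗ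
      (barProj (k := k) e (n + 1) - LinearMap.id - barHomotopy n ∘ₗ barD n).restrictScalars k))

theorem barD_comp_barHomotopy_zero (he : ∑ y, e y * e y = 1) :
    barD 0 ∘ₗ barHomotopy (k := k) e 0 = barProj (k := k) e 0 - LinearMap.id := by
  refine bar_hom_ext fun t => ?_
  have h := barD_barContraction_zero (k := k) (fun _ : Unit => 1) sum_unit_mul
    (barProj (k := k) e 0 (barMk 1 t) - barMk 1 t)
  rw [map_sub barAug, barAug_barProj e he, sub_self, map_zero, add_zero] at h
  rw [LinearMap.comp_apply, barHomotopy, barLift_one]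
  exact h

theorem barD_comp_barHomotopy_succ (he : ∑ y, e y * e y = 1) (n : ℕ) :
    barD (n + 1) ∘ₗ barHomotopy (k := k) e (n + 1) =
      barProj (k := k) e (n + 1) - LinearMap.id - barHomotopy (k := k) e n ∘ₗ barD (k := k) n := by
  have key : ∀ n, barD n ∘ₗ barHomotopy (k := k) e n ∘ₗ barD (k := k) n =
      (barProj (k := k) e n - LinearMap.id) ∘ₗ barD (k := k) n →
      barD (n + 1) ∘ₗ barHomotopy (k := k) e (n + 1) =
        barProj (k := k) e (n + 1) - LinearMap.id -
          barHomotopy (k := k) e n ∘ₗ barD (k := k) n := fun n hn => by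
    refine bar_hom_ext fun t => ?_
    have h := barD_barContraction_succ (k := k) (fun _ : Unit => 1) sum_unit_mul
      ((barProj (k := k) e (n + 1) - LinearMap.id -
        barHomotopy (k := k) e n ∘ₗ barD (k := k) n : BarModule k R (n + 1) →ₗ[_] _) (barMk 1 t))
    -- `barShift` inverts the differential on cycles.
    have h0 : barD n ((barProj (k := k) e (n + 1) - LinearMap.id -
        barHomotopy (k := k) e n ∘ₗ barD (k := k) n : BarModule k R (n + 1) →ₗ[_] _)
        (barMk (1 : R ⊗[k] Rᵐᵒᵖ) t)) = 0 := by
      rw [← LinearMap.comp_apply, LinearMap.comp_sub, LinearMap.comp_sub, hn, barD_barProj e he,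
        LinearMap.sub_comp, LinearMap.comp_id, LinearMap.id_comp, sub_self, LinearMap.zero_apply]
    rw [h0, map_zero, add_zero] at h
    rw [LinearMap.comp_apply, barHomotopy, barLift_one]
    exact h
  induction n with
  | zero =>
    refine key 0 ?_
    rw [← LinearMap.comp_assoc, barD_comp_barHomotopy_zero e he]
  | succ n ih =>
    refine key (n + 1) ?_
    rw [← LinearMap.comp_assoc, ih,
      LinearMap.sub_comp _ _ (barHomotopy (k := k) e n ∘ₗ barD (k := k) n),
      LinearMap.comp_assoc, barD_comp_barD, LinearMap.comp_zero, sub_zero]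

/-- The map `F ↦ ∑_v e_{v₀} F(e_{v₀} x₁ e_{v₁}, …, e_{vₙ₋₁} xₙ e_{vₙ}) e_{vₙ}` of the
Hochschild complex. For a complete family of orthogonal idempotents `e`, it is the projection onto
the cochains compatible with the Peirce decomposition. -/
noncomputable def peirceProj (n : ℕ) : HochschildCochain k R n →ₗ[k] HochschildCochain k R n where
  toFun F := ∑ v : Fin (n + 1) → V,
    (LinearMap.mulLeft k (e (v 0)) ∘ₗ LinearMap.mulRight k (e (v (Fin.last n)))).compMultilinearMap
      (F.compLinearMap fun i =>
        LinearMap.mulLeft k (e (v i.castSucc)) ∘ₗ LinearMap.mulRight k (e (v i.succ)))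
  map_add' F G := by
    rw [← Finset.sum_add_distrib]
    refine Finset.sum_congr rfl fun v _ => MultilinearMap.ext fun x => ?_
    simp [add_mul, mul_add]
  map_smul' c F := by
    rw [RingHom.id_apply, Finset.smul_sum]
    refine Finset.sum_congr rfl fun v _ => MultilinearMap.ext fun x => ?_
    simp

theorem peirceProj_apply {n : ℕ} (F : HochschildCochain k R n) (x : Fin n → R) :
    peirceProj e n F x = ∑ v : Fin (n + 1) → V, e (v 0) *
      (F (fun i => e (v i.castSucc) * (x i * e (v i.succ))) * e (v (Fin.last n))) := by
  simp [peirceProj]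

theorem barHomEquiv_peirceProj {n : ℕ} (F : HochschildCochain k R n) :
    barHomEquiv n (peirceProj e n F) = barHomEquiv n F ∘ₗ barProj e n := by
  refine barHom_ext fun x => ?_
  rw [barHomEquiv_one_tprod, peirceProj_apply, LinearMap.comp_apply, barProj_tprod]
  simp only [map_sum, barHomEquiv_tmul_tprod, MulOpposite.unop_op]
  rfl

theorem hochschildD_peirceProj (he : ∑ y, e y * e y = 1) {n : ℕ} (F : HochschildCochain k R n) :
    hochschildD k R n (peirceProj e n F) = peirceProj e (n + 1) (hochschildD k R n F) := by
  apply (barHomEquiv (n + 1)).injective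
  rw [barHomEquiv_hochschildD, barHomEquiv_peirceProj, barHomEquiv_peirceProj,
    barHomEquiv_hochschildD, LinearMap.comp_assoc, LinearMap.comp_assoc, barD_barProj e he]

theorem barHomEquiv_sub {n : ℕ} (F G : HochschildCochain k R n) :
    barHomEquiv n (F - G) = barHomEquiv n F - barHomEquiv n G :=
  barHom_ext fun x => by
    rw [LinearMap.sub_apply, barHomEquiv_one_tprod, barHomEquiv_one_tprod, barHomEquiv_one_tprod]
    rfl

theorem barHomEquiv_zero (n : ℕ) : barHomEquiv n (0 : HochschildCochain k R n) = 0 :=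
  barHom_ext fun x => by
    rw [LinearMap.zero_apply, barHomEquiv_one_tprod]
    rfl

/-- In degree zero there are no coboundaries, so cocycles are fixed. -/
theorem peirceProj_eq_self_of_cocycle (he : ∑ y, e y * e y = 1) (F : HochschildCochain k R 0)
    (hF : hochschildD k R 0 F = 0) : peirceProj e 0 F = F := by
  rw [← sub_eq_zero]
  apply (barHomEquiv 0).injective
  have h : barHomEquiv 0 F ∘ₗ barD 0 = 0 := by
    rw [← barHomEquiv_hochschildD, hF]
    exact barHomEquiv_zero _
  rw [barHomEquiv_sub, barHomEquiv_peirceProj]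
  have h2 : barHomEquiv 0 F ∘ₗ (barProj e 0 - LinearMap.id) = 0 := by
    rw [← barD_comp_barHomotopy_zero e he, ← LinearMap.comp_assoc, h, LinearMap.zero_comp]
  rw [LinearMap.comp_sub, LinearMap.comp_id] at h2
  rw [h2, barHomEquiv_zero]

/-- A Hochschild cocycle is cohomologous to its Peirce projection. -/
theorem exists_peirceProj_sub_eq (he : ∑ y, e y * e y = 1) {n : ℕ}
    (F : HochschildCochain k R (n + 1)) (hF : hochschildD k R (n + 1) F = 0) :
    ∃ G, peirceProj e (n + 1) F - F = hochschildD k R n G := by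
  have h : barHomEquiv (n + 1) F ∘ₗ barD (n + 1) = 0 := by
    rw [← barHomEquiv_hochschildD, hF]
    exact barHomEquiv_zero _
  refine ⟨(barHomEquiv n).symm (barHomEquiv (n + 1) F ∘ₗ barHomotopy e n), ?_⟩
  apply (barHomEquiv (n + 1)).injective
  have h2 : barHomEquiv (n + 1) F ∘ₗ (barProj (k := k) e (n + 1) - LinearMap.id -
      barHomotopy (k := k) e n ∘ₗ barD (k := k) n) = 0 := by
    rw [← barD_comp_barHomotopy_succ e he, ← LinearMap.comp_assoc, h, LinearMap.zero_comp]
  rw [LinearMap.comp_sub, LinearMap.comp_sub, LinearMap.comp_id, sub_eq_zero] at h2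
  rw [barHomEquiv_hochschildD, Equiv.apply_symm_apply, barHomEquiv_sub, barHomEquiv_peirceProj, h2,
    LinearMap.comp_assoc]

end Normalization

/-! ### The long exact sequence of a subcomplex -/

section LongExactSequence

variable {k : Type*} [Field k]

theorem exists_linearMap_factor {M X Y : Type*} [AddCommGroup M] [Module k M] [AddCommGroup X]
    [Module k X] [AddCommGroup Y] [Module k Y] (f : M →ₗ[k] X) (hf : Function.Surjective f)
    (g : M →ₗ[k] Y) (h : ∀ m, f m = 0 → g m = 0) : ∃ φ : X →ₗ[k] Y, ∀ m, φ (f m) = g m := by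
  obtain ⟨s, hs⟩ := f.exists_rightInverse_of_surjective (LinearMap.range_eq_top.2 hf)
  refine ⟨g ∘ₗ s, fun m => sub_eq_zero.1 ?_⟩
  rw [LinearMap.comp_apply, ← map_sub]
  refine h _ ?_
  rw [map_sub, ← LinearMap.comp_apply f s, hs, LinearMap.id_apply, sub_self]

variable {C X Y E : ℕ → Type*} [∀ n, AddCommGroup (C n)] [∀ n, Module k (C n)]
  [∀ n, AddCommGroup (X n)] [∀ n, Module k (X n)] [∀ n, AddCommGroup (Y n)] [∀ n, Module k (Y n)]
  [∀ n, AddCommGroup (E n)] [∀ n, Module k (E n)]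

/-- The long exact sequence `⋯ → Hⁿ(N) → Hⁿ(C) → Hⁿ(C / N) → Hⁿ⁺¹(N) → ⋯` of a subcomplex `N` of a
cochain complex `C`. The cohomology of `N`, of `C` and of `C / N` may be replaced by any spaces `Y`,
`E` and `X` that come with surjections from the cocycles and the right kernels; a cocycle of `C / N`
is represented by a cochain `F` with `d F ∈ N`. -/
theorem exists_longExactSequence (d : ∀ n, C n →ₗ[k] C (n + 1))
    (hd : ∀ n x, d (n + 1) (d n x) = 0) (N : ∀ n, Submodule k (C n))
    (α : ∀ n, (N (n + 1)).comap (d n) →ₗ[k] X n) (hα : ∀ n, Function.Surjective (α n))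
    (kα : ∀ n F, α n F = 0 ↔ ∃ b ∈ coboundaries d n, (F : C n) - b ∈ N n)
    (β : ∀ n, (N n ⊓ LinearMap.ker (d n) : Submodule k (C n)) →ₗ[k] Y n)
    (hβ : ∀ n, Function.Surjective (β n)) (kβ₀ : ∀ z, β 0 z = 0 → (z : C 0) = 0)
    (kβ : ∀ n z, β (n + 1) z = 0 ↔ ∃ G ∈ N n, d n G = z)
    (κ : ∀ n, LinearMap.ker (d n) →ₗ[k] E n) (hκ : ∀ n, Function.Surjective (κ n))
    (kκ : ∀ n z, κ n z = 0 ↔ (z : C n) ∈ coboundaries d n) :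
    ∃ (i : ∀ n, Y n →ₗ[k] E n) (p : ∀ n, E n →ₗ[k] X n) (conn : ∀ n, X n →ₗ[k] Y (n + 1)),
      (∀ n, Function.Exact (i n) (p n)) ∧ (∀ n, Function.Exact (p n) (conn n)) ∧
      (∀ n, Function.Exact (conn n) (i (n + 1))) ∧
      (∀ n z (hN : z ∈ N n) (hz : d n z = 0), i n (β n ⟨z, hN, hz⟩) = κ n ⟨z, hz⟩) ∧
      (∀ n z (hz : d n z = 0) (hN : d n z ∈ N (n + 1)), p n (κ n ⟨z, hz⟩) = α n ⟨z, hN⟩) ∧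
      (∀ n F (hF : d n F ∈ N (n + 1)),
        conn n (α n ⟨F, hF⟩) = β (n + 1) ⟨d n F, hF, hd n F⟩) := by
  have hcob : ∀ n, ∀ b ∈ coboundaries d n, d n b = 0 := by
    rintro (_ | n) b hb
    · rw [(Submodule.mem_bot k).1 hb, map_zero]
    · obtain ⟨c, rfl⟩ := hb
      exact hd n c
  -- Each map is defined on representing cochains; the assumptions on the kernels let it factor
  -- through the classes.
  have hi : ∀ n, ∃ i : Y n →ₗ[k] E n, ∀ z,
      i (β n z) = κ n (Submodule.inclusion inf_le_right z) := fun n => by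
    refine exists_linearMap_factor (β n) (hβ n) (κ n ∘ₗ Submodule.inclusion inf_le_right) ?_
    intro z hz
    refine (kκ n _).2 ?_
    cases n with
    | zero => exact (Submodule.mem_bot k).2 (kβ₀ z hz)
    | succ n =>
      obtain ⟨G, -, hG⟩ := (kβ n z).1 hz
      exact ⟨G, hG⟩
  have hcW : ∀ n, LinearMap.ker (d n) ≤ (N (n + 1)).comap (d n) := fun n z hz => by
    rw [Submodule.mem_comap, LinearMap.mem_ker.1 hz]
    exact zero_mem _
  have hp : ∀ n, ∃ p : E n →ₗ[k] X n, ∀ z, p (κ n z) = α n (Submodule.inclusion (hcW n) z) :=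
    fun n => by
      refine exists_linearMap_factor (κ n) (hκ n) (α n ∘ₗ Submodule.inclusion (hcW n)) ?_
      intro z hz
      exact (kα n _).2 ⟨z, (kκ n z).1 hz, by simp⟩
  let D : ∀ n, (N (n + 1)).comap (d n) →ₗ[k]
      (N (n + 1) ⊓ LinearMap.ker (d (n + 1)) : Submodule k (C (n + 1))) := fun n =>
    (d n ∘ₗ Submodule.subtype _).codRestrict _ fun F => ⟨F.2, hd n F⟩
  have hconn : ∀ n, ∃ c : X n →ₗ[k] Y (n + 1), ∀ F, c (α n F) = β (n + 1) (D n F) := fun n => by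
    refine exists_linearMap_factor (α n) (hα n) (β (n + 1) ∘ₗ D n) ?_
    intro F hF
    obtain ⟨b, hb, hG⟩ := (kα n F).1 hF
    refine (kβ n _).2 ⟨_, hG, ?_⟩
    rw [map_sub, hcob n b hb, sub_zero]
    rfl
  choose i hi using hi
  choose p hp using hp
  choose c hc using hconn
  refine ⟨i, p, c, fun n e => ⟨fun he => ?_, ?_⟩, fun n x => ⟨fun hx => ?_, ?_⟩,
    fun n y => ⟨fun hy => ?_, ?_⟩, fun n z hN hz => hi n _, fun n z hz hN => hp n _,
    fun n F hF => hc n _⟩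
  · obtain ⟨z, rfl⟩ := hκ n e
    rw [hp] at he
    obtain ⟨b, hb, hG⟩ := (kα n _).1 he
    have hz : d n ((z : C n) - b) = 0 := by
      rw [map_sub, hcob n b hb, sub_zero]
      exact z.2
    refine ⟨β n ⟨_, hG, hz⟩, ?_⟩
    rw [hi, ← sub_eq_zero, ← map_sub]
    refine (kκ n _).2 ?_
    have : (z : C n) - b - z = -b := by abel
    exact (congrArg (· ∈ coboundaries d n) this).mpr (neg_mem hb)
  · rintro ⟨y, rfl⟩
    obtain ⟨z, rfl⟩ := hβ n y
    rw [hi, hp]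
    exact (kα n _).2 ⟨0, zero_mem _, by simpa using z.2.1⟩
  · obtain ⟨F, rfl⟩ := hα n x
    rw [hc] at hx
    obtain ⟨G, hG, hGF⟩ := (kβ n _).1 hx
    have hFG : d n ((F : C n) - G) = 0 := by
      rw [map_sub, hGF]
      exact sub_self _
    refine ⟨κ n ⟨_, hFG⟩, ?_⟩
    rw [hp, ← sub_eq_zero, ← map_sub]
    refine (kα n _).2 ⟨0, zero_mem _, ?_⟩
    have : (F : C n) - G - F = -G := by abel
    rw [sub_zero]
    exact (congrArg (· ∈ N n) this).mpr (neg_mem hG)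
  · rintro ⟨e, rfl⟩
    obtain ⟨z, rfl⟩ := hκ n e
    rw [hp, hc]
    refine (kβ n _).2 ⟨0, zero_mem _, ?_⟩
    rw [map_zero]
    exact z.2.symm
  · obtain ⟨z, rfl⟩ := hβ (n + 1) y
    rw [hi] at hy
    obtain ⟨F, hF⟩ := (kκ (n + 1) _).1 hy
    have hF : d n F = z := hF
    refine ⟨α n ⟨F, ?_⟩, ?_⟩
    · rw [Submodule.mem_comap, hF]
      exact z.2.1
    · rw [hc]
      exact congrArg _ (Subtype.ext hF)
  · rintro ⟨x, rfl⟩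
    obtain ⟨F, rfl⟩ := hα n x
    rw [hc, hi]
    exact (kκ (n + 1) _).2 ⟨F, rfl⟩

end LongExactSequence

/-! ### The Peirce decomposition of `Λ` -/

namespace QSet

variable {k : Type*} [Field k] {V : Type v} [Quiver.{w + 1} V] (Δ : QSet.{u} k V)

/-- The target of an entry of a trajectory. -/
def entryTarget : V ⊕ Quiver.Total V → V
  | .inl x => x
  | .inr a => a.right

/-- The source of an entry of a trajectory. -/
def entrySource : V ⊕ Quiver.Total V → V
  | .inl x => x
  | .inr a => a.left

variable {Δ}

theorem lam_ext {l m : Δ.Lam} (h₁ : ∀ x, l.fst x = m.fst x) (h₂ : ∀ a, l.snd a = m.snd a) :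
    l = m :=
  TrivSqZeroExt.ext (funext h₁) (funext h₂)

theorem fst_mul_apply (l m : Δ.Lam) (x : V) : (l * m).fst x = l.fst x * m.fst x := rfl

theorem snd_mul_apply (l m : Δ.Lam) (a : Quiver.Total V) :
    (l * m).snd a = l.fst a.right • m.snd a + MulOpposite.op (m.fst a.left) • l.snd a := rfl

open Classical in
theorem fst_idem_apply (x y : V) : (Δ.idem x).fst y = if y = x then 1 else 0 := by
  rw [idem, TrivSqZeroExt.fst_inl]
  split_ifs with h
  · subst h
    rw [Pi.single_eq_same]
  · rw [Pi.single_eq_of_ne h]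

theorem snd_idem_apply (x : V) (a : Quiver.Total V) : (Δ.idem x).snd a = 0 := rfl

open Classical in
theorem fst_idem_mul (x y : V) (l : Δ.Lam) :
    (Δ.idem x * l).fst y = if y = x then l.fst y else 0 := by
  rw [fst_mul_apply, fst_idem_apply, ite_mul, one_mul, zero_mul]

open Classical in
theorem snd_idem_mul (x : V) (l : Δ.Lam) (a : Quiver.Total V) :
    (Δ.idem x * l).snd a = if a.right = x then l.snd a else 0 := by
  rw [snd_mul_apply, fst_idem_apply, snd_idem_apply, smul_zero, add_zero, ite_smul, one_smul,
    zero_smul]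

open Classical in
theorem fst_mul_idem (x y : V) (l : Δ.Lam) :
    (l * Δ.idem x).fst y = if y = x then l.fst y else 0 := by
  rw [fst_mul_apply, fst_idem_apply, mul_ite, mul_one, mul_zero]

open Classical in
theorem snd_mul_idem (x : V) (l : Δ.Lam) (a : Quiver.Total V) :
    (l * Δ.idem x).snd a = if a.left = x then l.snd a else 0 := by
  rw [snd_mul_apply, fst_idem_apply, snd_idem_apply, smul_zero, zero_add]
  split_ifs with h
  · rw [MulOpposite.op_one, one_smul]
  · rw [MulOpposite.op_zero, zero_smul]

theorem idem_mul_self (x : V) : Δ.idem x * Δ.idem x = Δ.idem x :=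
  lam_ext (fun y => by rw [fst_idem_mul, fst_idem_apply]; split_ifs <;> rfl)
    (fun a => by rw [snd_idem_mul, snd_idem_apply, ite_self])

theorem idem_mul_idem_of_ne {x y : V} (h : x ≠ y) : Δ.idem x * Δ.idem y = 0 :=
  lam_ext
    (fun z => by
      rw [fst_idem_mul, fst_idem_apply]
      split_ifs with h₁ h₂
      · exact absurd (h₁.symm.trans h₂) h
      · rfl
      · rfl)
    (fun a => by rw [snd_idem_mul, snd_idem_apply, ite_self]; rfl)

theorem sum_idem_mul_idem [Fintype V] : ∑ x, Δ.idem x * Δ.idem x = 1 := by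
  classical
  simp only [idem_mul_self]
  simp only [idem]
  rw [← TrivSqZeroExt.inl_one]
  refine (map_sum (TrivSqZeroExt.inlHom Δ.Diag Δ.Bimod) _ _).symm.trans (congrArg _ ?_)
  funext y
  rw [Finset.sum_apply, Finset.sum_eq_single y, Pi.single_eq_same, Pi.one_apply]
  · intro x _ h
    exact Pi.single_eq_of_ne h.symm _
  · exact fun h => absurd (Finset.mem_univ _) h

theorem mem_range_entryIncl_inl {x : V} {l : Δ.Lam} :
    l ∈ LinearMap.range (Δ.entryIncl (.inl x)) ↔ l.snd = 0 ∧ ∀ y, y ≠ x → l.fst y = 0 := by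
  classical
  constructor
  · rintro ⟨r, rfl⟩
    exact ⟨rfl, fun y hy => Pi.single_eq_of_ne hy _⟩
  · rintro ⟨h₁, h₂⟩
    refine ⟨l.fst x, lam_ext (fun y => ?_) fun a => (congrFun h₁ a).symm⟩
    change (Pi.single x (l.fst x) : Δ.Diag) y = l.fst y
    by_cases hy : y = x
    · subst hy
      rw [Pi.single_eq_same]
    · rw [Pi.single_eq_of_ne hy, h₂ y hy]

theorem mem_range_entryIncl_inr {a : Quiver.Total V} {l : Δ.Lam} :
    l ∈ LinearMap.range (Δ.entryIncl (.inr a)) ↔ l.fst = 0 ∧ ∀ b, b ≠ a → l.snd b = 0 := by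
  classical
  constructor
  · rintro ⟨r, rfl⟩
    exact ⟨rfl, fun y hy => Pi.single_eq_of_ne hy _⟩
  · rintro ⟨h₁, h₂⟩
    refine ⟨l.snd a, lam_ext (fun y => (congrFun h₁ y).symm) fun b => ?_⟩
    change (Pi.single a (l.snd a) : ∀ a, Δ.M a) b = l.snd b
    by_cases hy : b = a
    · subst hy
      rw [Pi.single_eq_same]
    · rw [Pi.single_eq_of_ne hy, h₂ b hy]

theorem entryProj_entryIncl (e : V ⊕ Quiver.Total V) (m : Δ.Entry e) :
    Δ.entryProj e (Δ.entryIncl e m) = m := by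
  classical
  cases e with
  | inl x => exact Pi.single_eq_same (M := Δ.A) x m
  | inr a => exact Pi.single_eq_same (M := Δ.M) a m

theorem entryProj_entryIncl_of_ne {e e' : V ⊕ Quiver.Total V} (h : e ≠ e') (m : Δ.Entry e) :
    Δ.entryProj e' (Δ.entryIncl e m) = 0 := by
  classical
  cases e with
  | inl x =>
    cases e' with
    | inl y => exact Pi.single_eq_of_ne (M := Δ.A) (fun h' => h (congrArg _ h'.symm)) m
    | inr b => rfl
  | inr a =>
    cases e' with
    | inl y => rfl
    | inr b => exact Pi.single_eq_of_ne (M := Δ.M) (fun h' => h (congrArg _ h'.symm)) m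

theorem entryProj_inl_of_isRight {e : V ⊕ Quiver.Total V} (h : ∃ a, e = .inr a) (r : Δ.Diag) :
    Δ.entryProj e (TrivSqZeroExt.inl r) = 0 := by
  obtain ⟨a, rfl⟩ := h
  rfl

theorem idem_mul_entryIncl {e : V ⊕ Quiver.Total V} {l : Δ.Lam}
    (h : l ∈ LinearMap.range (Δ.entryIncl e)) : Δ.idem (entryTarget e) * l = l := by
  cases e with
  | inl x =>
    obtain ⟨h₁, h₂⟩ := mem_range_entryIncl_inl.1 h
    refine lam_ext (fun y => ?_) (fun a => ?_)
    · rw [fst_idem_mul]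
      split_ifs with hy
      · rfl
      · exact (h₂ y hy).symm
    · rw [snd_idem_mul, h₁]
      exact ite_self _
  | inr a =>
    obtain ⟨h₁, h₂⟩ := mem_range_entryIncl_inr.1 h
    refine lam_ext (fun y => ?_) (fun b => ?_)
    · rw [fst_idem_mul, h₁]
      exact ite_self _
    · rw [snd_idem_mul]
      split_ifs with hb
      · rfl
      · refine (h₂ b fun hba => hb ?_).symm
        rw [hba]
        rfl

theorem entryIncl_mul_idem {e : V ⊕ Quiver.Total V} {l : Δ.Lam}
    (h : l ∈ LinearMap.range (Δ.entryIncl e)) : l * Δ.idem (entrySource e) = l := by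
  cases e with
  | inl x =>
    obtain ⟨h₁, h₂⟩ := mem_range_entryIncl_inl.1 h
    refine lam_ext (fun y => ?_) (fun a => ?_)
    · rw [fst_mul_idem]
      split_ifs with hy
      · rfl
      · exact (h₂ y hy).symm
    · rw [snd_mul_idem, h₁]
      exact ite_self _
  | inr a =>
    obtain ⟨h₁, h₂⟩ := mem_range_entryIncl_inr.1 h
    refine lam_ext (fun y => ?_) (fun b => ?_)
    · rw [fst_mul_idem, h₁]
      exact ite_self _
    · rw [snd_mul_idem]
      split_ifs with hb
      · rfl
      · refine (h₂ b fun hba => hb ?_).symm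
        rw [hba]
        rfl

theorem entryProj_idem_mul_idem (e : V ⊕ Quiver.Total V) (l : Δ.Lam) :
    Δ.entryProj e (Δ.idem (entryTarget e) * (l * Δ.idem (entrySource e))) = Δ.entryProj e l := by
  cases e with
  | inl x =>
    change (Δ.idem x * (l * Δ.idem x)).fst x = l.fst x
    rw [fst_idem_mul, if_pos rfl, fst_mul_idem, if_pos rfl]
  | inr a =>
    change (Δ.idem a.right * (l * Δ.idem a.left)).snd a = l.snd a
    rw [snd_idem_mul, if_pos rfl, snd_mul_idem, if_pos rfl]

theorem entryProj_mul_idem_of_ne {e : V ⊕ Quiver.Total V} {x : V} (h : entrySource e ≠ x)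
    (l m : Δ.Lam) : Δ.entryProj e (l * (m * Δ.idem x)) = 0 := by
  rw [← mul_assoc]
  cases e with
  | inl y =>
    change (l * m * Δ.idem x).fst y = 0
    exact (fst_mul_idem x y _).trans (if_neg h)
  | inr a =>
    change (l * m * Δ.idem x).snd a = 0
    exact (snd_mul_idem x _ a).trans (if_neg h)

/-- In a simply laced quiver, every Peirce component of `Λ` is spanned by at most one `A x` or
`M a`. -/
theorem idem_mul_idem_mem_range (hQ : IsSimplyLaced V) (x y : V) (l : Δ.Lam) :
    Δ.idem y * (l * Δ.idem x) = 0 ∨ ∃ e, entryTarget e = y ∧ entrySource e = x ∧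
      Δ.idem y * (l * Δ.idem x) ∈ LinearMap.range (Δ.entryIncl e) := by
  have hs : ∀ a : Quiver.Total V, (Δ.idem y * (l * Δ.idem x)).snd a ≠ 0 →
      a.right = y ∧ a.left = x := fun a ha => by
    rw [snd_idem_mul, snd_mul_idem] at ha
    split_ifs at ha with h₁ h₂
    · exact ⟨h₁, h₂⟩
    · exact absurd rfl ha
    · exact absurd rfl ha
  have hf : ∀ z, (Δ.idem y * (l * Δ.idem x)).fst z ≠ 0 → z = y ∧ z = x := fun z hz => by
    rw [fst_idem_mul, fst_mul_idem] at hz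
    split_ifs at hz with h₁ h₂
    · exact ⟨h₁, h₂⟩
    · exact absurd rfl hz
    · exact absurd rfl hz
  by_cases h : ∃ a : x ⟶ y, True
  · obtain ⟨a, -⟩ := h
    refine Or.inr ⟨.inr ⟨x, y, a⟩, rfl, rfl, mem_range_entryIncl_inr.2 ⟨funext fun z => ?_, ?_⟩⟩
    · by_contra hz
      obtain ⟨rfl, rfl⟩ := hf z hz
      exact (hQ.loopless z).false a
    · rintro ⟨x', y', b⟩ hb
      by_contra hz
      obtain ⟨h₁, h₂⟩ := hs _ hz
      have h₁ : y' = y := h₁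
      have h₂ : x' = x := h₂
      subst h₁ h₂
      exact hb (by rw [(hQ.thin x' y').elim b a])
  · have hs' : (Δ.idem y * (l * Δ.idem x)).snd = 0 := by
      funext a
      by_contra hz
      obtain ⟨h₁, h₂⟩ := hs a hz
      subst h₁ h₂
      exact h ⟨a.hom, trivial⟩
    by_cases hxy : x = y
    · subst hxy
      exact Or.inr ⟨.inl x, rfl, rfl, mem_range_entryIncl_inl.2
        ⟨hs', fun z hz => by_contra fun h' => hz (hf z h').1⟩⟩
    · refine Or.inl (lam_ext (fun z => ?_) fun a => congrFun hs' a)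
      by_contra h'
      obtain ⟨rfl, rfl⟩ := hf z h'
      exact hxy rfl

theorem mem_corner_iff {x y : V} {l : Δ.Lam} :
    l ∈ Δ.Corner x y ↔ Δ.idem y * (l * Δ.idem x) = l := by
  refine ⟨?_, fun h => ⟨l, h⟩⟩
  rintro ⟨m, rfl⟩
  change Δ.idem y * (Δ.idem y * (m * Δ.idem x) * Δ.idem x) = Δ.idem y * (m * Δ.idem x)
  rw [mul_assoc (Δ.idem y), mul_assoc m, idem_mul_self, ← mul_assoc (Δ.idem y) (Δ.idem y),
    idem_mul_self]

theorem corner_eq_self {x y : V} (c : Δ.Corner x y) :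
    Δ.idem y * ((c : Δ.Lam) * Δ.idem x) = c := mem_corner_iff.1 c.2

theorem idem_mul_corner_of_ne {x y z : V} (h : z ≠ y) (c : Δ.Corner x y) :
    Δ.idem z * (c : Δ.Lam) = 0 := by
  rw [← corner_eq_self c, ← mul_assoc, idem_mul_idem_of_ne h, zero_mul]

/-! ### Products of homogeneous elements of `Λ` -/

theorem inl_mul_inl_mem {x : V} {l m : Δ.Lam} (hl : l ∈ LinearMap.range (Δ.entryIncl (.inl x)))
    (hm : m ∈ LinearMap.range (Δ.entryIncl (.inl x))) :
    l * m ∈ LinearMap.range (Δ.entryIncl (.inl x)) := by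
  rw [mem_range_entryIncl_inl] at *
  refine ⟨funext fun a => ?_, fun y hy => ?_⟩
  · rw [snd_mul_apply, hl.1, hm.1]
    change l.fst a.right • (0 : Δ.M a) + MulOpposite.op (m.fst a.left) • (0 : Δ.M a) = 0
    rw [smul_zero, smul_zero, add_zero]
  · rw [fst_mul_apply, hl.2 y hy, zero_mul]

theorem inl_mul_inr_mem {x : V} {a : Quiver.Total V} {l m : Δ.Lam}
    (hl : l ∈ LinearMap.range (Δ.entryIncl (.inl x)))
    (hm : m ∈ LinearMap.range (Δ.entryIncl (.inr a))) :
    l * m ∈ LinearMap.range (Δ.entryIncl (.inr a)) := by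
  rw [mem_range_entryIncl_inl] at hl
  rw [mem_range_entryIncl_inr] at *
  refine ⟨funext fun y => ?_, fun b hb => ?_⟩
  · rw [fst_mul_apply, hm.1]
    exact mul_zero _
  · rw [snd_mul_apply, hl.1, hm.2 b hb, smul_zero, zero_add]
    exact smul_zero _

theorem inr_mul_inl_mem {x : V} {a : Quiver.Total V} {l m : Δ.Lam}
    (hl : l ∈ LinearMap.range (Δ.entryIncl (.inr a)))
    (hm : m ∈ LinearMap.range (Δ.entryIncl (.inl x))) :
    l * m ∈ LinearMap.range (Δ.entryIncl (.inr a)) := by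
  rw [mem_range_entryIncl_inl] at hm
  rw [mem_range_entryIncl_inr] at *
  refine ⟨funext fun y => ?_, fun b hb => ?_⟩
  · rw [fst_mul_apply, hl.1]
    exact zero_mul _
  · rw [snd_mul_apply, hm.1, hl.2 b hb, smul_zero, add_zero]
    exact smul_zero _

theorem inr_mul_inr_eq_zero {a b : Quiver.Total V} {l m : Δ.Lam}
    (hl : l ∈ LinearMap.range (Δ.entryIncl (.inr a)))
    (hm : m ∈ LinearMap.range (Δ.entryIncl (.inr b))) : l * m = 0 := by
  rw [mem_range_entryIncl_inr] at *
  refine lam_ext (fun y => ?_) fun c => ?_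
  · rw [fst_mul_apply, hl.1]
    exact zero_mul _
  · rw [snd_mul_apply, hl.1, hm.1]
    change (0 : Δ.A c.right) • m.snd c + MulOpposite.op (0 : Δ.A c.left) • l.snd c = 0
    rw [zero_smul, MulOpposite.op_zero, zero_smul, add_zero]

/-- As `M M = 0`, the arrow `a` only meets the component of `g` in `A (s a)`. -/
theorem inr_mul_eq_zero_of_ne {a : Quiver.Total V} {x : V} (h : a.left ≠ x) {m : Δ.Lam}
    (hm : m ∈ LinearMap.range (Δ.entryIncl (.inr a))) (g : Δ.Lam) :
    m * (g * Δ.idem x) = 0 := by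
  rw [mem_range_entryIncl_inr] at hm
  refine lam_ext (fun y => ?_) fun c => ?_
  · rw [fst_mul_apply, hm.1]
    exact zero_mul _
  · rw [snd_mul_apply, hm.1, fst_mul_idem]
    have h0 : (0 : Δ.Diag) c.right • (g * Δ.idem x).snd c = 0 := zero_smul _ _
    rw [h0, zero_add]
    split_ifs with hc
    · rw [hm.2 c (fun hca => h (hca ▸ hc)), smul_zero]
      rfl
    · rw [MulOpposite.op_zero, zero_smul]
      rfl

/-- As `M M = 0`, the arrow `a` only meets the component of `g` in `A (t a)`. -/
theorem mul_inr_eq_zero_of_ne {a : Quiver.Total V} {y : V} (h : a.right ≠ y) {m : Δ.Lam}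
    (hm : m ∈ LinearMap.range (Δ.entryIncl (.inr a))) (g : Δ.Lam) :
    Δ.idem y * g * m = 0 := by
  rw [mem_range_entryIncl_inr] at hm
  refine lam_ext (fun y => ?_) fun c => ?_
  · rw [fst_mul_apply, hm.1]
    exact mul_zero _
  · rw [snd_mul_apply, hm.1, fst_idem_mul]
    have h0 : MulOpposite.op ((0 : Δ.Diag) c.left) • (Δ.idem y * g).snd c = 0 :=
      (congrArg (· • (Δ.idem y * g).snd c) MulOpposite.op_zero).trans (zero_smul _ _)
    rw [h0, add_zero]
    split_ifs with hc
    · rw [hm.2 c (fun hca => h (hca ▸ hc)), smul_zero]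
      rfl
    · rw [zero_smul]
      rfl

end QSet

/-! ### Trajectories -/

section Trajectories

variable {V : Type v} [Quiver.{w + 1} V]

theorem isTrajectoryOver_cons_iff {x y : V} {ω : Quiver.Path x y} {e : V ⊕ Quiver.Total V}
    {l : List (V ⊕ Quiver.Total V)} :
    IsTrajectoryOver ω (e :: l) ↔ (e = .inl y ∧ IsTrajectoryOver ω l) ∨
      ∃ (z : V) (ω' : Quiver.Path x z) (a : z ⟶ y),
        ω = ω'.cons a ∧ e = .inr ⟨z, y, a⟩ ∧ IsTrajectoryOver ω' l := by
  constructor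
  · intro h
    cases h with
    | wait _ _ h => exact Or.inl ⟨rfl, h⟩
    | move ω' a _ h => exact Or.inr ⟨_, ω', a, rfl, rfl, h⟩
  · rintro (⟨rfl, h⟩ | ⟨z, ω', a, rfl, rfl, h⟩)
    · exact .wait _ _ h
    · exact .move _ _ _ h

theorem IsTrajectoryOver.path_length_le {x y : V} {ω : Quiver.Path x y}
    {l : List (V ⊕ Quiver.Total V)} (h : IsTrajectoryOver ω l) : ω.length ≤ l.length := by
  induction h with
  | nil => exact le_rfl
  | wait _ _ _ ih => exact ih.trans (Nat.le_succ _)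
  | move _ _ _ _ ih => exact Nat.succ_le_succ ih

theorem IsTrajectoryOver.exists_arrow {x y : V} {ω : Quiver.Path x y}
    {l : List (V ⊕ Quiver.Total V)} (h : IsTrajectoryOver ω l) (hω : 0 < ω.length) :
    ∃ a, Sum.inr a ∈ l := by
  induction h with
  | nil => exact absurd hω (lt_irrefl 0)
  | wait _ _ _ ih =>
    obtain ⟨a, ha⟩ := ih hω
    exact ⟨a, List.mem_cons_of_mem _ ha⟩
  | move _ a _ _ _ => exact ⟨_, List.mem_cons_self⟩

theorem IsTrajectoryOver.eq_inl {x y : V} {ω : Quiver.Path x y}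
    {l : List (V ⊕ Quiver.Total V)} (h : IsTrajectoryOver ω l) (hω : ω.length = 0) :
    ∀ e ∈ l, e = .inl y := by
  induction h with
  | nil => exact fun e he => absurd he List.not_mem_nil
  | wait _ _ _ ih =>
    intro e he
    rcases List.mem_cons.1 he with rfl | he
    · rfl
    · exact ih hω e he
  | move => exact absurd hω (Nat.succ_ne_zero _)

/-- A trajectory determines the path below it, up to its end point when no arrow occurs. -/
theorem IsTrajectoryOver.path_unique {l : List (V ⊕ Quiver.Total V)} :
    ∀ {x x' y : V} {ω : Quiver.Path x y} {ω' : Quiver.Path x' y}, IsTrajectoryOver ω l →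
      IsTrajectoryOver ω' l → (⟨x, ω⟩ : Σ x, Quiver.Path x y) = ⟨x', ω'⟩ := by
  induction l with
  | nil =>
    intro x x' y ω ω' h h'
    cases h
    cases h'
    rfl
  | cons e l ih =>
    intro x x' y ω ω' h h'
    rcases isTrajectoryOver_cons_iff.1 h with ⟨rfl, g⟩ | ⟨z, ω₁, a, rfl, rfl, g⟩
    · rcases isTrajectoryOver_cons_iff.1 h' with ⟨-, g'⟩ | ⟨z, ω₁, a, rfl, h₁, g'⟩
      · exact ih g g'
      · cases h₁
    · rcases isTrajectoryOver_cons_iff.1 h' with ⟨h₁, g'⟩ | ⟨z', ω₁', a', rfl, h₁, g'⟩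
      · cases h₁
      · cases h₁
        cases ih g g'
        rfl

end Trajectories

namespace QSet

section EntryVertices

variable {V : Type v} [Quiver.{w + 1} V]

/-- The sequence of vertices visited by a trajectory, starting from its final vertex `y`. -/
def entryVertices (y : V) {n : ℕ} (τ : Fin n → V ⊕ Quiver.Total V) : Fin (n + 1) → V :=
  Fin.cons y fun i => entrySource (τ i)

theorem entryVertices_zero (y : V) {n : ℕ} (τ : Fin n → V ⊕ Quiver.Total V) :
    entryVertices y τ 0 = y := rfl

theorem entryVertices_succ (y : V) {n : ℕ} (τ : Fin n → V ⊕ Quiver.Total V) (i : Fin n) :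
    entryVertices y τ i.succ = entrySource (τ i) := rfl

theorem entryVertices_cons (y : V) {n : ℕ} (τ : Fin (n + 1) → V ⊕ Quiver.Total V)
    (i : Fin (n + 1)) :
    entryVertices y τ i.succ = entryVertices (entrySource (τ 0)) (Fin.tail τ) i := by
  cases i using Fin.cases <;> rfl

theorem entryVertices_of_isTrajectoryOver {n : ℕ} : ∀ {x y : V} {ω : Quiver.Path x y}
    {τ : Fin n → V ⊕ Quiver.Total V}, IsTrajectoryOver ω (List.ofFn τ) →
      entryVertices y τ (Fin.last n) = x ∧
        ∀ i : Fin n, entryTarget (τ i) = entryVertices y τ i.castSucc := by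
  induction n with
  | zero =>
    intro x y ω τ h
    rw [List.ofFn_zero] at h
    cases h
    exact ⟨rfl, fun i => i.elim0⟩
  | succ n ih =>
    intro x y ω τ h
    rw [List.ofFn_succ] at h
    rw [← Fin.succ_last, entryVertices_cons]
    have key : ∀ z : V, entrySource (τ 0) = z → entryTarget (τ 0) = y →
        (entryVertices z (Fin.tail τ) (Fin.last n) = x ∧
          ∀ i : Fin n, entryTarget (Fin.tail τ i) =
            entryVertices z (Fin.tail τ) i.castSucc) →
        entryVertices (entrySource (τ 0)) (Fin.tail τ) (Fin.last n) = x ∧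
          ∀ i : Fin (n + 1), entryTarget (τ i) = entryVertices y τ i.castSucc := by
      rintro _ rfl h₁ ⟨h₂, h₃⟩
      refine ⟨h₂, fun i => ?_⟩
      cases i using Fin.cases with
      | zero => exact h₁
      | succ i => exact (h₃ i).trans (entryVertices_cons y τ i.castSucc).symm
    rcases isTrajectoryOver_cons_iff.1 h with ⟨h₁, h⟩ | ⟨z, ω₁, a, rfl, h₁, h⟩
    · exact key y (by rw [h₁]; rfl) (by rw [h₁]; rfl) (ih h)
    · exact key z (by rw [h₁]; rfl) (by rw [h₁]; rfl) (ih h)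

theorem exists_isTrajectoryOver_of_composable {n : ℕ} : ∀ (v : Fin (n + 1) → V)
    (τ : Fin n → V ⊕ Quiver.Total V), (∀ i, entryTarget (τ i) = v i.castSucc) →
      (∀ i, entrySource (τ i) = v i.succ) →
        ∃ ω : Quiver.Path (v (Fin.last n)) (v 0), IsTrajectoryOver ω (List.ofFn τ) := by
  induction n with
  | zero =>
    intro v τ _ _
    exact ⟨Quiver.Path.nil, by rw [List.ofFn_zero]; exact .nil _⟩
  | succ n ih =>
    intro v τ ht hs
    obtain ⟨ω, hω⟩ := ih (Fin.tail v) (Fin.tail τ) (fun i => ht i.succ) fun i => hs i.succ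
    have ht₀ : entryTarget (τ 0) = v 0 := ht 0
    have hs₀ : entrySource (τ 0) = Fin.tail v 0 := hs 0
    change ∃ ω : Quiver.Path (Fin.tail v (Fin.last n)) (v 0), _
    rw [List.ofFn_succ]
    rcases hτ : τ 0 with z | ⟨z, z', a⟩
    · rw [hτ] at ht₀ hs₀
      have h : Fin.tail v 0 = v 0 := hs₀.symm.trans ht₀
      have ht₀ : z = v 0 := ht₀
      rw [ht₀, ← h]
      exact ⟨ω, .wait _ _ hω⟩
    · rw [hτ] at ht₀ hs₀
      have ht₀ : z' = v 0 := ht₀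
      have hs₀ : z = Fin.tail v 0 := hs₀
      subst ht₀ hs₀
      exact ⟨ω.cons a, .move _ _ _ hω⟩

end EntryVertices

/-! ### Hochschild cochains along a path -/

variable {k : Type*} [Field k] {V : Type v} [Quiver.{w + 1} V] {Δ : QSet.{u} k V}

/-- The arguments `l` of a Hochschild cochain are adapted to the path `ω` if they are
homogeneous and their degrees form a trajectory over `ω`. -/
def IsAdapted {x y : V} (ω : Quiver.Path x y) {n : ℕ} (l : Fin n → Δ.Lam) : Prop :=
  ∃ τ : Fin n → V ⊕ Quiver.Total V, IsTrajectoryOver ω (List.ofFn τ) ∧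
    ∀ i, l i ∈ LinearMap.range (Δ.entryIncl (τ i))

theorem pathRes_eq_zero_iff {x y : V} {ω : Quiver.Path x y} {n : ℕ}
    {F : HochschildCochain k Δ.Lam n} :
    Δ.pathRes ω n F = 0 ↔
      ∀ l : Fin n → Δ.Lam, IsAdapted ω l → Δ.idem y * (F l * Δ.idem x) = 0 := by
  constructor
  · rintro h l ⟨τ, hτ, hl⟩
    choose m hm using hl
    obtain rfl : (fun i => Δ.entryIncl (τ i) (m i)) = l := funext hm
    exact congrArg Subtype.val (congrArg (fun f => f m) (congrFun h ⟨τ, hτ⟩))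
  · intro h
    refine funext fun τ => MultilinearMap.ext fun m => Subtype.ext ?_
    exact h _ ⟨τ.1, τ.2, fun i => ⟨m i, rfl⟩⟩

theorem isAdapted_succ_iff {x y : V} {ω : Quiver.Path x y} {n : ℕ} {l : Fin (n + 1) → Δ.Lam} :
    IsAdapted ω l ↔
      (l 0 ∈ LinearMap.range (Δ.entryIncl (.inl y)) ∧ IsAdapted ω (Fin.tail l)) ∨
      ∃ (z : V) (ω' : Quiver.Path x z) (a : z ⟶ y), ω = ω'.cons a ∧
        l 0 ∈ LinearMap.range (Δ.entryIncl (.inr ⟨z, y, a⟩)) ∧ IsAdapted ω' (Fin.tail l) := by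
  constructor
  · rintro ⟨τ, hτ, hl⟩
    rw [List.ofFn_succ] at hτ
    have h₀ := hl 0
    rcases isTrajectoryOver_cons_iff.1 hτ with ⟨h₁, h⟩ | ⟨z, ω₁, a, rfl, h₁, h⟩
    · rw [h₁] at h₀
      exact Or.inl ⟨h₀, _, h, fun i => hl i.succ⟩
    · rw [h₁] at h₀
      exact Or.inr ⟨z, ω₁, a, rfl, h₀, _, h, fun i => hl i.succ⟩
  · rintro (⟨h₀, τ, hτ, hl⟩ | ⟨z, ω', a, rfl, h₀, τ, hτ, hl⟩)
    · refine ⟨Fin.cons (.inl y) τ, ?_, fun i => ?_⟩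
      · rw [List.ofFn_succ]
        exact .wait _ _ hτ
      · cases i using Fin.cases with
        | zero => exact h₀
        | succ i => exact hl i
    · refine ⟨Fin.cons (.inr ⟨z, y, a⟩) τ, ?_, fun i => ?_⟩
      · rw [List.ofFn_succ]
        exact .move _ _ _ hτ
      · cases i using Fin.cases with
        | zero => exact h₀
        | succ i => exact hl i

theorem isAdapted_cons_inl {x y : V} {ω : Quiver.Path x y} {n : ℕ} {l : Fin n → Δ.Lam}
    {a : Δ.Lam} (ha : a ∈ LinearMap.range (Δ.entryIncl (.inl y))) (hl : IsAdapted ω l) :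
    IsAdapted ω (Fin.cons (α := fun _ => Δ.Lam) a l) :=
  isAdapted_succ_iff.2 (Or.inl ⟨ha, hl⟩)

theorem isAdapted_cons_inr {x y z : V} {ω : Quiver.Path x z} {b : z ⟶ y} {n : ℕ}
    {l : Fin n → Δ.Lam} {a : Δ.Lam} (ha : a ∈ LinearMap.range (Δ.entryIncl (.inr ⟨z, y, b⟩)))
    (hl : IsAdapted ω l) : IsAdapted (ω.cons b) (Fin.cons (α := fun _ => Δ.Lam) a l) :=
  isAdapted_succ_iff.2 (Or.inr ⟨z, ω, b, rfl, ha, hl⟩)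

theorem IsAdapted.zero_eq_nil {x y : V} {ω : Quiver.Path x y} {l : Fin 0 → Δ.Lam}
    (h : IsAdapted ω l) : (⟨x, ω⟩ : Σ x, Quiver.Path x y) = ⟨y, Quiver.Path.nil⟩ := by
  obtain ⟨τ, hτ, -⟩ := h
  rw [List.ofFn_zero] at hτ
  cases hτ
  rfl

theorem isAdapted_nil (x : V) (l : Fin 0 → Δ.Lam) :
    IsAdapted (Quiver.Path.nil : Quiver.Path x x) l :=
  ⟨Fin.elim0, by rw [List.ofFn_zero]; exact .nil x, fun i => i.elim0⟩

/-- The rightmost argument of an adapted family is either a waiting time at the source of the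
path, or its first arrow. -/
theorem IsAdapted.last {n : ℕ} : ∀ {x y : V} {ω : Quiver.Path x y} {l : Fin (n + 1) → Δ.Lam},
    IsAdapted ω l →
      (l (Fin.last n) ∈ LinearMap.range (Δ.entryIncl (.inl x)) ∧ IsAdapted ω (Fin.init l)) ∨
      ∃ (z : V) (a : x ⟶ z) (ω' : Quiver.Path z y),
        l (Fin.last n) ∈ LinearMap.range (Δ.entryIncl (.inr ⟨x, z, a⟩)) ∧
          IsAdapted ω' (Fin.init l) := by
  induction n with
  | zero =>
    intro x y ω l h
    rcases isAdapted_succ_iff.1 h with ⟨h₀, h⟩ | ⟨z, ω', a, rfl, h₀, h⟩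
    · cases h.zero_eq_nil
      exact Or.inl ⟨h₀, isAdapted_nil _ _⟩
    · cases h.zero_eq_nil
      exact Or.inr ⟨y, a, .nil, h₀, isAdapted_nil _ _⟩
  | succ n ih =>
    intro x y ω l h
    have hi : Fin.init l = Fin.cons (α := fun _ => Δ.Lam) (l 0) (Fin.init (Fin.tail l)) := by
      funext i
      cases i using Fin.cases <;> rfl
    rw [hi]
    rcases isAdapted_succ_iff.1 h with ⟨h₀, h⟩ | ⟨z, ω', a, rfl, h₀, h⟩
    · rcases ih h with ⟨h₁, h⟩ | ⟨z, a, ω', h₁, h⟩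
      · exact Or.inl ⟨h₁, isAdapted_cons_inl h₀ h⟩
      · exact Or.inr ⟨z, a, ω', h₁, isAdapted_cons_inl h₀ h⟩
    · rcases ih h with ⟨h₁, h⟩ | ⟨z', a', ω'', h₁, h⟩
      · exact Or.inl ⟨h₁, isAdapted_cons_inr h₀ h⟩
      · exact Or.inr ⟨z', a', ω''.cons a, h₁, isAdapted_cons_inr h₀ h⟩

/-- Multiplying two consecutive arguments of an adapted family shortens one waiting time, or gives
zero as `M M = 0`. -/
theorem IsAdapted.contractNth {n : ℕ} : ∀ {x y : V} {ω : Quiver.Path x y}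
    {l : Fin (n + 1) → Δ.Lam} (j : Fin n), IsAdapted ω l →
      IsAdapted ω (Fin.contractNth j.castSucc (· * ·) l) ∨
        ∃ i, Fin.contractNth j.castSucc (· * ·) l i = 0 := by
  induction n with
  | zero => exact fun j => j.elim0
  | succ n ih =>
    intro x y ω l j h
    obtain ⟨a, l, rfl⟩ : ∃ (a : Δ.Lam) (l' : Fin (n + 1) → Δ.Lam),
        l = Fin.cons (α := fun _ => Δ.Lam) a l' := ⟨l 0, Fin.tail l, (Fin.cons_self_tail l).symm⟩
    cases j using Fin.cases with
    | zero =>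
      rw [contractNth_cons_zero]
      rcases isAdapted_succ_iff.1 h with ⟨h₀, h⟩ | ⟨z, ω', b, rfl, h₀, h⟩
      · rcases isAdapted_succ_iff.1 h with ⟨h₁, h⟩ | ⟨z, ω', b, rfl, h₁, h⟩
        · exact Or.inl (isAdapted_cons_inl (inl_mul_inl_mem h₀ h₁) h)
        · exact Or.inl (isAdapted_cons_inr (inl_mul_inr_mem h₀ h₁) h)
      · rcases isAdapted_succ_iff.1 h with ⟨h₁, h⟩ | ⟨z', ω', b', rfl, h₁, h⟩
        · exact Or.inl (isAdapted_cons_inr (inr_mul_inl_mem h₀ h₁) h)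
        · exact Or.inr ⟨0, inr_mul_inr_eq_zero h₀ h₁⟩
    | succ j =>
      rw [contractNth_cons_succ]
      rcases isAdapted_succ_iff.1 h with ⟨h₀, h⟩ | ⟨z, ω', b, rfl, h₀, h⟩
      · rcases ih j h with h | ⟨i, hi⟩
        · exact Or.inl (isAdapted_cons_inl h₀ h)
        · exact Or.inr ⟨i.succ, hi⟩
      · rcases ih j h with h | ⟨i, hi⟩
        · exact Or.inl (isAdapted_cons_inr h₀ h)
        · exact Or.inr ⟨i.succ, hi⟩

/-- If the component of `G` along `ω` vanishes, then so does the one of `d G`. If `ω` is not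
a cycle, the components of `G` along the cycles may contribute (through the outer terms of `d G`)
and have to vanish too. -/
theorem pathRes_hochschildD_eq_zero (hQ : IsSimplyLaced V) {x y : V} {ω : Quiver.Path x y} {n : ℕ}
    {G : HochschildCochain k Δ.Lam n} (hG : Δ.pathRes ω n G = 0)
    (hc : x ≠ y → ∀ (z : V) (γ : Quiver.Path z z), Δ.pathRes γ n G = 0) :
    Δ.pathRes ω (n + 1) (hochschildD k Δ.Lam n G) = 0 := by
  simp only [pathRes_eq_zero_iff] at *
  intro l hl
  rw [hochschildD_apply, add_mul, add_mul, mul_add, mul_add, Finset.sum_mul, Finset.mul_sum]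
  -- The two outer terms are handled in the same way: either the outer argument is a waiting time at
  -- an end of `ω`, or it belongs to some `M a`, and then `M M = 0` leaves only the case that the
  -- other arguments run along a cycle.
  have h₁ : Δ.idem y * (l 0 * G (Fin.tail l) * Δ.idem x) = 0 := by
    rcases isAdapted_succ_iff.1 hl with ⟨h₀, h⟩ | ⟨z, ω', a, rfl, h₀, h⟩
    · rw [← entryIncl_mul_idem h₀]
      change Δ.idem y * (l 0 * Δ.idem y * G (Fin.tail l) * Δ.idem x) = 0
      rw [mul_assoc (l 0), mul_assoc (l 0), mul_assoc (Δ.idem y), hG _ h, mul_zero, mul_zero]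
    · by_cases hzx : z = x
      · subst hzx
        have hzy : z ≠ y := by
          rintro rfl
          exact (hQ.loopless z).false a
        rw [← entryIncl_mul_idem h₀]
        change Δ.idem y * (l 0 * Δ.idem z * G (Fin.tail l) * Δ.idem z) = 0
        rw [mul_assoc (l 0), mul_assoc (l 0), mul_assoc (Δ.idem z), hc hzy z ω' _ h, mul_zero,
          mul_zero]
      · rw [mul_assoc (l 0), inr_mul_eq_zero_of_ne (fun h' => hzx h') h₀, mul_zero]
  have h₂ : Δ.idem y * (G (Fin.init l) * l (Fin.last n) * Δ.idem x) = 0 := by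
    rcases hl.last with ⟨h₀, h⟩ | ⟨z, a, ω', h₀, h⟩
    · rw [← idem_mul_entryIncl h₀]
      change Δ.idem y * (G (Fin.init l) * (Δ.idem x * l (Fin.last n)) * Δ.idem x) = 0
      rw [← mul_assoc (G _), ← mul_assoc, ← mul_assoc, ← mul_assoc, mul_assoc (Δ.idem y),
        hG _ h, zero_mul, zero_mul]
    · by_cases hzy : z = y
      · subst hzy
        have hxz : x ≠ z := by
          rintro rfl
          exact (hQ.loopless x).false a
        rw [← idem_mul_entryIncl h₀]
        change Δ.idem z * (G (Fin.init l) * (Δ.idem z * l (Fin.last n)) * Δ.idem x) = 0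
        rw [← mul_assoc (G _), ← mul_assoc, ← mul_assoc, ← mul_assoc, mul_assoc (Δ.idem z),
          hc hxz z ω' _ h, zero_mul, zero_mul]
      · rw [← mul_assoc, ← mul_assoc, mul_inr_eq_zero_of_ne (fun h' => hzy h') h₀, zero_mul]
  rw [h₁, zero_add, smul_mul_assoc, mul_smul_comm, h₂, smul_zero, add_zero]
  refine Finset.sum_eq_zero fun j _ => ?_
  rw [smul_mul_assoc, mul_smul_comm]
  rcases hl.contractNth j with h | ⟨i, hi⟩
  · rw [hG _ h, smul_zero]
  · rw [G.map_coord_zero i hi, zero_mul, mul_zero, smul_zero]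

end QSet

namespace QSet

variable {k : Type*} [Field k] {V : Type v} [Quiver.{w + 1} V] {Δ : QSet.{u} k V}

/-! ### Extension and restriction of cochains -/

theorem coe_pathRes_apply {x y : V} (ω : Quiver.Path x y) {n : ℕ} (F : HochschildCochain k Δ.Lam n)
    (τ : Trajectory ω n) (m : ∀ i, Δ.Entry (τ.1 i)) :
    (Δ.pathRes ω n F τ m : Δ.Lam) =
      Δ.idem y * (F (fun i => Δ.entryIncl (τ.1 i) (m i)) * Δ.idem x) := rfl

theorem subsingleton_pathCochain {x y : V} (ω : Quiver.Path x y) {n : ℕ} (h : n < ω.length) :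
    Subsingleton (Δ.PathCochain ω n) := by
  refine ⟨fun f g => funext fun τ => ?_⟩
  have := τ.2.path_length_le
  rw [List.length_ofFn] at this
  exact absurd this (not_le.2 h)

theorem exists_trajectory_apply_eq_inr {x y : V} {ω : Quiver.Path x y} (hω : 0 < ω.length) {n : ℕ}
    (τ : Trajectory ω n) : ∃ i a, τ.1 i = .inr a := by
  obtain ⟨a, ha⟩ := τ.2.exists_arrow hω
  obtain ⟨i, hi⟩ := (List.mem_ofFn' _ _).1 ha
  exact ⟨i, a, hi⟩

theorem length_pos_of_ne {x y : V} (ω : Quiver.Path x y) (h : x ≠ y) : 0 < ω.length := by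
  cases ω with
  | nil => exact absurd rfl h
  | cons => exact Nat.succ_pos _

section Finite

variable [Finite V] [Finite (Quiver.Total V)]

theorem pathExt_apply {x y : V} (ω : Quiver.Path x y) {n : ℕ} (f : Δ.PathCochain ω n)
    (l : Fin n → Δ.Lam) :
    Δ.pathExt ω n f l = ∑ τ, (f τ (fun i => Δ.entryProj (τ.1 i) (l i)) : Δ.Lam) := by
  change (∑ τ, (Δ.Corner x y).subtype.compMultilinearMap
    ((f τ).compLinearMap fun i => Δ.entryProj (τ.1 i))) l = _
  rw [sum_apply]
  rfl

theorem pathRes_pathExt {x y : V} (ω : Quiver.Path x y) {n : ℕ} (f : Δ.PathCochain ω n) :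
    Δ.pathRes ω n (Δ.pathExt ω n f) = f := by
  refine funext fun τ => MultilinearMap.ext fun m => Subtype.ext ?_
  rw [coe_pathRes_apply, pathExt_apply, Finset.sum_eq_single τ]
  · simp only [entryProj_entryIncl]
    exact corner_eq_self _
  · intro τ' _ h
    obtain ⟨i, hi⟩ := Function.ne_iff.1 fun h' => h (Subtype.ext h')
    rw [(f τ').map_coord_zero i (entryProj_entryIncl_of_ne (Ne.symm hi) _)]
    rfl
  · exact fun h => absurd (Finset.mem_univ _) h

theorem pathRes_pathExt_of_ne {x y x' y' : V} {ω : Quiver.Path x y} {ω' : Quiver.Path x' y'}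
    (h : (⟨x, y, ω⟩ : Σ x y : V, Quiver.Path x y) ≠ ⟨x', y', ω'⟩) {n : ℕ}
    (f : Δ.PathCochain ω n) : Δ.pathRes ω' n (Δ.pathExt ω n f) = 0 := by
  refine funext fun τ' => MultilinearMap.ext fun m => Subtype.ext ?_
  rw [coe_pathRes_apply, pathExt_apply, Finset.sum_mul, Finset.mul_sum]
  refine Finset.sum_eq_zero fun τ _ => ?_
  by_cases hy : y' = y
  · subst hy
    by_cases hτ : τ.1 = τ'.1
    · have h₁ := τ.2
      rw [hτ] at h₁
      cases h₁.path_unique τ'.2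
      exact absurd rfl h
    · obtain ⟨i, hi⟩ := Function.ne_iff.1 hτ
      rw [(f τ).map_coord_zero i (entryProj_entryIncl_of_ne (Ne.symm hi) _)]
      exact (congrArg _ (zero_mul _)).trans (mul_zero _)
  · rw [← mul_assoc, idem_mul_corner_of_ne hy, zero_mul]

theorem pathRes_pathExt_cycle {x y z : V} {ω : Quiver.Path x y} (h : x ≠ y)
    (γ : Quiver.Path z z) {n : ℕ} (f : Δ.PathCochain ω n) :
    Δ.pathRes γ n (Δ.pathExt ω n f) = 0 :=
  pathRes_pathExt_of_ne (fun h' => by cases h'; exact h rfl) f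

/-- Restriction to a cycle is a chain map. -/
theorem pathRes_hochschildD_cycle (hQ : IsSimplyLaced V) {x : V} (γ : Quiver.Path x x) {n : ℕ}
    (F : HochschildCochain k Δ.Lam n) :
    Δ.pathRes γ (n + 1) (hochschildD k Δ.Lam n F) = Δ.pathD γ n (Δ.pathRes γ n F) := by
  have h := pathRes_hochschildD_eq_zero hQ (ω := γ) (G := F - Δ.pathExt γ n (Δ.pathRes γ n F))
    (by rw [map_sub, pathRes_pathExt, sub_self]) fun h => absurd rfl h
  rw [map_sub, map_sub] at h
  exact sub_eq_zero.1 h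

/-- Restriction to a non cycle commutes with the coboundaries of the cochains that vanish on the
cycles. -/
theorem pathRes_hochschildD_of_ne (hQ : IsSimplyLaced V) {x y : V} (hxy : x ≠ y)
    (ω : Quiver.Path x y) {n : ℕ} (F : HochschildCochain k Δ.Lam n)
    (hF : ∀ (z : V) (γ : Quiver.Path z z), Δ.pathRes γ n F = 0) :
    Δ.pathRes ω (n + 1) (hochschildD k Δ.Lam n F) = Δ.pathD ω n (Δ.pathRes ω n F) := by
  have h := pathRes_hochschildD_eq_zero hQ (ω := ω) (G := F - Δ.pathExt ω n (Δ.pathRes ω n F))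
    (by rw [map_sub, pathRes_pathExt, sub_self]) fun _ z γ => by
      rw [map_sub, hF, pathRes_pathExt_cycle hxy, sub_zero]
  rw [map_sub, map_sub] at h
  exact sub_eq_zero.1 h

theorem pathD_pathD (hQ : IsSimplyLaced V) {x y : V} (ω : Quiver.Path x y) {n : ℕ}
    (f : Δ.PathCochain ω n) : Δ.pathD ω (n + 1) (Δ.pathD ω n f) = 0 := by
  change Δ.pathD ω (n + 1) (Δ.pathRes ω (n + 1) (hochschildD k Δ.Lam n (Δ.pathExt ω n f))) = 0
  by_cases hxy : x = y
  · subst hxy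
    rw [← pathRes_hochschildD_cycle hQ, hochschildD_comp_hochschildD, map_zero]
  · rw [← pathRes_hochschildD_of_ne hQ hxy, hochschildD_comp_hochschildD, map_zero]
    intro z γ
    rw [pathRes_hochschildD_cycle hQ, pathRes_pathExt_cycle hxy, map_zero]

end Finite

/-! ### The Peirce projection and restriction to paths -/

section Peirce

/-- At arguments along a trajectory, only the sequence of the visited vertices contributes to the
Peirce projection. -/
theorem idem_mul_peirceProj_mul_idem [Fintype V] {x y : V} {n : ℕ}
    (F : HochschildCochain k Δ.Lam n) {τ : Fin n → V ⊕ Quiver.Total V} {ω : Quiver.Path x y}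
    (hτ : IsTrajectoryOver ω (List.ofFn τ)) {l : Fin n → Δ.Lam}
    (hl : ∀ i, l i ∈ LinearMap.range (Δ.entryIncl (τ i))) :
    Δ.idem y * (peirceProj Δ.idem n F l * Δ.idem x) = Δ.idem y * (F l * Δ.idem x) := by
  obtain ⟨h₁, h₂⟩ := entryVertices_of_isTrajectoryOver hτ
  rw [peirceProj_apply, Finset.sum_mul, Finset.mul_sum,
    Finset.sum_eq_single (entryVertices y τ)]
  · have : (fun i => Δ.idem (entryVertices y τ i.castSucc) *
        (l i * Δ.idem (entryVertices y τ i.succ))) = l := funext fun i => by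
      rw [entryVertices_succ, entryIncl_mul_idem (hl i), ← h₂ i, idem_mul_entryIncl (hl i)]
    rw [this, h₁, entryVertices_zero, mul_assoc, mul_assoc, idem_mul_self, ← mul_assoc (Δ.idem y),
      idem_mul_self]
  · intro v _ hv
    by_cases h₀ : y = v 0
    · obtain ⟨i, hi⟩ : ∃ i : Fin n, entrySource (τ i) ≠ v i.succ := by
        by_contra! h
        refine hv (funext fun i => ?_)
        cases i using Fin.cases with
        | zero => exact h₀.symm
        | succ i => exact (h i).symm
      rw [F.map_coord_zero i, zero_mul, mul_zero, zero_mul, mul_zero]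
      rw [← entryIncl_mul_idem (hl i), mul_assoc (l i), idem_mul_idem_of_ne hi, mul_zero, mul_zero]
    · rw [← mul_assoc, ← mul_assoc, idem_mul_idem_of_ne h₀, zero_mul, zero_mul]
  · exact fun h => absurd (Finset.mem_univ _) h

theorem pathRes_peirceProj [Fintype V] {x y : V} (ω : Quiver.Path x y) {n : ℕ}
    (F : HochschildCochain k Δ.Lam n) :
    Δ.pathRes ω n (peirceProj Δ.idem n F) = Δ.pathRes ω n F :=
  funext fun τ => MultilinearMap.ext fun _ => Subtype.ext <|
    idem_mul_peirceProj_mul_idem F τ.2 fun _ => ⟨_, rfl⟩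

/-- A cochain whose restrictions to all paths vanish has Peirce projection zero: as the quiver is
simply laced, composable arguments are homogeneous. -/
theorem peirceProj_eq_zero [Fintype V] (hQ : IsSimplyLaced V) {n : ℕ}
    {F : HochschildCochain k Δ.Lam n}
    (hF : ∀ (x y : V) (ω : Quiver.Path x y), Δ.pathRes ω n F = 0) :
    peirceProj Δ.idem n F = 0 := by
  refine MultilinearMap.ext fun l => ?_
  rw [peirceProj_apply]
  refine Finset.sum_eq_zero fun v _ => ?_
  by_cases h : ∃ i : Fin n, Δ.idem (v i.castSucc) * (l i * Δ.idem (v i.succ)) = 0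
  · obtain ⟨i, hi⟩ := h
    rw [F.map_coord_zero i hi, zero_mul, mul_zero]
  · have h' := fun i : Fin n => (idem_mul_idem_mem_range hQ (v i.succ) (v i.castSucc)
      (l i)).resolve_left fun h' => h ⟨i, h'⟩
    choose τ ht hs hτ using h'
    obtain ⟨ω, hω⟩ := exists_isTrajectoryOver_of_composable v τ ht hs
    exact pathRes_eq_zero_iff.1 (hF _ _ ω) _ ⟨τ, hω, hτ⟩

theorem peirceProj_pathExt [Fintype V] [Finite (Quiver.Total V)] {x y : V} (ω : Quiver.Path x y)
    {n : ℕ} (f : Δ.PathCochain ω n) :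
    peirceProj Δ.idem n (Δ.pathExt ω n f) = Δ.pathExt ω n f := by
  refine MultilinearMap.ext fun l => ?_
  rw [peirceProj_apply]
  simp only [pathExt_apply, Finset.sum_mul, Finset.mul_sum]
  rw [Finset.sum_comm]
  refine Finset.sum_congr rfl fun τ _ => ?_
  obtain ⟨h₁, h₂⟩ := entryVertices_of_isTrajectoryOver τ.2
  rw [Finset.sum_eq_single (entryVertices y τ.1)]
  · have : (fun i => Δ.entryProj (τ.1 i) (Δ.idem (entryVertices y τ.1 i.castSucc) *
        (l i * Δ.idem (entryVertices y τ.1 i.succ)))) = fun i => Δ.entryProj (τ.1 i) (l i) :=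
      funext fun i => by
        rw [entryVertices_succ, ← h₂ i, entryProj_idem_mul_idem]
    rw [this, h₁, entryVertices_zero, corner_eq_self]
  · intro v _ hv
    by_cases h₀ : v 0 = y
    · obtain ⟨i, hi⟩ : ∃ i : Fin n, entrySource (τ.1 i) ≠ v i.succ := by
        by_contra! h
        refine hv (funext fun i => ?_)
        cases i using Fin.cases with
        | zero => exact h₀
        | succ i => exact (h i).symm
      rw [(f τ).map_coord_zero i (entryProj_mul_idem_of_ne hi _ _)]
      exact (congrArg _ (zero_mul _)).trans (mul_zero _)
    · rw [← mul_assoc, idem_mul_corner_of_ne h₀, zero_mul]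
  · exact fun h => absurd (Finset.mem_univ _) h

/-- Extension by zero along a non cycle is a chain map. -/
theorem hochschildD_pathExt [Finite V] [Finite (Quiver.Total V)] (hQ : IsSimplyLaced V) {x y : V}
    (hxy : x ≠ y) (ω : Quiver.Path x y) {n : ℕ} (f : Δ.PathCochain ω n) :
    hochschildD k Δ.Lam n (Δ.pathExt ω n f) = Δ.pathExt ω (n + 1) (Δ.pathD ω n f) := by
  have := Fintype.ofFinite V
  -- Both sides are fixed by the Peirce projection and have the same restrictions to all paths.
  have key : peirceProj Δ.idem (n + 1)
      (hochschildD k Δ.Lam n (Δ.pathExt ω n f) - Δ.pathExt ω (n + 1) (Δ.pathD ω n f)) = 0 := by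
    refine peirceProj_eq_zero hQ fun x' y' ω' => ?_
    rw [map_sub, sub_eq_zero]
    by_cases hxy' : x' = y'
    · subst hxy'
      rw [pathRes_hochschildD_cycle hQ, pathRes_pathExt_cycle hxy, pathRes_pathExt_cycle hxy,
        map_zero]
    · rw [pathRes_hochschildD_of_ne hQ hxy' ω' _ fun z γ => pathRes_pathExt_cycle hxy γ f]
      by_cases h : (⟨x, y, ω⟩ : Σ x y : V, Quiver.Path x y) = ⟨x', y', ω'⟩
      · cases h
        rw [pathRes_pathExt, pathRes_pathExt]
      · rw [pathRes_pathExt_of_ne h, pathRes_pathExt_of_ne h, map_zero]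
  rw [map_sub, ← hochschildD_peirceProj Δ.idem sum_idem_mul_idem, peirceProj_pathExt,
    peirceProj_pathExt] at key
  exact sub_eq_zero.1 key

end Peirce

/-! ### Restriction to the diagonal subalgebra -/

theorem diagRes_apply {n : ℕ} (F : HochschildCochain k Δ.Lam n) (r : Fin n → Δ.Diag) :
    Δ.diagRes n F r = (F fun i => TrivSqZeroExt.inl (r i)).fst := rfl

variable (Δ) in
/-- A Hochschild cochain of `A`, extended by zero to a Hochschild cochain of `Λ = A ⊕ M`. -/
def diagExt (n : ℕ) : HochschildCochain k Δ.Diag n →ₗ[k] HochschildCochain k Δ.Lam n where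
  toFun L := (TrivSqZeroExt.inlAlgHom k Δ.Diag Δ.Bimod).toLinearMap.compMultilinearMap
    (L.compLinearMap fun _ => (TrivSqZeroExt.fstHom k Δ.Diag Δ.Bimod).toLinearMap)
  map_add' _ _ := MultilinearMap.ext fun _ => TrivSqZeroExt.inl_add _ _ _
  map_smul' _ _ := MultilinearMap.ext fun _ =>
    map_smul (TrivSqZeroExt.inlAlgHom k Δ.Diag Δ.Bimod).toLinearMap _ _

theorem diagExt_apply {n : ℕ} (L : HochschildCochain k Δ.Diag n) (l : Fin n → Δ.Lam) :
    Δ.diagExt n L l = TrivSqZeroExt.inl (L fun i => (l i).fst) := rfl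

theorem diagRes_diagExt {n : ℕ} (L : HochschildCochain k Δ.Diag n) :
    Δ.diagRes n (Δ.diagExt n L) = L := rfl

theorem pathRes_diagExt {x y : V} {ω : Quiver.Path x y} (hω : 0 < ω.length) {n : ℕ}
    (L : HochschildCochain k Δ.Diag n) : Δ.pathRes ω n (Δ.diagExt n L) = 0 := by
  refine funext fun τ => MultilinearMap.ext fun m => Subtype.ext ?_
  obtain ⟨i, a, hi⟩ := exists_trajectory_apply_eq_inr hω τ
  rw [coe_pathRes_apply, diagExt_apply, L.map_coord_zero i, TrivSqZeroExt.inl_zero, zero_mul,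
    mul_zero]
  · rfl
  · generalize m i = m
    revert m
    rw [hi]
    exact fun m => rfl

theorem diagRes_pathExt [Finite V] [Finite (Quiver.Total V)] {x y : V} {ω : Quiver.Path x y}
    (hω : 0 < ω.length) {n : ℕ} (f : Δ.PathCochain ω n) :
    Δ.diagRes n (Δ.pathExt ω n f) = 0 := by
  refine MultilinearMap.ext fun r => ?_
  rw [diagRes_apply, pathExt_apply, Finset.sum_eq_zero fun τ _ => ?_]
  · rfl
  obtain ⟨i, hi⟩ := exists_trajectory_apply_eq_inr hω τ
  rw [(f τ).map_coord_zero i (entryProj_inl_of_isRight hi _)]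
  rfl

/-- Restriction to `A` is a chain map. -/
theorem diagRes_hochschildD {n : ℕ} (F : HochschildCochain k Δ.Lam n) :
    Δ.diagRes (n + 1) (hochschildD k Δ.Lam n F) = hochschildD k Δ.Diag n (Δ.diagRes n F) := by
  refine MultilinearMap.ext fun r => ?_
  rw [diagRes_apply, hochschildD_apply, hochschildD_apply, TrivSqZeroExt.fst_add,
    TrivSqZeroExt.fst_add, TrivSqZeroExt.fst_sum]
  refine congrArg₂ _ (congrArg₂ _ rfl (Finset.sum_congr rfl fun j _ => ?_)) rfl
  rw [TrivSqZeroExt.fst_smul, diagRes_apply]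
  refine congrArg (fun l => (-1 : k) ^ (j.val + 1) • (F l).fst) (funext fun i => ?_)
  simp only [Fin.contractNth]
  split_ifs
  · rfl
  · rw [TrivSqZeroExt.inl_mul]
  · rfl

open Classical in
theorem diagRes_peirceProj [Fintype V] {n : ℕ} (F : HochschildCochain k Δ.Lam n) :
    Δ.diagRes n (peirceProj Δ.idem n F) =
      peirceProj (fun x => (Pi.single x 1 : Δ.Diag)) n (Δ.diagRes n F) := by
  refine MultilinearMap.ext fun r => ?_
  rw [diagRes_apply, peirceProj_apply, peirceProj_apply, TrivSqZeroExt.fst_sum]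
  refine Finset.sum_congr rfl fun v _ => ?_
  rw [TrivSqZeroExt.fst_mul, TrivSqZeroExt.fst_mul, diagRes_apply]
  simp only [TrivSqZeroExt.inl_mul]
  rfl

open Classical in
theorem sum_single_mul_single [Fintype V] :
    ∑ x, (Pi.single x 1 : Δ.Diag) * Pi.single x 1 = 1 := by
  have := congrArg TrivSqZeroExt.fst (sum_idem_mul_idem (Δ := Δ))
  rw [TrivSqZeroExt.fst_sum] at this
  exact this

/-- As there are no loops, the restriction to a path of length zero is determined by the
restriction to `A`. -/
theorem pathRes_eq_zero_of_diagRes_eq_zero (hQ : IsSimplyLaced V) {x : V} (γ : Quiver.Path x x)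
    (hγ : γ.length = 0) {n : ℕ} {F : HochschildCochain k Δ.Lam n} (hF : Δ.diagRes n F = 0) :
    Δ.pathRes γ n F = 0 := by
  refine pathRes_eq_zero_iff.2 fun l ⟨τ, hτ, hl⟩ => ?_
  have h : (F l).fst = 0 := by
    have hl' : l = fun i => TrivSqZeroExt.inl (l i).fst := funext fun i => by
      have h₁ := hl i
      rw [hτ.eq_inl hγ _ ((List.mem_ofFn' _ _).2 ⟨i, rfl⟩), mem_range_entryIncl_inl] at h₁
      exact TrivSqZeroExt.ext rfl h₁.1
    rw [hl', ← diagRes_apply, hF]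
    rfl
  refine lam_ext (fun y => ?_) fun a => ?_
  · rw [fst_idem_mul, fst_mul_idem, h]
    split_ifs <;> rfl
  · rw [snd_idem_mul, snd_mul_idem]
    split_ifs with h₁ h₂
    · obtain ⟨y, z, a⟩ := a
      have h₁ : z = x := h₁
      have h₂ : y = x := h₂
      subst h₁ h₂
      exact ((hQ.loopless _).false a).elim
    · rfl
    · rfl

end QSet

/-! ### Paths of bounded length -/

section FinitePaths

variable {V : Type v} [Quiver.{w + 1} V]

theorem exists_isTrajectoryOver {x y : V} (ω : Quiver.Path x y) {n : ℕ} (h : ω.length ≤ n) :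
    ∃ l, l.length = n ∧ IsTrajectoryOver ω l := by
  induction ω generalizing n with
  | nil =>
    induction n with
    | zero => exact ⟨[], rfl, .nil _⟩
    | succ n ih =>
      obtain ⟨l, hl, h⟩ := ih (Nat.zero_le _)
      exact ⟨_ :: l, congrArg Nat.succ hl, .wait _ _ h⟩
  | cons ω a ih =>
    cases n with
    | zero => exact absurd h (Nat.not_succ_le_zero _)
    | succ n =>
      obtain ⟨l, hl, h⟩ := ih (Nat.le_of_succ_le_succ h)
      exact ⟨_ :: l, congrArg Nat.succ hl, .move _ a _ h⟩

/-- Waiting at the end of a path of length at most `n` gives a trajectory of duration `n`, and this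
trajectory determines the path. -/
theorem finite_path_length_le [Finite V] [Finite (Quiver.Total V)] (n : ℕ) :
    Finite {p : Σ x y : V, Quiver.Path x y // p.2.2.length ≤ n} := by
  have := (List.finite_length_eq (V ⊕ Quiver.Total V) n).to_subtype
  choose l hl h using
    fun p : {p : Σ x y : V, Quiver.Path x y // p.2.2.length ≤ n} =>
      exists_isTrajectoryOver p.1.2.2 p.2
  refine Finite.of_injective (β := V × {l : List (V ⊕ Quiver.Total V) | l.length = n})
    (fun p => (p.1.2.1, ⟨l p, hl p⟩)) fun p q hpq => ?_
  have h₁ := h p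
  have h₂ := h q
  rw [Prod.mk.injEq, Subtype.mk.injEq] at hpq
  obtain ⟨h₃, h₄⟩ := hpq
  rw [← h₄] at h₂
  generalize l p = s at h₁ h₂
  obtain ⟨⟨x, y, ω⟩, hp⟩ := p
  obtain ⟨⟨x', y', ω'⟩, hq⟩ := q
  cases h₃
  cases h₁.path_unique h₂
  rfl

instance [Finite V] [Finite (Quiver.Total V)] (n : ℕ) : Finite (NonCycle V n) := by
  have := finite_path_length_le (V := V) n
  refine Finite.of_injective (β := {p : Σ x y : V, Quiver.Path x y // p.2.2.length ≤ n})
    (fun δ => ⟨⟨δ.source, δ.target, δ.path⟩, δ.length_le⟩) ?_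
  rintro ⟨x, y, ω, _, _⟩ ⟨x', y', ω', _, _⟩ h
  cases h
  rfl

instance [Finite V] [Finite (Quiver.Total V)] (n : ℕ) : Finite (PosCycle V n) := by
  have := finite_path_length_le (V := V) n
  refine Finite.of_injective (β := {p : Σ x y : V, Quiver.Path x y // p.2.2.length ≤ n})
    (fun γ => ⟨⟨γ.base, γ.base, γ.path⟩, γ.length_le⟩) ?_
  rintro ⟨x, ω, _, _⟩ ⟨x', ω', _, _⟩ h
  cases h
  rfl

theorem NonCycle.sigma_ne {n : ℕ} {δ δ' : NonCycle V n} (h : δ ≠ δ') :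
    (⟨δ.source, δ.target, δ.path⟩ : Σ x y : V, Quiver.Path x y) ≠
      ⟨δ'.source, δ'.target, δ'.path⟩ := by
  obtain ⟨x, y, ω, _, _⟩ := δ
  obtain ⟨x', y', ω', _, _⟩ := δ'
  intro h'
  cases h'
  exact h rfl

theorem PosCycle.sigma_ne {n : ℕ} {γ γ' : PosCycle V n} (h : γ ≠ γ') :
    (⟨γ.base, γ.base, γ.path⟩ : Σ x y : V, Quiver.Path x y) ≠ ⟨γ'.base, γ'.base, γ'.path⟩ := by
  obtain ⟨x, ω, _, _⟩ := γ
  obtain ⟨x', ω', _, _⟩ := γ'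
  intro h'
  cases h'
  exact h rfl

instance : IsEmpty (NonCycle V 0) :=
  ⟨fun δ => absurd (QSet.length_pos_of_ne δ.path δ.ne) (not_lt.2 δ.length_le)⟩

instance : IsEmpty (PosCycle V 0) := ⟨fun γ => absurd γ.pos (not_lt.2 γ.length_le)⟩

theorem isEmpty_posCycle_one (hQ : IsSimplyLaced V) : IsEmpty (PosCycle V 1) := by
  refine ⟨fun ⟨x, γ, hpos, hle⟩ => ?_⟩
  cases γ with
  | nil => exact absurd hpos (lt_irrefl 0)
  | cons ω a =>
    cases Quiver.Path.eq_of_length_zero ω (Nat.le_zero.1 (Nat.le_of_succ_le_succ hle))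
    exact (hQ.loopless _).false a

end FinitePaths

/-! ### Classes of families of cocycles -/

section Classes

variable {k : Type*} [Field k] {X : ℕ → Type*} [∀ n, AddCommGroup (X n)] [∀ n, Module k (X n)]
  (d : ∀ n, X n →ₗ[k] X (n + 1))

theorem cohomologyClass_eq_zero_iff {n : ℕ} {f : X n} {hf : d n f = 0} :
    cohomologyClass d f hf = 0 ↔ f ∈ coboundaries d n :=
  (Submodule.Quotient.mk_eq_zero _).trans Iff.rfl

theorem exists_cohomologyClass_eq {n : ℕ} (c : CochainCohomology d n) :
    ∃ f hf, cohomologyClass d (n := n) f hf = c := by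
  obtain ⟨⟨f, hf⟩, rfl⟩ := Submodule.Quotient.mk_surjective _ c
  exact ⟨f, hf, rfl⟩

/-- The linear map sending a cocycle to its class. -/
def cocycleClass (n : ℕ) : LinearMap.ker (d n) →ₗ[k] CochainCohomology d n := Submodule.mkQ _

theorem cocycleClass_surjective (n : ℕ) : Function.Surjective (cocycleClass d n) :=
  Submodule.mkQ_surjective _

theorem cocycleClass_eq_zero_iff {n : ℕ} {z : LinearMap.ker (d n)} :
    cocycleClass d n z = 0 ↔ (z : X n) ∈ coboundaries d n :=
  (Submodule.Quotient.mk_eq_zero _).trans Iff.rfl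

/-- The linear map sending an element of `W` to the class of the cocycle `r w`. -/
def classMap {C : Type*} [AddCommGroup C] [Module k C] (W : Submodule k C) {n : ℕ} (r : C →ₗ[k] X n)
    (h : ∀ w ∈ W, d n (r w) = 0) : W →ₗ[k] CochainCohomology d n :=
  Submodule.mkQ _ ∘ₗ (r ∘ₗ W.subtype).codRestrict (LinearMap.ker (d n)) fun w => h w w.2

/-- The linear map to a finite direct sum with given components. -/
noncomputable def toDirectSum {ι : Type*} [Finite ι] {M : ι → Type*} [∀ i, AddCommMonoid (M i)]
    [∀ i, Module k (M i)] {W : Type*} [AddCommMonoid W] [Module k W] (r : ∀ i, W →ₗ[k] M i) :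
    W →ₗ[k] ⨁ i, M i :=
  haveI := Fintype.ofFinite ι
  (DirectSum.linearEquivFunOnFintype k ι M).symm.toLinearMap ∘ₗ LinearMap.pi r

theorem toDirectSum_apply {ι : Type*} [Finite ι] {M : ι → Type*} [∀ i, AddCommMonoid (M i)]
    [∀ i, Module k (M i)] {W : Type*} [AddCommMonoid W] [Module k W] (r : ∀ i, W →ₗ[k] M i)
    (w : W) (i : ι) : toDirectSum r w i = r i w :=
  haveI := Fintype.ofFinite ι
  congrFun ((DirectSum.linearEquivFunOnFintype k ι M).apply_symm_apply (LinearMap.pi r w)) i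

end Classes

namespace QSet

variable {k : Type*} [Field k] {V : Type v} [Quiver.{w + 1} V] (Δ : QSet.{u} k V)

/-! ### The subcomplex of cochains concentrated on the non cycles -/

/-- The Hochschild cochains of `Λ` whose restrictions to `A` and to all cycles vanish. -/
def offCycles (n : ℕ) : Submodule k (HochschildCochain k Δ.Lam n) where
  carrier := {F | Δ.diagRes n F = 0 ∧ ∀ (x : V) (γ : Quiver.Path x x), Δ.pathRes γ n F = 0}
  add_mem' := by
    rintro F G ⟨hF, hF'⟩ ⟨hG, hG'⟩
    exact ⟨by rw [map_add, hF, hG, add_zero], fun x γ => by rw [map_add, hF', hG', add_zero]⟩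
  zero_mem' := ⟨map_zero _, fun x γ => map_zero _⟩
  smul_mem' := by
    rintro c F ⟨hF, hF'⟩
    exact ⟨by rw [map_smul, hF, smul_zero], fun x γ => by rw [map_smul, hF', smul_zero]⟩

variable {Δ}

theorem mem_offCycles_of_posCycle (hQ : IsSimplyLaced V) {n : ℕ} {F : HochschildCochain k Δ.Lam n}
    (hA : Δ.diagRes n F = 0) (hC : ∀ γ : PosCycle V n, Δ.pathRes γ.path n F = 0) :
    F ∈ Δ.offCycles n := by
  refine ⟨hA, fun x γ => ?_⟩
  rcases Nat.eq_zero_or_pos γ.length with h | h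
  · exact pathRes_eq_zero_of_diagRes_eq_zero hQ γ h hA
  · rcases le_or_gt γ.length n with h' | h'
    · exact hC ⟨x, γ, h, h'⟩
    · exact @Subsingleton.elim _ (subsingleton_pathCochain γ h') _ _

theorem pathRes_eq_zero_of_nonCycle {n : ℕ} {F : HochschildCochain k Δ.Lam n}
    (hF : F ∈ Δ.offCycles n) (h : ∀ δ : NonCycle V n, Δ.pathRes δ.path n F = 0) {x y : V}
    (ω : Quiver.Path x y) : Δ.pathRes ω n F = 0 := by
  by_cases hxy : x = y
  · subst hxy
    exact hF.2 x ω
  · rcases le_or_gt ω.length n with h' | h'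
    · exact h ⟨x, y, ω, hxy, h'⟩
    · exact @Subsingleton.elim _ (subsingleton_pathCochain ω h') _ _

theorem eq_zero_of_cocycle_mem_offCycles [Finite V] (hQ : IsSimplyLaced V)
    {z : HochschildCochain k Δ.Lam 0} (hz : hochschildD k Δ.Lam 0 z = 0)
    (hN : z ∈ Δ.offCycles 0) : z = 0 := by
  have := Fintype.ofFinite V
  rw [← peirceProj_eq_self_of_cocycle Δ.idem sum_idem_mul_idem z hz]
  exact peirceProj_eq_zero hQ fun x y ω => pathRes_eq_zero_of_nonCycle hN (fun δ => isEmptyElim δ) ω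

variable [Finite V] [Finite (Quiver.Total V)]

theorem pathExt_mem_offCycles {x y : V} (hxy : x ≠ y) (ω : Quiver.Path x y) {n : ℕ}
    (f : Δ.PathCochain ω n) : Δ.pathExt ω n f ∈ Δ.offCycles n :=
  ⟨diagRes_pathExt (length_pos_of_ne ω hxy) f, fun _ γ => pathRes_pathExt_cycle hxy γ f⟩

/-- A cocycle of the subcomplex without components along paths is the coboundary of an element of
the subcomplex: the Peirce projection provides a primitive, and after subtracting from it its own
projection and correcting it on `A`, it lies in the subcomplex. -/
theorem exists_mem_offCycles_hochschildD_eq (hQ : IsSimplyLaced V) {n : ℕ}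
    {z : HochschildCochain k Δ.Lam (n + 1)} (hz : hochschildD k Δ.Lam (n + 1) z = 0)
    (hN : z ∈ Δ.offCycles (n + 1))
    (h : ∀ δ : NonCycle V (n + 1), Δ.pathRes δ.path (n + 1) z = 0) :
    ∃ G ∈ Δ.offCycles n, hochschildD k Δ.Lam n G = z := by
  classical
  have := Fintype.ofFinite V
  have hπ : peirceProj Δ.idem (n + 1) z = 0 :=
    peirceProj_eq_zero hQ fun x y ω => pathRes_eq_zero_of_nonCycle hN h ω
  obtain ⟨G₀, hG₀⟩ := exists_peirceProj_sub_eq Δ.idem sum_idem_mul_idem z hz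
  rw [hπ, zero_sub] at hG₀
  have hG₁ : hochschildD k Δ.Lam n (peirceProj Δ.idem n G₀ - G₀) = z := by
    rw [map_sub, hochschildD_peirceProj Δ.idem sum_idem_mul_idem, ← hG₀, map_neg, hπ, neg_zero,
      zero_sub, neg_neg]
  have hres : ∀ {x y : V} (ω : Quiver.Path x y),
      Δ.pathRes ω n (peirceProj Δ.idem n G₀ - G₀) = 0 := fun ω => by
    rw [map_sub, pathRes_peirceProj, sub_self]
  have hL : hochschildD k Δ.Diag n (Δ.diagRes n G₀) = 0 := by
    rw [← diagRes_hochschildD, ← hG₀, map_neg, hN.1, neg_zero]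
  have hd := diagRes_peirceProj G₀
  cases n with
  | zero =>
    rw [peirceProj_eq_self_of_cocycle _ sum_single_mul_single _ hL] at hd
    exact ⟨_, ⟨by rw [map_sub, hd, sub_self], fun x γ => hres γ⟩, hG₁⟩
  | succ n =>
    obtain ⟨L, hL'⟩ := exists_peirceProj_sub_eq _ sum_single_mul_single _ hL
    rw [← hd, ← map_sub] at hL'
    refine ⟨peirceProj Δ.idem (n + 1) G₀ - G₀ - hochschildD k Δ.Lam n (Δ.diagExt n L),
      mem_offCycles_of_posCycle hQ ?_ fun γ => ?_, ?_⟩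
    · rw [map_sub, hL', diagRes_hochschildD, diagRes_diagExt, sub_self]
    · rw [map_sub, hres, pathRes_hochschildD_cycle hQ, pathRes_diagExt γ.pos, map_zero, sub_zero]
    · rw [map_sub, hG₁, hochschildD_comp_hochschildD, sub_zero]

/-! ### Cochains with prescribed restrictions -/

theorem pathRes_sum_pathExt_nonCycle [∀ n, Fintype (NonCycle V n)] {n m : ℕ}
    (f : ∀ δ : NonCycle V n, Δ.PathCochain δ.path m) (δ : NonCycle V n) :
    Δ.pathRes δ.path m (∑ δ' : NonCycle V n, Δ.pathExt δ'.path m (f δ')) = f δ := by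
  rw [map_sum, Finset.sum_eq_single δ, pathRes_pathExt]
  · exact fun δ' _ h => pathRes_pathExt_of_ne (NonCycle.sigma_ne h) _
  · exact fun h => absurd (Finset.mem_univ _) h

theorem pathRes_sum_pathExt_posCycle [∀ n, Fintype (PosCycle V n)] {n m : ℕ}
    (f : ∀ γ : PosCycle V n, Δ.PathCochain γ.path m) (γ : PosCycle V n) :
    Δ.pathRes γ.path m (∑ γ' : PosCycle V n, Δ.pathExt γ'.path m (f γ')) = f γ := by
  rw [map_sum, Finset.sum_eq_single γ, pathRes_pathExt]
  · exact fun γ' _ h => pathRes_pathExt_of_ne (PosCycle.sigma_ne h) _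
  · exact fun h => absurd (Finset.mem_univ _) h

theorem exists_diagRes_pathRes_eq {n m : ℕ} (L : HochschildCochain k Δ.Diag m)
    (f : ∀ γ : PosCycle V n, Δ.PathCochain γ.path m) :
    ∃ F, Δ.diagRes m F = L ∧ ∀ γ : PosCycle V n, Δ.pathRes γ.path m F = f γ := by
  have := fun n => Fintype.ofFinite (PosCycle V n)
  refine ⟨Δ.diagExt m L + ∑ γ : PosCycle V n, Δ.pathExt γ.path m (f γ), ?_, fun γ => ?_⟩
  · rw [map_add, diagRes_diagExt, map_sum,
      Finset.sum_eq_zero fun γ _ => diagRes_pathExt γ.pos _, add_zero]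
  · rw [map_add, pathRes_diagExt γ.pos, zero_add, pathRes_sum_pathExt_posCycle]

theorem exists_mem_offCycles_pathRes_eq (hQ : IsSimplyLaced V) {n m : ℕ}
    (f : ∀ δ : NonCycle V n, Δ.PathCochain δ.path m) :
    ∃ F ∈ Δ.offCycles m, (∀ δ : NonCycle V n, Δ.pathRes δ.path m F = f δ) ∧
      ((∀ δ, Δ.pathD δ.path m (f δ) = 0) → hochschildD k Δ.Lam m F = 0) := by
  have := fun n => Fintype.ofFinite (NonCycle V n)
  refine ⟨∑ δ : NonCycle V n, Δ.pathExt δ.path m (f δ),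
    Submodule.sum_mem _ fun δ _ => pathExt_mem_offCycles δ.ne _ _,
    pathRes_sum_pathExt_nonCycle f, fun h => ?_⟩
  rw [map_sum]
  refine Finset.sum_eq_zero fun δ _ => ?_
  rw [hochschildD_pathExt hQ δ.ne, h, map_zero]

end QSet

namespace QSet

variable {k : Type*} [Field k] {V : Type v} [Quiver.{w + 1} V] {Δ : QSet.{u} k V}

/-! ### Bimodule endomorphisms of `M` as Hochschild cochains -/

variable (Δ) in
/-- A linear endomorphism of `M`, extended by zero to a Hochschild `1`-cochain of `Λ = A ⊕ M`. -/
def endCochain : (Δ.Bimod →ₗ[k] Δ.Bimod) →ₗ[k] HochschildCochain k Δ.Lam 1 where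
  toFun φ := ((TrivSqZeroExt.inrHom Δ.Diag Δ.Bimod).restrictScalars k ∘ₗ φ ∘ₗ
    (TrivSqZeroExt.sndHom Δ.Diag Δ.Bimod).restrictScalars k).compMultilinearMap
      (MultilinearMap.ofSubsingleton k Δ.Lam Δ.Lam 0 LinearMap.id)
  map_add' _ _ := MultilinearMap.ext fun _ => TrivSqZeroExt.inr_add _ _ _
  map_smul' c φ := MultilinearMap.ext fun l => TrivSqZeroExt.inr_smul _ c (φ (l 0).snd)

theorem endCochain_apply (φ : Δ.Bimod →ₗ[k] Δ.Bimod) (l : Fin 1 → Δ.Lam) :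
    Δ.endCochain φ l = TrivSqZeroExt.inr (φ (l 0).snd) := rfl

theorem mul_inr (l : Δ.Lam) (m : Δ.Bimod) :
    l * TrivSqZeroExt.inr m = TrivSqZeroExt.inr (l.fst • m) := by
  refine TrivSqZeroExt.ext (mul_zero _) ?_
  change l.fst • m + MulOpposite.op (0 : Δ.Diag) • l.snd = l.fst • m
  rw [MulOpposite.op_zero, zero_smul, add_zero]

theorem inr_mul (l : Δ.Lam) (m : Δ.Bimod) :
    TrivSqZeroExt.inr m * l = TrivSqZeroExt.inr (MulOpposite.op l.fst • m) := by
  refine TrivSqZeroExt.ext (zero_mul _) ?_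
  change (0 : Δ.Diag) • l.snd + MulOpposite.op l.fst • m = MulOpposite.op l.fst • m
  rw [zero_smul, zero_add]

theorem hochschildD_one_apply (F : HochschildCochain k Δ.Lam 1) (a b : Δ.Lam) :
    hochschildD k Δ.Lam 1 F ![a, b] = a * F ![b] - F ![a * b] + F ![a] * b := by
  rw [hochschildD_apply]
  have h₁ : Fin.tail ![a, b] = ![b] := rfl
  have h₂ : Fin.init ![a, b] = ![a] := by
    funext i
    fin_cases i
    rfl
  have h₃ : Fin.contractNth (Fin.castSucc (0 : Fin 1)) (· * ·) ![a, b] = ![a * b] := by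
    funext i
    fin_cases i
    rfl
  rw [h₁, h₂, Fin.sum_univ_one, h₃]
  simp [sub_eq_add_neg]

theorem hochschildD_endCochain {φ : Δ.Bimod →ₗ[k] Δ.Bimod} (hφ : φ ∈ Δ.bimodEnd) :
    hochschildD k Δ.Lam 1 (Δ.endCochain φ) = 0 := by
  refine MultilinearMap.ext fun l => ?_
  obtain ⟨a, b, rfl⟩ : ∃ a b, l = ![a, b] := ⟨l 0, l 1, by funext i; fin_cases i <;> rfl⟩
  rw [hochschildD_one_apply]
  change a * TrivSqZeroExt.inr (φ b.snd) - TrivSqZeroExt.inr (φ (a * b).snd) +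
    TrivSqZeroExt.inr (φ a.snd) * b = 0
  rw [mul_inr, inr_mul, TrivSqZeroExt.snd_mul, map_add, hφ.1, hφ.2, TrivSqZeroExt.inr_add]
  abel

theorem endCochain_mem_offCycles (hQ : IsSimplyLaced V) (φ : Δ.Bimod →ₗ[k] Δ.Bimod) :
    Δ.endCochain φ ∈ Δ.offCycles 1 :=
  mem_offCycles_of_posCycle hQ (MultilinearMap.ext fun _ => rfl)
    fun γ => ((isEmpty_posCycle_one hQ).false γ).elim

/-- A bimodule endomorphism of `M` that bounds a cochain of the subcomplex is zero, as that cochain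
is an element of `M` and `M M = 0`. -/
theorem eq_zero_of_hochschildD_eq_endCochain {φ : Δ.Bimod →ₗ[k] Δ.Bimod}
    {G : HochschildCochain k Δ.Lam 0} (hG : G ∈ Δ.offCycles 0)
    (h : hochschildD k Δ.Lam 0 G = Δ.endCochain φ) : φ = 0 := by
  have hfst : (G ![]).fst = 0 := by
    have h' := congrArg (fun L => L ![]) hG.1
    change (G fun i => TrivSqZeroExt.inl (![] i)).fst = 0 at h'
    rwa [Subsingleton.elim (fun i => TrivSqZeroExt.inl (![] i)) ![]] at h'
  have hM : G ![] = TrivSqZeroExt.inr (G ![]).snd := TrivSqZeroExt.ext hfst rfl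
  refine LinearMap.ext fun m => TrivSqZeroExt.inr_injective (R := Δ.Diag) ?_
  have h' := congrArg (fun F => F ![TrivSqZeroExt.inr m]) h
  change _ = TrivSqZeroExt.inr (φ m) at h'
  rw [← h', hochschildD_apply, Subsingleton.elim (Fin.tail _) ![],
    Subsingleton.elim (Fin.init _) ![], hM]
  change TrivSqZeroExt.inr m * TrivSqZeroExt.inr (G ![]).snd + ∑ j : Fin 0, _ +
    (-1 : k) ^ (0 + 1) • (TrivSqZeroExt.inr (G ![]).snd * TrivSqZeroExt.inr m) = _
  rw [TrivSqZeroExt.inr_mul_inr, TrivSqZeroExt.inr_mul_inr, Finset.univ_eq_empty,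
    Finset.sum_empty, smul_zero, add_zero, add_zero]
  rfl

/-- Every `1`-cocycle along a non cycle comes from a bimodule endomorphism of `M`. -/
theorem exists_endCochain_eq_pathExt [Finite V] [Finite (Quiver.Total V)] (hQ : IsSimplyLaced V)
    {x y : V} (hxy : x ≠ y) (ω : Quiver.Path x y) (f : Δ.PathCochain ω 1)
    (hf : Δ.pathD ω 1 f = 0) : ∃ φ ∈ Δ.bimodEnd, Δ.endCochain φ = Δ.pathExt ω 1 f := by
  set F := Δ.pathExt ω 1 f with hF
  have hd : hochschildD k Δ.Lam 1 F = 0 := by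
    rw [hF, hochschildD_pathExt hQ hxy, hf, map_zero]
  -- the value lies in a corner between distinct vertices, hence in `M`
  have hfst : ∀ l, (F l).fst = 0 := fun l => by
    rw [hF, pathExt_apply, TrivSqZeroExt.fst_sum]
    refine Finset.sum_eq_zero fun τ _ => funext fun z => ?_
    rw [← corner_eq_self, fst_idem_mul, fst_mul_idem]
    split_ifs with h₁ h₂
    · exact absurd (h₂.symm.trans h₁) hxy
    · rfl
    · rfl
  have hinl : ∀ r : Δ.Diag, F ![TrivSqZeroExt.inl r] = 0 := fun r => by
    rw [hF, pathExt_apply]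
    refine Finset.sum_eq_zero fun τ _ => ?_
    obtain ⟨i, hi⟩ := exists_trajectory_apply_eq_inr (length_pos_of_ne ω hxy) τ
    rw [(f τ).map_coord_zero i]
    · rfl
    · rw [Subsingleton.elim i 0] at hi ⊢
      exact entryProj_inl_of_isRight hi r
  have hc : ∀ a : Δ.Lam, ![a] = fun _ : Fin 1 => a := fun a => by
    funext i
    fin_cases i
    rfl
  let φ : Δ.Bimod →ₗ[k] Δ.Bimod :=
    (TrivSqZeroExt.sndHom Δ.Diag Δ.Bimod).restrictScalars k ∘ₗ
      (MultilinearMap.ofSubsingleton k Δ.Lam Δ.Lam (0 : Fin 1)).symm F ∘ₗ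
        (TrivSqZeroExt.inrHom Δ.Diag Δ.Bimod).restrictScalars k
  have hφ : ∀ m, F ![TrivSqZeroExt.inr m] = TrivSqZeroExt.inr (φ m) := fun m => by
    refine TrivSqZeroExt.ext (hfst _) ?_
    change _ = (F fun _ => TrivSqZeroExt.inr m).snd
    rw [hc]
  refine ⟨φ, ⟨fun r m => ?_, fun r m => ?_⟩, MultilinearMap.ext fun l => ?_⟩
  · have h := congrArg (fun G => G ![TrivSqZeroExt.inl r, TrivSqZeroExt.inr m]) hd
    change hochschildD k Δ.Lam 1 F ![TrivSqZeroExt.inl r, TrivSqZeroExt.inr m] = 0 at h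
    rw [hochschildD_one_apply, hinl, zero_mul, add_zero, mul_inr, hφ, hφ, mul_inr,
      sub_eq_zero] at h
    exact (TrivSqZeroExt.inr_injective h).symm
  · have h := congrArg (fun G => G ![TrivSqZeroExt.inr m, TrivSqZeroExt.inl r.unop]) hd
    change hochschildD k Δ.Lam 1 F ![TrivSqZeroExt.inr m, TrivSqZeroExt.inl r.unop] = 0 at h
    rw [hochschildD_one_apply, hinl, mul_zero, zero_sub, inr_mul, hφ, hφ, inr_mul,
      neg_add_eq_zero] at h
    exact TrivSqZeroExt.inr_injective h
  · have hl : l = ![TrivSqZeroExt.inl (l 0).fst + TrivSqZeroExt.inr (l 0).snd] := by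
      funext i
      fin_cases i
      exact (TrivSqZeroExt.inl_fst_add_inr_snd_eq _).symm
    have hadd : ∀ a b : Δ.Lam, F ![a + b] = F ![a] + F ![b] := fun a b => by
      have h := ((MultilinearMap.ofSubsingleton k Δ.Lam Δ.Lam (0 : Fin 1)).symm F).map_add a b
      change (F fun _ => a + b) = (F fun _ => a) + (F fun _ => b) at h
      rw [hc, hc, hc, h]
    rw [endCochain_apply, hl, hadd, hinl, zero_add, hφ]
    rw [← hl]

end QSet

namespace QSet

variable {k : Type*} [Field k] {V : Type v} [Quiver.{w + 1} V] {Δ : QSet.{u} k V}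

/-! ### Cohomology of the subcomplex and of the quotient -/

variable (Δ) in
/-- The cocycles of the subcomplex. -/
abbrev offCyclesCocycles (n : ℕ) : Submodule k (HochschildCochain k Δ.Lam n) :=
  Δ.offCycles n ⊓ LinearMap.ker (hochschildD k Δ.Lam n)

variable (Δ) in
/-- The cochains that represent a cocycle of the quotient by the subcomplex. -/
abbrev cyclesCocycles (n : ℕ) : Submodule k (HochschildCochain k Δ.Lam n) :=
  (Δ.offCycles (n + 1)).comap (hochschildD k Δ.Lam n)

theorem hochschildD_diagRes_of_mem {n : ℕ} {F : HochschildCochain k Δ.Lam n}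
    (hF : F ∈ Δ.cyclesCocycles n) : hochschildD k Δ.Diag n (Δ.diagRes n F) = 0 := by
  rw [← diagRes_hochschildD]
  exact hF.1

variable (Δ) in
/-- A bimodule endomorphism of `M`, as a cocycle of the subcomplex. -/
def endCocycle (hQ : IsSimplyLaced V) : Δ.bimodEnd →ₗ[k] Δ.offCyclesCocycles 1 :=
  (Δ.endCochain ∘ₗ Δ.bimodEnd.subtype).codRestrict _ fun φ =>
    ⟨endCochain_mem_offCycles hQ φ.1, hochschildD_endCochain φ.2⟩

variable [Finite V] [Finite (Quiver.Total V)]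

theorem pathD_pathRes_of_cocycle (hQ : IsSimplyLaced V) {n : ℕ} {F : HochschildCochain k Δ.Lam n}
    (hF : F ∈ Δ.offCyclesCocycles n) (δ : NonCycle V n) :
    Δ.pathD δ.path n (Δ.pathRes δ.path n F) = 0 := by
  rw [← pathRes_hochschildD_of_ne hQ δ.ne _ _ hF.1.2, LinearMap.mem_ker.1 hF.2, map_zero]

variable (Δ) in
/-- The map from the cocycles of the subcomplex to the cohomology along the non cycles. -/
noncomputable def nonCycleMap (hQ : IsSimplyLaced V) (n : ℕ) :
    Δ.offCyclesCocycles n →ₗ[k] Δ.NonCycleCohomology n :=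
  toDirectSum (W := Δ.offCyclesCocycles n) fun δ =>
    classMap (Δ.pathD δ.path) (Δ.offCyclesCocycles n) (Δ.pathRes δ.path n) fun _ hF =>
      pathD_pathRes_of_cocycle hQ hF δ

theorem nonCycleMap_apply (hQ : IsSimplyLaced V) {n : ℕ} (z : Δ.offCyclesCocycles n)
    (δ : NonCycle V n) :
    Δ.nonCycleMap hQ n z δ = Δ.pathClass (Δ.pathRes δ.path n z)
      (pathD_pathRes_of_cocycle hQ z.2 δ) := by
  rw [nonCycleMap, toDirectSum_apply]
  rfl

theorem nonCycleMap_pathExt (hQ : IsSimplyLaced V) {n : ℕ} (δ : NonCycle V n)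
    (f : Δ.PathCochain δ.path n) (hf : Δ.pathD δ.path n f = 0)
    (h : Δ.pathExt δ.path n f ∈ Δ.offCyclesCocycles n) :
    Δ.nonCycleMap hQ n ⟨_, h⟩ = Δ.nonCycleClass δ f hf := by
  classical
  refine DFinsupp.ext fun δ' => ?_
  rw [nonCycleMap_apply, nonCycleClass]
  by_cases hδ : δ' = δ
  · subst hδ
    refine Eq.trans ?_ (DirectSum.of_eq_same
      (β := fun δ : NonCycle V n => Δ.PathCohomology δ.path n) _ _).symm
    simp only [pathRes_pathExt]
  · refine Eq.trans ?_ (DirectSum.of_eq_of_ne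
      (β := fun δ : NonCycle V n => Δ.PathCohomology δ.path n) _ _ _ hδ).symm
    refine (cohomologyClass_eq_zero_iff _).2 ?_
    rw [pathRes_pathExt_of_ne (NonCycle.sigma_ne (Ne.symm hδ))]
    exact zero_mem _

theorem nonCycleMap_surjective (hQ : IsSimplyLaced V) (n : ℕ) :
    Function.Surjective (Δ.nonCycleMap hQ n) := by
  intro c
  choose f hf hc using fun δ : NonCycle V n => exists_cohomologyClass_eq (Δ.pathD δ.path) (c δ)
  obtain ⟨F, hN, hF, hd⟩ := exists_mem_offCycles_pathRes_eq hQ f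
  refine ⟨⟨F, hN, hd hf⟩, DFinsupp.ext fun δ => ?_⟩
  rw [nonCycleMap_apply, ← hc δ]
  simp only [hF]
  rfl

theorem nonCycleMap_eq_zero_iff (hQ : IsSimplyLaced V) {n : ℕ}
    (z : Δ.offCyclesCocycles (n + 1)) :
    Δ.nonCycleMap hQ (n + 1) z = 0 ↔ ∃ G ∈ Δ.offCycles n, hochschildD k Δ.Lam n G = z := by
  constructor
  · intro h
    have h' : ∀ δ : NonCycle V (n + 1), ∃ f : Δ.PathCochain δ.path n,
        Δ.pathD δ.path n f = Δ.pathRes δ.path (n + 1) z := fun δ =>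
      (cohomologyClass_eq_zero_iff (Δ.pathD δ.path)
        (hf := pathD_pathRes_of_cocycle hQ z.2 δ)).1
        ((nonCycleMap_apply hQ z δ).symm.trans (by rw [h]; rfl))
    choose f hf using h'
    obtain ⟨F, hN, hF, -⟩ := exists_mem_offCycles_pathRes_eq hQ f
    have hdN : hochschildD k Δ.Lam n F ∈ Δ.offCycles (n + 1) :=
      ⟨by rw [diagRes_hochschildD, hN.1, map_zero],
        fun x γ => by rw [pathRes_hochschildD_cycle hQ, hN.2, map_zero]⟩
    -- Subtracting the coboundary of `F` removes all components of `z` along non cycles.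
    obtain ⟨G, hG, hGz⟩ := exists_mem_offCycles_hochschildD_eq hQ
      (z := (z : HochschildCochain k Δ.Lam (n + 1)) - hochschildD k Δ.Lam n F)
      (by rw [map_sub, LinearMap.mem_ker.1 z.2.2, hochschildD_comp_hochschildD, sub_zero])
      (sub_mem z.2.1 hdN) fun δ => by
        rw [map_sub, pathRes_hochschildD_of_ne hQ δ.ne _ _ hN.2, hF, hf, sub_self]
    exact ⟨G + F, add_mem hG hN, by rw [map_add, hGz, sub_add_cancel]⟩
  · rintro ⟨G, hG, hz⟩
    refine DFinsupp.ext fun δ => ?_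
    rw [nonCycleMap_apply]
    refine (cohomologyClass_eq_zero_iff _).2 ⟨Δ.pathRes δ.path n G, ?_⟩
    rw [← pathRes_hochschildD_of_ne hQ δ.ne _ _ hG.2, hz]

theorem pathD_pathRes_of_mem (hQ : IsSimplyLaced V) {n : ℕ} {F : HochschildCochain k Δ.Lam n}
    (hF : F ∈ Δ.cyclesCocycles n) (γ : PosCycle V n) :
    Δ.pathD γ.path n (Δ.pathRes γ.path n F) = 0 := by
  rw [← pathRes_hochschildD_cycle hQ]
  exact hF.2 _ _

theorem mem_comap_offCycles (hQ : IsSimplyLaced V) {n : ℕ} {F : HochschildCochain k Δ.Lam n}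
    (hA : hochschildD k Δ.Diag n (Δ.diagRes n F) = 0)
    (hC : ∀ γ : PosCycle V n, Δ.pathD γ.path n (Δ.pathRes γ.path n F) = 0) :
    F ∈ Δ.cyclesCocycles n := by
  refine mem_offCycles_of_posCycle hQ (by rw [diagRes_hochschildD, hA]) fun γ => ?_
  rw [pathRes_hochschildD_cycle hQ]
  rcases le_or_gt γ.path.length n with h | h
  · exact hC ⟨γ.base, γ.path, γ.pos, h⟩
  -- Along a cycle of length `n + 1` there are no `n`-cochains.
  · rw [@Subsingleton.elim _ (subsingleton_pathCochain γ.path h) (Δ.pathRes γ.path n F) 0, map_zero]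

variable (Δ) in
/-- The map from the cocycles of the quotient complex to the cohomology of `A` and along the
cycles. -/
noncomputable def cycleMap (hQ : IsSimplyLaced V) (n : ℕ) :
    Δ.cyclesCocycles n →ₗ[k] HochschildComplexCohomology k Δ.Diag n × Δ.PosCycleCohomology n :=
  LinearMap.prod
    (classMap (X := fun n => HochschildCochain k Δ.Diag n) (hochschildD k Δ.Diag)
      (Δ.cyclesCocycles n) (Δ.diagRes n) fun _ hF => hochschildD_diagRes_of_mem hF)
    (toDirectSum (W := Δ.cyclesCocycles n) fun γ =>
      classMap (Δ.pathD γ.path) (Δ.cyclesCocycles n) (Δ.pathRes γ.path n) fun _ hF =>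
        pathD_pathRes_of_mem hQ hF γ)

theorem cycleMap_fst (hQ : IsSimplyLaced V) {n : ℕ} (F : Δ.cyclesCocycles n) :
    (Δ.cycleMap hQ n F).1 =
      hochschildClass (Δ.diagRes n F) (hochschildD_diagRes_of_mem F.2) := rfl

theorem cycleMap_snd (hQ : IsSimplyLaced V) {n : ℕ} (F : Δ.cyclesCocycles n) (γ : PosCycle V n) :
    (Δ.cycleMap hQ n F).2 γ =
      Δ.pathClass (Δ.pathRes γ.path n F) (pathD_pathRes_of_mem hQ F.2 γ) := by
  rw [cycleMap, LinearMap.prod_apply]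
  exact toDirectSum_apply _ _ _

theorem cycleMap_surjective (hQ : IsSimplyLaced V) (n : ℕ) :
    Function.Surjective (Δ.cycleMap hQ n) := by
  rintro ⟨a, c⟩
  obtain ⟨L, hL, rfl⟩ := exists_cohomologyClass_eq (X := fun n => HochschildCochain k Δ.Diag n)
    (hochschildD k Δ.Diag) a
  choose f hf hc using fun γ : PosCycle V n => exists_cohomologyClass_eq (Δ.pathD γ.path) (c γ)
  obtain ⟨F, hFL, hFf⟩ := exists_diagRes_pathRes_eq L f
  have hF := mem_comap_offCycles hQ (F := F) (by rw [hFL, hL]) fun γ => by rw [hFf, hf]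
  refine ⟨⟨F, hF⟩, Prod.ext ?_ (DFinsupp.ext fun γ => ?_)⟩
  · rw [cycleMap_fst]
    simp only [hFL]
    rfl
  · rw [cycleMap_snd, ← hc γ]
    simp only [hFf]
    rfl

theorem cycleMap_eq_zero_iff (hQ : IsSimplyLaced V) {n : ℕ}
    (F : Δ.cyclesCocycles n) :
    Δ.cycleMap hQ n F = 0 ↔
      ∃ b ∈ coboundaries (X := fun n => HochschildCochain k Δ.Lam n) (hochschildD k Δ.Lam) n,
        (F : HochschildCochain k Δ.Lam n) - b ∈ Δ.offCycles n := by
  constructor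
  · intro h
    have hA := (cohomologyClass_eq_zero_iff (X := fun n => HochschildCochain k Δ.Diag n)
      (hochschildD k Δ.Diag) (hf := hochschildD_diagRes_of_mem F.2)).1 (congrArg Prod.fst h)
    have hC := fun γ : PosCycle V n => (cohomologyClass_eq_zero_iff (Δ.pathD γ.path)
      (hf := pathD_pathRes_of_mem hQ F.2 γ)).1
      ((cycleMap_snd hQ F γ).symm.trans (by rw [h]; rfl))
    cases n with
    | zero =>
      refine ⟨0, zero_mem _, ?_⟩
      rw [sub_zero]
      exact mem_offCycles_of_posCycle hQ ((Submodule.mem_bot k).1 hA) fun γ => isEmptyElim γ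
    | succ n =>
      obtain ⟨L, hL⟩ := hA
      choose f hf using hC
      obtain ⟨G, hGL, hGf⟩ := exists_diagRes_pathRes_eq L f
      refine ⟨_, ⟨G, rfl⟩, mem_offCycles_of_posCycle hQ ?_ fun γ => ?_⟩
      · rw [map_sub, diagRes_hochschildD, hGL, hL, sub_self]
      · rw [map_sub, pathRes_hochschildD_cycle hQ, hGf, hf, sub_self]
  · rintro ⟨b, hb, hFb⟩
    have hA : Δ.diagRes n F = Δ.diagRes n b := sub_eq_zero.1 ((map_sub _ _ _).symm.trans hFb.1)
    have hC : ∀ γ : PosCycle V n, Δ.pathRes γ.path n F = Δ.pathRes γ.path n b := fun γ =>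
      sub_eq_zero.1 ((map_sub _ _ _).symm.trans (hFb.2 _ _))
    refine Prod.ext ((cohomologyClass_eq_zero_iff _).2 ?_) (DFinsupp.ext fun γ => ?_)
    · cases n with
      | zero =>
        rw [(Submodule.mem_bot k).1 hb, map_zero] at hA
        exact hA
      | succ n =>
        obtain ⟨G, rfl⟩ := hb
        exact ⟨Δ.diagRes n G, by rw [← diagRes_hochschildD]; exact hA.symm⟩
    · rw [cycleMap_snd]
      refine (cohomologyClass_eq_zero_iff _).2 ?_
      cases n with
      | zero => exact isEmptyElim γ
      | succ n =>
        obtain ⟨G, rfl⟩ := hb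
        exact ⟨Δ.pathRes γ.path n G, by rw [← pathRes_hochschildD_cycle hQ]; exact (hC γ).symm⟩

/-! ### The degree one term -/

theorem exists_nonCycleMap_endCocycle_eq (hQ : IsSimplyLaced V) (δ : NonCycle V 1)
    (f : Δ.PathCochain δ.path 1) (hf : Δ.pathD δ.path 1 f = 0) :
    ∃ φ : Δ.bimodEnd, Δ.nonCycleMap hQ 1 (Δ.endCocycle hQ φ) = Δ.nonCycleClass δ f hf ∧
      Δ.endCochain φ.1 = Δ.pathExt δ.path 1 f := by
  obtain ⟨φ, hφ, h⟩ := exists_endCochain_eq_pathExt hQ δ.ne δ.path f hf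
  have hm : Δ.pathExt δ.path 1 f ∈ Δ.offCyclesCocycles 1 := by
    rw [← h]
    exact ⟨endCochain_mem_offCycles hQ φ, hochschildD_endCochain hφ⟩
  have h' : Δ.endCocycle hQ ⟨φ, hφ⟩ = ⟨Δ.pathExt δ.path 1 f, hm⟩ := Subtype.ext h
  exact ⟨⟨φ, hφ⟩, by rw [h', nonCycleMap_pathExt hQ δ f hf], h⟩

variable (Δ) in
/-- The class of a bimodule endomorphism of `M` in the cohomology along the non cycles. -/
noncomputable def endClass (hQ : IsSimplyLaced V) : Δ.bimodEnd →ₗ[k] Δ.NonCycleCohomology 1 :=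
  Δ.nonCycleMap hQ 1 ∘ₗ Δ.endCocycle hQ

theorem endClass_apply (hQ : IsSimplyLaced V) (φ : Δ.bimodEnd) :
    Δ.endClass hQ φ = Δ.nonCycleMap hQ 1 (Δ.endCocycle hQ φ) := rfl

theorem endClass_bijective (hQ : IsSimplyLaced V) : Function.Bijective (Δ.endClass hQ) := by
  classical
  constructor
  · refine (injective_iff_map_eq_zero (Δ.endClass hQ)).2 fun φ hφ => ?_
    rw [endClass_apply, nonCycleMap_eq_zero_iff] at hφ
    obtain ⟨G, hG, h⟩ := hφ
    exact Subtype.ext (eq_zero_of_hochschildD_eq_endCochain hG h)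
  · intro c
    change c ∈ LinearMap.range (Δ.endClass hQ)
    induction c using DirectSum.induction_on with
    | zero => exact zero_mem _
    | of δ c =>
      obtain ⟨f, hf, rfl⟩ := exists_cohomologyClass_eq (Δ.pathD δ.path) c
      obtain ⟨φ, hφ, -⟩ := exists_nonCycleMap_endCocycle_eq hQ δ f hf
      refine ⟨φ, hφ.trans ?_⟩
      rw [nonCycleClass]
      congr!
    | add c c' h h' => exact add_mem h h'

end QSet

namespace QSet

variable {k : Type*} [Field k] {V : Type v} [Quiver.{w + 1} V] {Δ : QSet.{u} k V}
  [Finite V] [Finite (Quiver.Total V)]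

/-! ### The long exact sequence -/

/-- The long exact sequence of the subcomplex of cochains concentrated on the non cycles, for
arbitrary models `E` and `D` of the cohomology of the Hochschild complexes of `Λ` and `A`. -/
theorem exists_longExactSequence_nonCycleCohomology (hQ : IsSimplyLaced V) {E D : ℕ → Type*}
    [∀ n, AddCommGroup (E n)] [∀ n, Module k (E n)] [∀ n, AddCommGroup (D n)]
    [∀ n, Module k (D n)] (Φ : ∀ n, E n ≃ₗ[k] HochschildComplexCohomology k Δ.Lam n)
    (Ψ : ∀ n, D n ≃ₗ[k] HochschildComplexCohomology k Δ.Diag n) :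
    ∃ (i : ∀ n, Δ.NonCycleCohomology n →ₗ[k] E n)
      (p : ∀ n, E n →ₗ[k] D n × Δ.PosCycleCohomology n)
      (conn : ∀ n, D n × Δ.PosCycleCohomology n →ₗ[k] Δ.NonCycleCohomology (n + 1)),
      (∀ n, Function.Exact (i n) (p n)) ∧
      (∀ n, Function.Exact (p n) (conn n)) ∧
      (∀ n, Function.Exact (conn n) (i (n + 1))) ∧
      (∀ (n : ℕ) (δ : NonCycle V n) (f : Δ.PathCochain δ.path n)
        (hf : Δ.pathD δ.path n f = 0),
        ∃ h, Φ n (i n (Δ.nonCycleClass δ f hf)) = hochschildClass (Δ.pathExt δ.path n f) h) ∧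
      (∀ (n : ℕ) (F : HochschildCochain k Δ.Lam n) (hF : hochschildD k Δ.Lam n F = 0),
        (∃ h, Ψ n (p n ((Φ n).symm (hochschildClass F hF))).1 =
          hochschildClass (Δ.diagRes n F) h) ∧
        ∀ γ : PosCycle V n, ∃ h, (p n ((Φ n).symm (hochschildClass F hF))).2 γ =
          Δ.pathClass (Δ.pathRes γ.path n F) h) ∧
      (∀ (n : ℕ) (F : HochschildCochain k Δ.Lam n)
        (hA : hochschildD k Δ.Diag n (Δ.diagRes n F) = 0)
        (hC : ∀ γ : PosCycle V n, Δ.pathD γ.path n (Δ.pathRes γ.path n F) = 0)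
        (z : D n × Δ.PosCycleCohomology n),
        Ψ n z.1 = hochschildClass (Δ.diagRes n F) hA →
        (∀ γ, z.2 γ = Δ.pathClass (Δ.pathRes γ.path n F) (hC γ)) →
        ∀ δ : NonCycle V (n + 1), ∃ h, conn n z δ =
          Δ.pathClass (Δ.pathRes δ.path (n + 1) (hochschildD k Δ.Lam n F)) h) := by
  let κ : ∀ n, LinearMap.ker (hochschildD k Δ.Lam n) →ₗ[k] E n := fun n =>
    (Φ n).symm.toLinearMap ∘ₗ
      cocycleClass (X := fun n => HochschildCochain k Δ.Lam n) (hochschildD k Δ.Lam) n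
  let ψ : ∀ n, (HochschildComplexCohomology k Δ.Diag n × Δ.PosCycleCohomology n) ≃ₗ[k]
      D n × Δ.PosCycleCohomology n := fun n =>
    LinearEquiv.prodCongr (Ψ n).symm (LinearEquiv.refl k (Δ.PosCycleCohomology n))
  obtain ⟨i, p, conn, hip, hpc, hci, hi, hp, hconn⟩ := exists_longExactSequence
    (C := fun n => HochschildCochain k Δ.Lam n) (E := E)
    (X := fun n => D n × Δ.PosCycleCohomology n) (Y := fun n => Δ.NonCycleCohomology n)
    (hochschildD k Δ.Lam) (fun n F => hochschildD_comp_hochschildD n F) Δ.offCycles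
    (fun n => (ψ n).toLinearMap ∘ₗ Δ.cycleMap hQ n)
    (fun n => (ψ n).surjective.comp (cycleMap_surjective hQ n))
    (fun n F => ((ψ n).map_eq_zero_iff).trans (cycleMap_eq_zero_iff hQ F))
    (Δ.nonCycleMap hQ) (nonCycleMap_surjective hQ)
    (fun z _ => eq_zero_of_cocycle_mem_offCycles hQ z.2.2 z.2.1)
    (fun n z => nonCycleMap_eq_zero_iff hQ z)
    κ (fun n => (Φ n).symm.surjective.comp (cocycleClass_surjective _ n))
    (fun n z => ((Φ n).symm.map_eq_zero_iff).trans (cocycleClass_eq_zero_iff _))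
  refine ⟨i, p, conn, hip, hpc, hci, ?_, ?_, ?_⟩
  · intro n δ f hf
    have h : hochschildD k Δ.Lam n (Δ.pathExt δ.path n f) = 0 := by
      rw [hochschildD_pathExt hQ δ.ne, hf, map_zero]
    refine ⟨h, ?_⟩
    have hN := pathExt_mem_offCycles δ.ne δ.path f
    rw [← nonCycleMap_pathExt hQ δ f hf ⟨hN, h⟩]
    exact (congrArg (Φ n) (hi n _ hN h)).trans ((Φ n).apply_symm_apply _)
  · intro n F hF
    have hN : F ∈ Δ.cyclesCocycles n := by
      rw [Submodule.mem_comap, hF]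
      exact zero_mem _
    have key := hp n F hF (by rw [hF]; exact zero_mem _)
    refine ⟨⟨hochschildD_diagRes_of_mem hN, ?_⟩, fun γ =>
      ⟨pathD_pathRes_of_mem hQ hN γ, ?_⟩⟩
    · exact (congrArg (fun z => Ψ n z.1) key).trans ((Ψ n).apply_symm_apply _)
    · exact (congrArg (fun z => z.2 γ) key).trans (cycleMap_snd hQ ⟨F, hN⟩ γ)
  · intro n F hA hC z hz hz' δ
    have hN := mem_comap_offCycles hQ hA hC
    have key : ψ n (Δ.cycleMap hQ n ⟨F, hN⟩) = z := by
      refine Prod.ext ?_ (DFinsupp.ext fun γ => ?_)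
      · exact (LinearEquiv.symm_apply_eq _).2 hz.symm
      · exact (cycleMap_snd hQ ⟨F, hN⟩ γ).trans (hz' γ).symm
    have h := hconn n F hN
    refine ⟨pathD_pathRes_of_cocycle hQ ⟨hN, hochschildD_comp_hochschildD n F⟩ δ, ?_⟩
    rw [← key]
    exact (congrArg (fun z => z δ) h).trans (nonCycleMap_apply hQ _ δ)

/-- The start of a long exact sequence whose terms `Y 0`, `P 0` and `P 1` vanish. -/
theorem exact_first_terms {k : Type*} [Field k] {Y E D P : ℕ → Type*} {B : Type*}
    [∀ n, AddCommMonoid (Y n)] [∀ n, Module k (Y n)] [∀ n, AddCommGroup (E n)]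
    [∀ n, Module k (E n)] [∀ n, AddCommGroup (D n)] [∀ n, Module k (D n)]
    [∀ n, AddCommMonoid (P n)] [∀ n, Module k (P n)] [AddCommMonoid B] [Module k B]
    [Subsingleton (Y 0)] [Subsingleton (P 0)] [Subsingleton (P 1)]
    (i : ∀ n, Y n →ₗ[k] E n) (p : ∀ n, E n →ₗ[k] D n × P n)
    (conn : ∀ n, D n × P n →ₗ[k] Y (n + 1)) (θ : Y 1 ≃ₗ[k] B)
    (hip : ∀ n, Function.Exact (i n) (p n)) (hpc : ∀ n, Function.Exact (p n) (conn n))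
    (hci : ∀ n, Function.Exact (conn n) (i (n + 1))) :
    let p₀ : E 0 →ₗ[k] D 0 := LinearMap.fst k _ _ ∘ₗ p 0
    let conn₀ : D 0 →ₗ[k] B := θ.toLinearMap ∘ₗ conn 0 ∘ₗ LinearMap.inl k _ _
    let i₁ : B →ₗ[k] E 1 := i 1 ∘ₗ θ.symm.toLinearMap
    let p₁ : E 1 →ₗ[k] D 1 := LinearMap.fst k _ _ ∘ₗ p 1
    let conn₁ : D 1 →ₗ[k] Y 2 := conn 1 ∘ₗ LinearMap.inl k _ _
    Function.Injective p₀ ∧ Function.Exact p₀ conn₀ ∧ Function.Exact conn₀ i₁ ∧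
      Function.Exact i₁ p₁ ∧ Function.Exact p₁ conn₁ ∧ Function.Exact conn₁ (i 2) := by
  intro p₀ conn₀ i₁ p₁ conn₁
  refine ⟨?_, ?_, ?_, ?_, ?_, ?_⟩
  · refine (injective_iff_map_eq_zero _).2 fun e he => ?_
    obtain ⟨c, rfl⟩ := (hip 0 e).1 (Prod.ext he (Subsingleton.elim _ _))
    rw [Subsingleton.elim c 0, map_zero]
  · intro a
    refine (θ.map_eq_zero_iff).trans ((hpc 0 (a, 0)).trans (exists_congr fun e => ?_))
    exact ⟨fun h => congrArg Prod.fst h, fun h => Prod.ext h (Subsingleton.elim _ _)⟩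
  · intro φ
    refine (hci 0 (θ.symm φ)).trans ?_
    constructor
    · rintro ⟨⟨a, c⟩, h⟩
      exact ⟨a, by
        rw [Subsingleton.elim c 0] at h
        exact (congrArg θ h).trans (θ.apply_symm_apply φ)⟩
    · rintro ⟨a, h⟩
      exact ⟨(a, 0), θ.eq_symm_apply.2 h⟩
  · intro e
    refine Iff.trans ?_ ((hip 1 e).trans ?_)
    · exact ⟨fun h => Prod.ext h (Subsingleton.elim _ _), fun h => congrArg Prod.fst h⟩
    · exact ⟨fun ⟨c, h⟩ => ⟨θ c, (congrArg (i 1) (θ.symm_apply_apply c)).trans h⟩,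
        fun ⟨φ, h⟩ => ⟨θ.symm φ, h⟩⟩
  · intro a
    refine (hpc 1 (a, 0)).trans (exists_congr fun e => ?_)
    exact ⟨fun h => congrArg Prod.fst h, fun h => Prod.ext h (Subsingleton.elim _ _)⟩
  · intro c
    refine (hci 1 c).trans ⟨?_, fun ⟨a, h⟩ => ⟨(a, 0), h⟩⟩
    rintro ⟨⟨a, b⟩, h⟩
    exact ⟨a, by
      rw [Subsingleton.elim b 0] at h
      exact h⟩

set_option maxHeartbeats 400000 in
/-- The long exact sequence with the identification of its term `⨁_δ H¹_δ(Δ)`. Here `E` and `D` are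
arbitrary models of the cohomology of the Hochschild complexes of `Λ` and `A`. -/
theorem exists_longExactSequence_bimodEnd (hQ : IsSimplyLaced V) {E D : ℕ → Type*}
    [∀ n, AddCommGroup (E n)] [∀ n, Module k (E n)] [∀ n, AddCommGroup (D n)]
    [∀ n, Module k (D n)]
    (hE : ∀ n, Nonempty (E n ≃ₗ[k] HochschildComplexCohomology k Δ.Lam n))
    (hD : ∀ n, Nonempty (D n ≃ₗ[k] HochschildComplexCohomology k Δ.Diag n)) :
    (∀ (x y : V) (ω : Quiver.Path x y) (n : ℕ), Δ.pathD ω (n + 1) ∘ₗ Δ.pathD ω n = 0) ∧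
    ∃ (i : ∀ n, Δ.NonCycleCohomology n →ₗ[k] E n)
      (p : ∀ n, E n →ₗ[k] D n × Δ.PosCycleCohomology n)
      (conn : ∀ n, D n × Δ.PosCycleCohomology n →ₗ[k] Δ.NonCycleCohomology (n + 1))
      (θ : Δ.NonCycleCohomology 1 ≃ₗ[k] Δ.bimodEnd),
      (∀ n, Function.Exact (i n) (p n)) ∧
      (∀ n, Function.Exact (p n) (conn n)) ∧
      (∀ n, Function.Exact (conn n) (i (n + 1))) ∧
      (Subsingleton (Δ.NonCycleCohomology 0) ∧ Subsingleton (Δ.PosCycleCohomology 0) ∧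
        Subsingleton (Δ.PosCycleCohomology 1)) ∧
      (let p₀ : E 0 →ₗ[k] D 0 := LinearMap.fst k _ _ ∘ₗ p 0
       let conn₀ : D 0 →ₗ[k] Δ.bimodEnd :=
        θ.toLinearMap ∘ₗ conn 0 ∘ₗ LinearMap.inl k _ _
       let i₁ : Δ.bimodEnd →ₗ[k] E 1 := i 1 ∘ₗ θ.symm.toLinearMap
       let p₁ : E 1 →ₗ[k] D 1 := LinearMap.fst k _ _ ∘ₗ p 1
       let conn₁ : D 1 →ₗ[k] Δ.NonCycleCohomology 2 := conn 1 ∘ₗ LinearMap.inl k _ _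
       Function.Injective p₀ ∧ Function.Exact p₀ conn₀ ∧ Function.Exact conn₀ i₁ ∧
        Function.Exact i₁ p₁ ∧ Function.Exact p₁ conn₁ ∧ Function.Exact conn₁ (i 2)) ∧
      (∀ (δ : NonCycle V 1) (f : Δ.PathCochain δ.path 1) (hf : Δ.pathD δ.path 1 f = 0)
        (m : Δ.Bimod), Δ.pathExt δ.path 1 f (fun _ => TrivSqZeroExt.inr m) =
          TrivSqZeroExt.inr ((θ (Δ.nonCycleClass δ f hf)).1 m)) ∧
      ∃ (Φ : ∀ n, E n ≃ₗ[k] HochschildComplexCohomology k Δ.Lam n)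
        (Ψ : ∀ n, D n ≃ₗ[k] HochschildComplexCohomology k Δ.Diag n),
        (∀ (n : ℕ) (δ : NonCycle V n) (f : Δ.PathCochain δ.path n)
          (hf : Δ.pathD δ.path n f = 0),
          ∃ h, Φ n (i n (Δ.nonCycleClass δ f hf)) = hochschildClass (Δ.pathExt δ.path n f) h) ∧
        (∀ (n : ℕ) (F : HochschildCochain k Δ.Lam n) (hF : hochschildD k Δ.Lam n F = 0),
          (∃ h, Ψ n (p n ((Φ n).symm (hochschildClass F hF))).1 =
            hochschildClass (Δ.diagRes n F) h) ∧
          ∀ γ : PosCycle V n, ∃ h, (p n ((Φ n).symm (hochschildClass F hF))).2 γ =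
            Δ.pathClass (Δ.pathRes γ.path n F) h) ∧
        (∀ (n : ℕ) (F : HochschildCochain k Δ.Lam n)
          (hA : hochschildD k Δ.Diag n (Δ.diagRes n F) = 0)
          (hC : ∀ γ : PosCycle V n, Δ.pathD γ.path n (Δ.pathRes γ.path n F) = 0)
          (z : D n × Δ.PosCycleCohomology n),
          Ψ n z.1 = hochschildClass (Δ.diagRes n F) hA →
          (∀ γ, z.2 γ = Δ.pathClass (Δ.pathRes γ.path n F) (hC γ)) →
          ∀ δ : NonCycle V (n + 1), ∃ h, conn n z δ =
            Δ.pathClass (Δ.pathRes δ.path (n + 1) (hochschildD k Δ.Lam n F)) h) := by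
  refine ⟨fun x y ω n => LinearMap.ext fun f => pathD_pathD hQ ω f, ?_⟩
  have Φ := fun n => (hE n).some
  have Ψ := fun n => (hD n).some
  obtain ⟨i, p, conn, hip, hpc, hci, hi, hp, hconn⟩ :=
    exists_longExactSequence_nonCycleCohomology hQ Φ Ψ
  have h0 : Subsingleton (Δ.NonCycleCohomology 0) :=
    ⟨fun a b => DFinsupp.ext fun δ => isEmptyElim δ⟩
  have h1 : Subsingleton (Δ.PosCycleCohomology 0) :=
    ⟨fun a b => DFinsupp.ext fun γ => isEmptyElim γ⟩
  have h2 : Subsingleton (Δ.PosCycleCohomology 1) :=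
    ⟨fun a b => DFinsupp.ext fun γ => ((isEmpty_posCycle_one hQ).false γ).elim⟩
  let θ := (LinearEquiv.ofBijective (Δ.endClass hQ) (endClass_bijective hQ)).symm
  refine ⟨i, p, conn, θ, hip, hpc, hci, ⟨h0, h1, h2⟩,
    exact_first_terms (Y := fun n => Δ.NonCycleCohomology n)
      (P := fun n => Δ.PosCycleCohomology n) i p conn θ hip hpc hci, ?_, Φ, Ψ, hi, hp, hconn⟩
  · intro δ f hf m
    obtain ⟨φ, hφ, h⟩ := exists_nonCycleMap_endCocycle_eq hQ δ f hf
    have hθ : θ (Δ.nonCycleClass δ f hf) = φ := by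
      rw [← hφ]
      exact LinearEquiv.ofBijective_symm_apply_apply _ _
    rw [hθ, ← h]
    rfl

end QSet

theorem mainTheorem1 {k : Type*} [Field k] {V : Type v} [Quiver.{w + 1} V] [Finite V]
    [Finite (Quiver.Total V)] (hQ : IsSimplyLaced V) (Δ : QSet.{u} k V) :
    -- the cochains along every path form a complex
    (∀ (x y : V) (ω : Quiver.Path x y) (n : ℕ), Δ.pathD ω (n + 1) ∘ₗ Δ.pathD ω n = 0) ∧
    -- the maps of the long exact sequence, and the identification of its term `⊕_δ H¹_δ(Δ)`
    ∃ (i : ∀ n, Δ.NonCycleCohomology n →ₗ[k] HH k Δ.Lam n)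
      (p : ∀ n, HH k Δ.Lam n →ₗ[k] HH k Δ.Diag n × Δ.PosCycleCohomology n)
      (conn : ∀ n, HH k Δ.Diag n × Δ.PosCycleCohomology n →ₗ[k] Δ.NonCycleCohomology (n + 1))
      (θ : Δ.NonCycleCohomology 1 ≃ₗ[k] Δ.bimodEnd),
      -- exactness in all degrees
      (∀ n, Function.Exact (i n) (p n)) ∧
      (∀ n, Function.Exact (p n) (conn n)) ∧
      (∀ n, Function.Exact (conn n) (i (n + 1))) ∧
      -- the first terms:
      -- `0 → HH⁰(Λ) → HH⁰(A) → End M → HH¹(Λ) → HH¹(A) → ⊕_δ H²_δ(Δ) → HH²(Λ)`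
      (Subsingleton (Δ.NonCycleCohomology 0) ∧ Subsingleton (Δ.PosCycleCohomology 0) ∧
        Subsingleton (Δ.PosCycleCohomology 1)) ∧
      (let p₀ : HH k Δ.Lam 0 →ₗ[k] HH k Δ.Diag 0 := LinearMap.fst k _ _ ∘ₗ p 0
       let conn₀ : HH k Δ.Diag 0 →ₗ[k] Δ.bimodEnd :=
        θ.toLinearMap ∘ₗ conn 0 ∘ₗ LinearMap.inl k _ _
       let i₁ : Δ.bimodEnd →ₗ[k] HH k Δ.Lam 1 := i 1 ∘ₗ θ.symm.toLinearMap
       let p₁ : HH k Δ.Lam 1 →ₗ[k] HH k Δ.Diag 1 := LinearMap.fst k _ _ ∘ₗ p 1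
       let conn₁ : HH k Δ.Diag 1 →ₗ[k] Δ.NonCycleCohomology 2 := conn 1 ∘ₗ LinearMap.inl k _ _
       Function.Injective p₀ ∧ Function.Exact p₀ conn₀ ∧ Function.Exact conn₀ i₁ ∧
        Function.Exact i₁ p₁ ∧ Function.Exact p₁ conn₁ ∧ Function.Exact conn₁ (i 2)) ∧
      -- `θ` sends the class of a `1`-cocycle `f : M a → M a` to its extension by zero to `M`
      (∀ (δ : NonCycle V 1) (f : Δ.PathCochain δ.path 1) (hf : Δ.pathD δ.path 1 f = 0)
        (m : Δ.Bimod), Δ.pathExt δ.path 1 f (fun _ => TrivSqZeroExt.inr m) =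
          TrivSqZeroExt.inr ((θ (Δ.nonCycleClass δ f hf)).1 m)) ∧
      -- up to the identification of `HH` with the cohomology of the Hochschild complex, the maps
      -- are induced by extension by zero and by restriction of cochains, and `conn` is the
      -- connecting homomorphism
      ∃ (Φ : ∀ n, HH k Δ.Lam n ≃ₗ[k] HochschildComplexCohomology k Δ.Lam n)
        (Ψ : ∀ n, HH k Δ.Diag n ≃ₗ[k] HochschildComplexCohomology k Δ.Diag n),
        (∀ (n : ℕ) (δ : NonCycle V n) (f : Δ.PathCochain δ.path n)
          (hf : Δ.pathD δ.path n f = 0),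
          ∃ h, Φ n (i n (Δ.nonCycleClass δ f hf)) = hochschildClass (Δ.pathExt δ.path n f) h) ∧
        (∀ (n : ℕ) (F : HochschildCochain k Δ.Lam n) (hF : hochschildD k Δ.Lam n F = 0),
          (∃ h, Ψ n (p n ((Φ n).symm (hochschildClass F hF))).1 =
            hochschildClass (Δ.diagRes n F) h) ∧
          ∀ γ : PosCycle V n, ∃ h, (p n ((Φ n).symm (hochschildClass F hF))).2 γ =
            Δ.pathClass (Δ.pathRes γ.path n F) h) ∧
        (∀ (n : ℕ) (F : HochschildCochain k Δ.Lam n)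
          (hA : hochschildD k Δ.Diag n (Δ.diagRes n F) = 0)
          (hC : ∀ γ : PosCycle V n, Δ.pathD γ.path n (Δ.pathRes γ.path n F) = 0)
          (z : HH k Δ.Diag n × Δ.PosCycleCohomology n),
          Ψ n z.1 = hochschildClass (Δ.diagRes n F) hA →
          (∀ γ, z.2 γ = Δ.pathClass (Δ.pathRes γ.path n F) (hC γ)) →
          ∀ δ : NonCycle V (n + 1), ∃ h, conn n z δ =
            Δ.pathClass (Δ.pathRes δ.path (n + 1) (hochschildD k Δ.Lam n F)) h) := by
  exact QSet.exists_longExactSequence_bimodEnd hQ (E := fun n => HH k Δ.Lam n)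
    (D := fun n => HH k Δ.Diag n) (fun n => nonempty_hh_linearEquiv k Δ.Lam n)
    (fun n => nonempty_hh_linearEquiv k Δ.Diag n)
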